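/- Let $n\ge 0$ be even. A noncrossing matching $a$ on the vertices $1,\dots,n$ is a set of arcs $(i,j)$, $i<j$, such that every vertex lies on exactly one arc and there are no arcs $(i,j),(i',j')$ with $i<i'<j<j'$. Put $S_a=\{x\in (S^2)^n : x_i=x_j \text{ for every arc } (i,j)\in a\}$, let $X_n=\bigcup_a S_a\subseteq (S^2)^n$ be the union over all noncrossing matchings (this space is homeomorphic to the $(n/2,n/2)$ Springer variety), and let $\iota_a:S_a\to X_n$ be the inclusion. Let $\gamma: X_n\to (S^2)^n$ be $\gamma(x)=((-1)^i x_i)_i$, and let $\gamma_a:S_a\to (S^2)^n$ be the map that is the antipodal map in the coordinates at left endpoints of arcs of $a$ and the identity in those at right endpoints. $H_*$ is total singular homology with complex coefficients. Give $S^2$ the cell decomposition into a point $p$ and the two-cell $c=S^2-p$. For $U\subseteq\{1,\dots,n\}$ let $l_U\in H_{2|U|}((S^2)^n)$ be the class of the product cell with $c$ in the coordinates in $U$ and $p$ in the others. A dotted noncrossing matching $M$ on $a$ is $a$ together with a set of arcs of $a$ that are called dotted; it represents the class $[M]\in H_*(S_a)$ of the product cell of $S_a$ with $c$ for each undotted arc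 and $p$ for each dotted arc. $M$ is standard if no dotted arc $(i,j)$ is nested below another arc $(i',j')$, $i'<i<j<j'$. Let $\mathcal U_M$ be the collection of the sets $U$ that consist of exactly one endpoint of each undotted arc of $M$, let $\Lambda_M(U)$ be the number of left endpoints in $U$, let $L_M=\sum_{U\in\mathcal U_M}(-1)^{\Lambda_M(U)}\,l_U$, and let $U_M$ be the set of right endpoints of the undotted arcs of $M$. Order subsets of $\{1,\dots,n\}$ of equal size by comparing the largest elements in which they differ (colexicographic order). Then: 1. The classes $l_U$ form a basis of $H_*((S^2)^n)$, and for every standard $M$ the coefficient of $l_{U_M}$ in $L_M$ is $1$, and every $U$ for which $l_U$ has a nonzero coefficient in $L_M$ satisfies $|U|=|U_M|$ and $U\le U_M$. The map $M\mapsto U_M$ is injective on standard dotted noncrossing matchings. (So the $L_M$ are unitriangular with respect to the order on undot sets.) 2. For every standard $M$, with underlying matching $a$, $(\gamma_a)_*[M]=L_M$ and $\gamma_*((\iota_a)_*[M])=\pm L_M$. 3. The family $(L_M)$, indexed by the standard dotted noncrossing matchings $M$ on $n$ vertices, is linearly independent in $H_*((S^2)^n)$. 4. The map $\gamma_*:H_*(X_n)\to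 H_*((S^2)^n)$ is injective. -/

import Mathlib

open CategoryTheory unitInterval
open scoped Simplicial DirectSum

noncomputable section

namespace SpringerTwoRow

/-! ### Singular homology with complex coefficients -/

/-- The singular homology `H_d(X; ℂ)`. -/
abbrev H (X : Type) [TopologicalSpace X] (d : ℕ) : ModuleCat.{0} ℂ :=
  ((AlgebraicTopology.singularHomologyFunctor (ModuleCat.{0} ℂ) d).obj
    (ModuleCat.of ℂ ℂ)).obj (TopCat.of X)

/-- The map `H_d(X; ℂ) → H_d(Y; ℂ)` induced by a continuous map. -/
def HMap {X Y : Type} [TopologicalSpace X] [TopologicalSpace Y] (f : C(X, Y)) (d : ℕ) :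
    H X d →ₗ[ℂ] H Y d :=
  (((AlgebraicTopology.singularHomologyFunctor (ModuleCat.{0} ℂ) d).obj
    (ModuleCat.of ℂ ℂ)).map (TopCat.ofHom f)).hom

/-- The total homology `H_*(X; ℂ)`, the direct sum of all `H_d(X; ℂ)`. -/
abbrev HTot (X : Type) [TopologicalSpace X] : Type := ⨁ d : ℕ, H X d

/-- The map `f_* : H_*(X; ℂ) → H_*(Y; ℂ)`. -/
def HTotMap {X Y : Type} [TopologicalSpace X] [TopologicalSpace Y] (f : C(X, Y)) :
    HTot X →ₗ[ℂ] HTot Y :=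
  DirectSum.lmap fun d => HMap f d

/-! ### The homology class of a cube whose opposite faces are identified -/

/-- The affine simplex of the cube `[0,1]^m` with vertices
`0, e_{π 0}, e_{π 0} + e_{π 1}, …, e_{π 0} + ⋯ + e_{π (m-1)}`. In barycentric coordinates `s` its
`i`-th coordinate is the sum of the `s j` with `π⁻¹ i < j`. -/
def cubeSimplex {m : ℕ} (π : Equiv.Perm (Fin m)) :
    C(stdSimplex ℝ (Fin (m + 1)), Fin m → I) where
  toFun s i := ⟨∑ j with (π.symm i).castSucc < j, s j,
    Finset.sum_nonneg fun j _ => s.2.1 j,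
    (Finset.sum_le_univ_sum_of_nonneg fun j => s.2.1 j).trans s.2.2.le⟩
  continuous_toFun := by
    refine continuous_pi fun i => Continuous.subtype_mk ?_ _
    exact continuous_finsetSum _ fun j _ => (continuous_apply j).comp continuous_subtype_val

/-- The singular chain complex of `X` with complex coefficients. -/
abbrev singularChains (X : Type) [TopologicalSpace X] : ChainComplex (ModuleCat.{0} ℂ) ℕ :=
  (TopCat.toSSet.obj (TopCat.of X)).chainComplex (ModuleCat.of ℂ ℂ)

/-- The singular chain `∑_π sign(π) [f ∘ σ_π]`, the image under `f : [0,1]^m → X` of the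
standard triangulation of the cube into `m!` simplices, as a morphism from the coefficients `ℂ`
into the module of singular `m`-chains of `X`. -/
def cubeChain {X : Type} [TopologicalSpace X] {m : ℕ} (f : C(Fin m → I, X)) :
    ModuleCat.of ℂ ℂ ⟶ (singularChains X).X m :=
  ∑ π : Equiv.Perm (Fin m), (Equiv.Perm.sign π : ℤ) •
    (TopCat.toSSet.obj (TopCat.of X)).ιChainComplex
      (((TopCat.of X).toSSetObjEquiv (.op ⦋m⦌)).symm (f.comp (cubeSimplex π)))

/-- `f` takes the same values on opposite faces of the cube. -/
def IsClosedCube {X : Type} [TopologicalSpace X] {m : ℕ} (f : C(Fin m → I, X)) : Prop :=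
  ∀ (t : Fin m → I) (i : Fin m), f (Function.update t i 0) = f (Function.update t i 1)

/-- The `q`-th face of `f ∘ σ_π`. -/
def cubeFace {X : Type} [TopologicalSpace X] {m : ℕ} (f : C(Fin (m + 1) → I, X))
    (q : Fin (m + 2)) (π : Equiv.Perm (Fin (m + 1))) : C(stdSimplex ℝ (Fin (m + 1)), X) :=
  (f.comp (cubeSimplex π)).comp ⟨_, stdSimplex.continuous_map q.succAbove⟩

theorem toSSet_face {X : Type} [TopologicalSpace X] {m : ℕ} (f : C(Fin (m + 1) → I, X))
    (q : Fin (m + 2)) (π : Equiv.Perm (Fin (m + 1))) :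
    (TopCat.toSSet.obj (TopCat.of X)).δ q
      (((TopCat.of X).toSSetObjEquiv (.op ⦋m + 1⦌)).symm (f.comp (cubeSimplex π))) =
    ((TopCat.of X).toSSetObjEquiv (.op ⦋m⦌)).symm (cubeFace f q π) := by
  rfl

theorem cubeSimplex_face {m : ℕ} (π : Equiv.Perm (Fin (m + 1))) (q : Fin (m + 2))
    (s : stdSimplex ℝ (Fin (m + 1))) (i : Fin (m + 1)) :
    (cubeSimplex π (stdSimplex.map q.succAbove s) i : ℝ) =
      ∑ l with (π.symm i).castSucc < q.succAbove l, s l := by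
  simp only [cubeSimplex, ContinuousMap.coe_mk, stdSimplex.map_coe]
  simp only [FunOnFinite.linearMap_apply_apply]
  rw [Finset.sum_sigma']
  refine Finset.sum_bij' (fun x _ => x.2) (fun l _ => ⟨q.succAbove l, l⟩) ?_ ?_ ?_ ?_ ?_ <;>
    simp +contextual

theorem cubeFace_inner {X : Type} [TopologicalSpace X] {m : ℕ} (f : C(Fin (m + 1) → I, X))
    (r : Fin m) (π : Equiv.Perm (Fin (m + 1))) :
    cubeFace f r.succ.castSucc (π * Equiv.swap r.castSucc r.succ) =
      cubeFace f r.succ.castSucc π := by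
  ext s
  change f _ = f _
  congr 1
  ext i
  refine (cubeSimplex_face _ _ s i).trans (Eq.trans ?_ (cubeSimplex_face _ _ s i).symm)
  congr 1
  ext l
  have h : (π * Equiv.swap r.castSucc r.succ).symm i
      = Equiv.swap r.castSucc r.succ (π.symm i) := rfl
  rw [h]
  generalize π.symm i = p
  simp only [Finset.mem_filter, Finset.mem_univ, true_and]
  rw [Equiv.swap_apply_def]
  simp only [Fin.succAbove, Fin.lt_def, Fin.ext_iff]
  split_ifs <;> simp_all <;> omega

theorem cubeFace_outer {X : Type} [TopologicalSpace X] {m : ℕ} (f : C(Fin (m + 1) → I, X))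
    (hf : IsClosedCube f) (π : Equiv.Perm (Fin (m + 1))) :
    cubeFace f (Fin.last (m + 1)) (π * finRotate (m + 1)) = cubeFace f 0 π := by
  ext s
  change f _ = f _
  have key := hf (cubeSimplex (π * finRotate (m + 1))
    (stdSimplex.map (Fin.last (m + 1)).succAbove s)) (π 0)
  have hp : ∀ i, (π * finRotate (m + 1)).symm i = (finRotate (m + 1)).symm (π.symm i) :=
    fun _ => rfl
  refine Eq.trans (congrArg f ?_) (key.trans (congrArg f ?_))
  · symm
    refine Function.update_eq_self_iff.mpr ?_
    ext
    rw [cubeSimplex_face, hp, Equiv.symm_apply_apply]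
    have : (finRotate (m + 1)).symm 0 = Fin.last m := by
      rw [Equiv.symm_apply_eq, finRotate_last]
    rw [this]
    symm
    apply Finset.sum_eq_zero
    intro l hl
    simp [Fin.lt_def] at hl
    omega
  · funext i
    ext
    by_cases hi : i = π 0
    · subst hi
      rw [Function.update_self]
      refine Eq.trans ?_ (cubeSimplex_face _ _ s _).symm
      simp [Fin.lt_def]
    · rw [Function.update_of_ne hi]
      refine (cubeSimplex_face _ _ s i).trans (Eq.trans ?_ (cubeSimplex_face _ _ s i).symm)
      congr 1
      ext l
      rw [hp]
      have h0 : π.symm i ≠ 0 := fun h => hi (by rw [← h, Equiv.apply_symm_apply])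
      obtain ⟨p, hpp⟩ := Fin.exists_succ_eq.mpr h0
      rw [← hpp]
      have : (finRotate (m + 1)).symm p.succ = p.castSucc := by
        rw [Equiv.symm_apply_eq, finRotate_apply]
        simp
      rw [this]
      simp [Fin.lt_def]

theorem cubeChain_d {X : Type} [TopologicalSpace X] {m : ℕ} (f : C(Fin m → I, X))
    (hf : IsClosedCube f) :
    cubeChain f ≫ (singularChains X).d m ((ComplexShape.down ℕ).next m) = 0 := by
  cases m with
  | zero =>
    rw [HomologicalComplex.shape, Limits.comp_zero]
    simp
  | succ m =>
    rw [show (ComplexShape.down ℕ).next (m + 1) = m from ChainComplex.next_nat_succ m]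
    let F : C(stdSimplex ℝ (Fin (m + 1)), X) →
        (ModuleCat.of ℂ ℂ ⟶ (singularChains X).X m) := fun g =>
      (TopCat.toSSet.obj (TopCat.of X)).ιChainComplex
        (((TopCat.of X).toSSetObjEquiv (.op ⦋m⦌)).symm g)
    have hd : ∀ π : Equiv.Perm (Fin (m + 1)),
        (TopCat.toSSet.obj (TopCat.of X)).ιChainComplex
          (((TopCat.of X).toSSetObjEquiv (.op ⦋m + 1⦌)).symm (f.comp (cubeSimplex π))) ≫
        (singularChains X).d (m + 1) m =
        ∑ q : Fin (m + 2), (-1 : ℤ) ^ q.val • F (cubeFace f q π) := fun π =>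
      SSet.ιChainComplex_d _ _ _
    unfold cubeChain
    rw [Preadditive.sum_comp]
    simp only [Preadditive.zsmul_comp, hd, Finset.smul_sum]
    rw [Finset.sum_comm, Fin.sum_univ_succ, Fin.sum_univ_castSucc]
    have hin : ∀ r : Fin m, ∑ π : Equiv.Perm (Fin (m + 1)), (Equiv.Perm.sign π : ℤ) •
        (-1 : ℤ) ^ (r.castSucc.succ).val • F (cubeFace f r.castSucc.succ π) = 0 := by
      intro r
      have hne : r.castSucc ≠ r.succ := Fin.castSucc_lt_succ.ne
      refine Finset.sum_involution (fun π _ => π * Equiv.swap r.castSucc r.succ) ?_ ?_ ?_ ?_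
      · intro π _
        rw [Fin.succ_castSucc, cubeFace_inner]
        simp [Equiv.Perm.sign_mul, hne]
      · intro π _ _ h
        exact hne (Equiv.swap_eq_one_iff.mp (mul_eq_left.mp h))
      · simp
      · simp [mul_assoc]
    have hlast : ∑ π : Equiv.Perm (Fin (m + 1)), (Equiv.Perm.sign π : ℤ) •
        (-1 : ℤ) ^ ((Fin.last m).succ).val • F (cubeFace f (Fin.last m).succ π) =
        - ∑ π : Equiv.Perm (Fin (m + 1)), (Equiv.Perm.sign π : ℤ) • F (cubeFace f 0 π) := by
      rw [← Equiv.sum_comp (Equiv.mulRight (finRotate (m + 1))), ← Finset.sum_neg_distrib]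
      refine Finset.sum_congr rfl fun π _ => ?_
      simp only [Equiv.coe_mulRight, Fin.succ_last, cubeFace_outer f hf, smul_smul,
        Equiv.Perm.sign_mul, sign_finRotate, Fin.val_last, ← neg_smul]
      congr 1
      rw [Nat.succ_eq_add_one, pow_succ]
      push_cast
      have : ((-1 : ℤ) ^ m) * (-1) ^ m = 1 := by rw [← mul_pow]; simp
      linear_combination (-(Equiv.Perm.sign π : ℤ)) * this
    rw [Finset.sum_eq_zero (fun r _ => hin r), hlast]
    simp

/-- The homology class of the image of the fundamental chain of the cube `[0,1]^m` under a map
`f : [0,1]^m → X` which takes the same values on opposite faces. -/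
def cubeClass {X : Type} [TopologicalSpace X] {m : ℕ} (f : C(Fin m → I, X))
    (hf : IsClosedCube f) : H X m :=
  ((singularChains X).liftCycles (cubeChain f) _ rfl (cubeChain_d f hf) ≫
    (singularChains X).homologyπ m).hom (1 : ℂ)

/-! ### Noncrossing matchings -/

/-- A noncrossing matching on the vertices `0, …, n-1`, given by its arcs `(i, j)` with `i < j`:
every vertex lies on exactly one arc, and no two arcs cross. -/
@[ext]
structure Matching (n : ℕ) where
  arcs : Finset (Fin n × Fin n)
  lt : ∀ e ∈ arcs, e.1 < e.2
  existsUnique_arc : ∀ v, ∃! e, e ∈ arcs ∧ (v = e.1 ∨ v = e.2)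
  noncrossing : ∀ e ∈ arcs, ∀ e' ∈ arcs, ¬ (e.1 < e'.1 ∧ e'.1 < e.2 ∧ e.2 < e'.2)

/-- The arc through the vertex `v`. -/
def Matching.arc {n : ℕ} (a : Matching n) (v : Fin n) : Fin n × Fin n :=
  (a.existsUnique_arc v).choose

theorem Matching.arc_eq {n : ℕ} (a : Matching n) {v : Fin n} {e : Fin n × Fin n}
    (he : e ∈ a.arcs) (hv : v = e.1 ∨ v = e.2) : a.arc v = e :=
  (a.existsUnique_arc v).unique (a.existsUnique_arc v).choose_spec.1 ⟨he, hv⟩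

/-- A dotted noncrossing matching: some of the arcs carry a dot. -/
@[ext]
structure DottedMatching (n : ℕ) extends Matching n where
  dotted : Finset (Fin n × Fin n)
  dotted_subset : dotted ⊆ arcs

namespace DottedMatching

variable {n : ℕ} (M : DottedMatching n)

/-- The arcs without a dot. -/
def undotted : Finset (Fin n × Fin n) := M.arcs \ M.dotted

/-- No dotted arc is nested below another arc. -/
def IsStandard : Prop :=
  ∀ e ∈ M.dotted, ∀ e' ∈ M.arcs, ¬ (e'.1 < e.1 ∧ e.2 < e'.2)

/-- The set `U_M` of the right endpoints of the undotted arcs. -/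
def rightUndot : Finset (Fin n) := M.undotted.image Prod.snd

/-- `𝒰_M`: the sets of vertices that consist of exactly one endpoint of each undotted arc. -/
def undotSets : Finset (Finset (Fin n)) :=
  {U | (∀ v ∈ U, ∃ e ∈ M.undotted, v = e.1 ∨ v = e.2) ∧
    ∀ e ∈ M.undotted, (e.1 ∈ U ↔ e.2 ∉ U)}

/-- `Λ_M(U)`: the number of left endpoints of arcs in `U`. -/
def leftCount (U : Finset (Fin n)) : ℕ := (U.filter fun v => ∃ e ∈ M.arcs, v = e.1).card

end DottedMatching

/-! ### The spaces and the maps between them -/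

/-- The two-sphere, the unit sphere of `ℝ³`. -/
abbrev S2 : Type := Metric.sphere (0 : EuclideanSpace ℝ (Fin 3)) 1

/-- `S_a`: the points of `(S²)^n` whose coordinates at the two ends of each arc of `a` agree. -/
def Matching.component {n : ℕ} (a : Matching n) : Set (Fin n → S2) :=
  {x | ∀ e ∈ a.arcs, x e.1 = x e.2}

/-- `X_n`, the union of the `S_a` over all noncrossing matchings `a`. -/
def springer (n : ℕ) : Set (Fin n → S2) := ⋃ a : Matching n, a.component

/-- The inclusion of `S_a` into `X_n`. -/
def Matching.incl {n : ℕ} (a : Matching n) : C(a.component, springer n) where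
  toFun := Set.inclusion (Set.subset_iUnion Matching.component a)
  continuous_toFun := continuous_inclusion _

/-- `γ : X_n → (S²)^n`, `x ↦ ((-1)^i x_i)_i` where the coordinates are numbered from `1`; the
vertex `i : Fin n` has the number `i + 1`. -/
def gammaMap (n : ℕ) : C(springer n, Fin n → S2) where
  toFun x i := if Even ((i : ℕ) + 1) then x.1 i else -x.1 i
  continuous_toFun := by
    refine continuous_pi fun i => ?_
    have h : Continuous fun x : springer n => x.1 i :=
      (continuous_apply i).comp continuous_subtype_val
    split_ifs
    exacts [h, h.neg]

/-- `γ_a : S_a → (S²)^n`, the antipodal map in the coordinates at left endpoints of arcs and the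
identity in those at right endpoints. -/
def Matching.gammaMap {n : ℕ} (a : Matching n) : C(a.component, Fin n → S2) where
  toFun x i := if ∃ e ∈ a.arcs, i = e.1 then -x.1 i else x.1 i
  continuous_toFun := by
    refine continuous_pi fun i => ?_
    have h : Continuous fun x : a.component => x.1 i :=
      (continuous_apply i).comp continuous_subtype_val
    split_ifs
    exacts [h.neg, h]

/-! ### The product cells and their homology classes -/

/-- The zero-cell `p` of `S²`. -/
def basePt : S2 := ⟨!₂[0, 0, 1], by simp [EuclideanSpace.norm_eq, Fin.sum_univ_three]⟩

theorem cellMap_aux (u v : ℝ) : u ^ 2 + v ^ 2 + ((1 - u ^ 2) * (1 - v ^ 2)) ^ 2 ≠ 0 := by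
  intro h
  have hu : u = 0 := by
    nlinarith [sq_nonneg u, sq_nonneg v, sq_nonneg ((1 - u ^ 2) * (1 - v ^ 2))]
  have hv : v = 0 := by
    nlinarith [sq_nonneg u, sq_nonneg v, sq_nonneg ((1 - u ^ 2) * (1 - v ^ 2))]
  simp [hu, hv] at h

/-- The characteristic map `[0,1]² → S²` of the two-cell `c = S² - p`. With `u = 2a - 1`,
`v = 2b - 1` and `w = (1 - u²)(1 - v²)` it is the inverse of the stereographic projection from `p`,
applied to the point `(u / w, v / w)` of the plane, with denominators cleared. It maps the open
square bijectively onto `S² - p` and the boundary of the square to `p`. -/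
def cellMap (a b : I) : S2 :=
  let u : ℝ := 2 * a - 1
  let v : ℝ := 2 * b - 1
  let w : ℝ := (1 - u ^ 2) * (1 - v ^ 2)
  let d : ℝ := u ^ 2 + v ^ 2 + w ^ 2
  ⟨!₂[2 * w * u / d, 2 * w * v / d, (u ^ 2 + v ^ 2 - w ^ 2) / d], by
    have hd : d ≠ 0 := cellMap_aux u v
    rw [mem_sphere_zero_iff_norm, EuclideanSpace.norm_eq, Real.sqrt_eq_one]
    simp only [Fin.sum_univ_three, Real.norm_eq_abs, sq_abs]
    simp
    field_simp
    ring⟩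

theorem cellMap_continuous : Continuous fun t : I × I => cellMap t.1 t.2 := by
  refine Continuous.subtype_mk ?_ _
  refine (PiLp.continuous_toLp 2 _).comp (continuous_pi fun i => ?_)
  have hd : ∀ t : I × I, (2 * (t.1 : ℝ) - 1) ^ 2 + (2 * (t.2 : ℝ) - 1) ^ 2 +
      ((1 - (2 * (t.1 : ℝ) - 1) ^ 2) * (1 - (2 * (t.2 : ℝ) - 1) ^ 2)) ^ 2 ≠ 0 :=
    fun t => cellMap_aux _ _
  fin_cases i <;> refine Continuous.div ?_ ?_ hd <;> fun_prop

theorem cellMap_boundary (a b : I) (h : a = 0 ∨ a = 1 ∨ b = 0 ∨ b = 1) :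
    cellMap a b = basePt := by
  have hw : (1 - (2 * (a : ℝ) - 1) ^ 2) * (1 - (2 * (b : ℝ) - 1) ^ 2) = 0 := by
    rcases h with rfl | rfl | rfl | rfl <;> norm_num
  have hd := cellMap_aux (2 * (a : ℝ) - 1) (2 * (b : ℝ) - 1)
  apply Subtype.ext
  simp only [cellMap, basePt, hw]
  rw [hw] at hd
  ext i
  fin_cases i <;> simp
  simpa using hd

/-- The characteristic map of the two-cell `c` as a continuous map. -/
def twoCell : C(I × I, S2) := ⟨fun t => cellMap t.1 t.2, cellMap_continuous⟩

theorem twoCell_boundary (a b : I) (h : a = 0 ∨ a = 1 ∨ b = 0 ∨ b = 1) :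
    twoCell (a, b) = basePt :=
  cellMap_boundary a b h

/-- The map from the cube `[0,1]^(2k)` to `(S²)^n` whose coordinate at a vertex `v` is `p` if
`lab v = none`, and the characteristic map of `c` in the `j`-th pair of coordinates of the cube if
`lab v = some j`. -/
def prodCell {n k : ℕ} (lab : Fin n → Option (Fin k)) :
    C(Fin (2 * k) → I, Fin n → S2) where
  toFun t v := (lab v).elim basePt fun j =>
    twoCell (t ⟨2 * j, by omega⟩, t ⟨2 * j + 1, by omega⟩)
  continuous_toFun := by
    refine continuous_pi fun v => ?_
    cases lab v with
    | none => exact continuous_const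
    | some j =>
      simp only [Option.elim_some]
      have h : Continuous fun t : Fin (2 * k) → I =>
          ((t ⟨2 * j, by omega⟩, t ⟨2 * j + 1, by omega⟩) : I × I) :=
        (continuous_apply _).prodMk (continuous_apply _)
      exact twoCell.continuous.comp h

theorem prodCell_closed {n k : ℕ} (lab : Fin n → Option (Fin k)) :
    IsClosedCube (prodCell lab) := by
  intro t i
  funext v
  simp only [prodCell, ContinuousMap.coe_mk]
  cases lab v with
  | none => rfl
  | some j =>
    simp only [Option.elim_some]
    by_cases h0 : i = ⟨2 * j, by omega⟩
    · rw [twoCell_boundary _ _ (.inl (by rw [h0, Function.update_self])),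
        twoCell_boundary _ _ (.inr (.inl (by rw [h0, Function.update_self])))]
    by_cases h1 : i = ⟨2 * j + 1, by omega⟩
    · rw [twoCell_boundary _ _ (.inr (.inr (.inl (by rw [h1, Function.update_self])))),
        twoCell_boundary _ _ (.inr (.inr (.inr (by rw [h1, Function.update_self]))))]
    · simp only [Function.update_of_ne (Ne.symm h0), Function.update_of_ne (Ne.symm h1)]

/-- The position of `v` among the elements of `U`, in increasing order; `none` if `v ∉ U`. -/
def position {n : ℕ} (U : Finset (Fin n)) (v : Fin n) : Option (Fin U.card) :=
  if h : v ∈ U then some ((U.orderIsoOfFin rfl).symm ⟨v, h⟩) else none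

/-- The class `l_U ∈ H_*((S²)^n)` of the product cell that has the two-cell `c` in the coordinates
in `U` and the point `p` in all others (the line diagram with undot set `U`). -/
def lineDiagram {n : ℕ} (U : Finset (Fin n)) : HTot (Fin n → S2) :=
  DirectSum.lof ℂ ℕ (fun d => H (Fin n → S2) d) (2 * U.card)
    (cubeClass (prodCell (position U)) (prodCell_closed _))

namespace DottedMatching

variable {n : ℕ} (M : DottedMatching n)

theorem cell_mem (t : Fin (2 * M.rightUndot.card) → I) :
    prodCell (fun v => position M.rightUndot (M.arc v).2) t ∈ M.component := by
  intro e he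
  simp only [prodCell, ContinuousMap.coe_mk]
  rw [M.arc_eq he (.inl rfl), M.arc_eq he (.inr rfl)]

/-- The product cell of `S_a` given by the dotted matching `M` on `a`: the coordinates at both ends
of the `j`-th undotted arc run through the `j`-th copy of the two-cell `c`, and the coordinates at
the ends of dotted arcs are `p`. The undotted arcs are listed by their right endpoints. -/
def cell : C(Fin (2 * M.rightUndot.card) → I, M.component) where
  toFun t := ⟨prodCell (fun v => position M.rightUndot (M.arc v).2) t, M.cell_mem t⟩
  continuous_toFun := (ContinuousMap.continuous _).subtype_mk M.cell_mem

/-- The homology generator `[M] ∈ H_*(S_a)` given by the dotted matching `M` on `a`. -/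
def homologyClass : HTot M.component :=
  DirectSum.lof ℂ ℕ (fun d => H M.component d) (2 * M.rightUndot.card)
    (cubeClass M.cell fun t i => Subtype.ext (prodCell_closed _ t i))

/-- The line diagram sum `L_M = ∑_{U ∈ 𝒰_M} (-1)^{Λ_M(U)} l_U`. -/
def lineDiagramSum : HTot (Fin n → S2) :=
  ∑ U ∈ M.undotSets, (-1 : ℂ) ^ M.leftCount U • lineDiagram U

end DottedMatching

end SpringerTwoRow
end

open SpringerTwoRow

/-!
The total homology of a space is computed from ungraded singular chains `Chain X`: the kernel of
`bd` modulo its image is `HTot X`, by `totClass_surjective` and `totClass_eq_zero_iff`. Prisms and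
barycentric subdivision are defined by cone recursions on formal sums of lists of points of convex
spaces and transported to singular chains along `realize`; they give homotopy invariance
(`HomologousIn.of_homotopy`), small chains (`exists_sd_pow_mem`), a Mayer-Vietoris relation (`MVRel`)
and an excision argument (`excision`).

**Homology of products with the sphere.** The cross product `cross A` sweeps a chain of `A` over the
characteristic map of the two-cell. Two Mayer-Vietoris steps, for coverings of the sphere by the
complements of two rays and then of two half-planes, define a slant product `SphereRel` that inverts
it. So a cycle of `A × S²` is, up to homology, the sum of a cycle of `A` and a cross product, in a
unique way (`exists_homologous_add_cross`, `homologous_zero_of_add_cross`). The slant product also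
shows that the antipodal map reverses the sign of the cross product and that the antidiagonal sphere
`s ↦ (-s, s)` of `S² × S²` is the difference of the two factors (`homologous_antidiag_cross`).

**The basis and the line diagram sums.** The fundamental chain of a cube is an iterated prism
(`cubeCh_succ`), so the classes `l_U` are iterated cross products with spheres (`setClass`), and they
form a basis by induction on `n` (`exists_basis_setClass`). Under `γ_a`, the sphere of an undotted
arc becomes an antidiagonal sphere in the coordinates of its ends, which is the difference of the
spheres at the right and the left end; multiplying out gives the line diagram sum
(`gammaMap_homologyClass`). Under `γ` some arcs have their signs reversed, because the ends of an arc
have different parity (`gammaMap_incl_homologyClass`). Replacing a right endpoint by a left one lowers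
a set of vertices in the colexicographic order, and a standard dotted matching is determined by
its right endpoints (`rightUndot_injOn`), which gives unitriangularity and linear independence.

**Injectivity.** The map `γ` is the inclusion of `X_n` followed by a homeomorphism, so it suffices
to treat the inclusion. Regard a point of `(S²)^n` as a word in the free product of groups of order
two indexed by the points of the sphere. A point belongs to `X_n` if and only if its word reduces to
the empty word (`mem_springer_iff`). More generally, `level n k` consists of the words whose reduced
form has length at most `n - 2k`, and by induction on `n` all inclusions `level n k → (S²)^n` are
injective in homology (`levelInjective`). Forgetting the first coordinate maps `level (n + 1) (k + 1)`
to `level n k`. Over `level n (k + 1)` the first coordinate is arbitrary, and elsewhere it is the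
first letter of the reduced word. Hence, by excision, a cycle whose image in `(S²)^(n+1)` bounds can
be moved over a neighbourhood of `level n (k + 1)`. The levels are given by equations between
coordinates, and merging nearby coordinates (`gather`) deforms this part to
`level n (k + 1) × S²`, where the decomposition into a cycle and a cross product and the induction
hypotheses apply.
-/

open CategoryTheory unitInterval
open scoped Simplicial DirectSum

noncomputable section

namespace SpringerTwoRow

/-! ### Homology of a complex of modules, by elements -/

section Complexes

variable (K L : ChainComplex (ModuleCat.{0} ℂ) ℕ)

/-- The projection of the `n`-cycles of `K` onto the homology. -/
def cycleClass (n : ℕ) :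
    LinearMap.ker (K.d n ((ComplexShape.down ℕ).next n)).hom →ₗ[ℂ] K.homology n :=
  ((K.sc n).moduleCatLeftHomologyData.π ≫ (K.sc n).moduleCatHomologyIso.inv).hom

theorem cycleClass_surjective (n : ℕ) : Function.Surjective (cycleClass K n) := by
  intro y
  obtain ⟨x, hx⟩ := (Submodule.mkQ_surjective _) ((K.sc n).moduleCatHomologyIso.hom.hom y)
  refine ⟨x, ?_⟩
  have : (K.sc n).moduleCatHomologyIso.inv.hom
      ((K.sc n).moduleCatHomologyIso.hom.hom y) = y := by
    exact congr(($((K.sc n).moduleCatHomologyIso.hom_inv_id)).hom y)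
  rw [← this, ← hx]
  rfl

theorem cycleClass_eq_zero_iff (n : ℕ)
    (x : LinearMap.ker (K.d n ((ComplexShape.down ℕ).next n)).hom) :
    cycleClass K n x = 0 ↔ ∃ y, (K.d (n + 1) n).hom y = x.1 := by
  have hinj : Function.Injective (K.sc n).moduleCatHomologyIso.inv.hom :=
    (ModuleCat.mono_iff_injective _).1 inferInstance
  have h1 : cycleClass K n x = 0 ↔ ∃ y : (K.sc n).X₁, (K.sc n).moduleCatToCycles y = x :=
    ⟨fun h => (Submodule.Quotient.mk_eq_zero
        (LinearMap.range (K.sc n).moduleCatToCycles)).1 (hinj (h.trans (map_zero _).symm)),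
      fun h => (congrArg (K.sc n).moduleCatHomologyIso.inv.hom
        ((Submodule.Quotient.mk_eq_zero (LinearMap.range (K.sc n).moduleCatToCycles)).2 h)).trans
        (map_zero _)⟩
  rw [h1]
  have hp : (ComplexShape.down ℕ).prev n = n + 1 := ChainComplex.prev ℕ n
  have h2 : (∃ y, (K.d (n + 1) n).hom y = x.1) ↔
      ∃ y, (K.d ((ComplexShape.down ℕ).prev n) n).hom y = x.1 := by
    rw [hp]
  rw [h2]
  exact exists_congr fun y => ⟨fun h => congrArg Subtype.val h, fun h => Subtype.ext h⟩

variable {K L}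

theorem cycleClass_iCycles (n : ℕ)
    (x : LinearMap.ker (K.d n ((ComplexShape.down ℕ).next n)).hom) :
    ∃ c : K.cycles n, (K.iCycles n).hom c = x.1 ∧ cycleClass K n x = (K.homologyπ n).hom c := by
  refine ⟨(K.sc n).moduleCatCyclesIso.inv.hom x, ?_, ?_⟩
  · exact congr(($((K.sc n).moduleCatCyclesIso_inv_iCycles)).hom x)
  · exact congr(($((K.sc n).moduleCatCyclesIso_inv_π.symm)).hom x)

theorem iCycles_injective (n : ℕ) : Function.Injective (K.iCycles n).hom :=
  (ModuleCat.mono_iff_injective _).1 inferInstance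

theorem homologyMap_cycleClass (f : K ⟶ L) (n : ℕ)
    (x : LinearMap.ker (K.d n ((ComplexShape.down ℕ).next n)).hom)
    (y : LinearMap.ker (L.d n ((ComplexShape.down ℕ).next n)).hom)
    (h : (f.f n).hom x.1 = y.1) :
    (HomologicalComplex.homologyMap f n).hom (cycleClass K n x) = cycleClass L n y := by
  obtain ⟨c, hc, hx⟩ := cycleClass_iCycles n x
  obtain ⟨c', hc', hy⟩ := cycleClass_iCycles n y
  rw [hx, hy]
  have h1 := congr(($(HomologicalComplex.homologyπ_naturality f n)).hom c)
  simp only [ModuleCat.hom_comp, LinearMap.comp_apply] at h1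
  rw [h1]
  congr 1
  apply iCycles_injective
  have h2 := congr(($(HomologicalComplex.cyclesMap_i f n)).hom c)
  simp only [ModuleCat.hom_comp, LinearMap.comp_apply] at h2
  rw [h2, hc, hc', h]

theorem liftCycles_class (n : ℕ) (k : ModuleCat.of ℂ ℂ ⟶ K.X n)
    (hk : k ≫ K.d n ((ComplexShape.down ℕ).next n) = 0)
    (y : LinearMap.ker (K.d n ((ComplexShape.down ℕ).next n)).hom) (h : k.hom (1 : ℂ) = y.1) :
    (K.liftCycles k _ rfl hk ≫ K.homologyπ n).hom (1 : ℂ) = cycleClass K n y := by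
  obtain ⟨c', hc', hy⟩ := cycleClass_iCycles n y
  rw [hy, ModuleCat.hom_comp, LinearMap.comp_apply]
  congr 1
  apply iCycles_injective
  rw [hc', ← h]
  exact congr(($(K.liftCycles_i k _ rfl hk)).hom (1 : ℂ))

end Complexes

/-! ### Ungraded singular chains -/

/-- The singular simplices of `X`, of all dimensions. -/
abbrev Simp (X : Type) [TopologicalSpace X] : Type :=
  Σ n : ℕ, C(stdSimplex ℝ (Fin (n + 1)), X)

/-- The singular chains of `X`, of all dimensions together. The boundary operator and the homotopy
formulas below do not mention the dimension, so that no index arithmetic is needed. -/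
abbrev Chain (X : Type) [TopologicalSpace X] : Type := Simp X →₀ ℂ

/-- The `i`-th face of the standard simplex. -/
def faceMap {n : ℕ} (i : Fin (n + 2)) :
    C(stdSimplex ℝ (Fin (n + 1)), stdSimplex ℝ (Fin (n + 2))) :=
  ⟨stdSimplex.map i.succAbove, stdSimplex.continuous_map _⟩

section Chains

variable {X Y Z : Type} [TopologicalSpace X] [TopologicalSpace Y] [TopologicalSpace Z]

/-- The boundary of a singular simplex. -/
def bdSimp (s : Simp X) : Chain X :=
  match s with
  | ⟨0, _⟩ => 0
  | ⟨n + 1, τ⟩ => ∑ i : Fin (n + 2), (-1 : ℂ) ^ (i : ℕ) •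
      Finsupp.single ⟨n, τ.comp (faceMap i)⟩ 1

variable (X) in
/-- The boundary operator on the ungraded singular chains. -/
def bd : Chain X →ₗ[ℂ] Chain X := Finsupp.linearCombination ℂ bdSimp

theorem bd_single (s : Simp X) : bd X (Finsupp.single s 1) = bdSimp s := by
  simp [bd]

/-- The chain map induced by a continuous map. -/
def push (f : C(X, Y)) : Chain X →ₗ[ℂ] Chain Y :=
  Finsupp.lmapDomain ℂ ℂ fun s => ⟨s.1, f.comp s.2⟩

theorem push_single (f : C(X, Y)) (s : Simp X) (r : ℂ) :
    push f (Finsupp.single s r) = Finsupp.single ⟨s.1, f.comp s.2⟩ r := by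
  simp [push]

/-- Two linear maps on singular chains agree if they agree on simplices. -/
theorem chain_hom_ext {V : Type*} [AddCommGroup V] [Module ℂ V] {f g : Chain X →ₗ[ℂ] V}
    (h : ∀ n (τ : C(stdSimplex ℝ (Fin (n + 1)), X)),
      f (Finsupp.single ⟨n, τ⟩ 1) = g (Finsupp.single ⟨n, τ⟩ 1)) : f = g := by
  refine Finsupp.lhom_ext' fun s => LinearMap.ext_ring ?_
  simpa using h s.1 s.2

theorem push_comp (g : C(Y, Z)) (f : C(X, Y)) (c : Chain X) :
    push g (push f c) = push (g.comp f) c := by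
  have : (push g).comp (push f) = push (g.comp f) :=
    chain_hom_ext fun n τ => by simp [push_single, ContinuousMap.comp_assoc]
  exact congr($this c)

theorem push_id (c : Chain X) : push (ContinuousMap.id X) c = c := by
  have : push (ContinuousMap.id X) = LinearMap.id :=
    chain_hom_ext fun n τ => by simp [push_single]
  exact congr($this c)

theorem bd_push (f : C(X, Y)) (c : Chain X) : bd Y (push f c) = push f (bd X c) := by
  have : (bd Y).comp (push f) = (push f).comp (bd X) := by
    refine chain_hom_ext fun n τ => ?_
    simp only [LinearMap.comp_apply, push_single, bd_single]
    cases n with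
    | zero => simp [bdSimp]
    | succ n => simp [bdSimp, push_single, ContinuousMap.comp_assoc]
  exact congr($this c)

/-! ### Comparison with singular homology -/

variable (X) in
/-- The comparison of the free module on the `n`-simplices with the singular `n`-chains. -/
def compareDeg (n : ℕ) :
    (C(stdSimplex ℝ (Fin (n + 1)), X) →₀ ℂ) →ₗ[ℂ] (singularChains X).X n :=
  Finsupp.linearCombination ℂ fun τ =>
    (show ModuleCat.of ℂ ℂ ⟶ (singularChains X).X n from
      (TopCat.toSSet.obj (TopCat.of X)).ιChainComplex
        (((TopCat.of X).toSSetObjEquiv (.op ⦋n⦌)).symm τ)).hom (1 : ℂ)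

variable (X) in
theorem compareDeg_bijective (n : ℕ) : Function.Bijective (compareDeg X n) := by
  let S := TopCat.toSSet.obj (TopCat.of X)
  let e := (TopCat.of X).toSSetObjEquiv (.op ⦋n⦌)
  let k : S _⦋n⦌ → (ModuleCat.of ℂ ℂ ⟶
      ModuleCat.of ℂ (C(stdSimplex ℝ (Fin (n + 1)), X) →₀ ℂ)) := fun x =>
    ModuleCat.ofHom (Finsupp.lsingle (e x))
  let inv : (singularChains X).X n ⟶
      ModuleCat.of ℂ (C(stdSimplex ℝ (Fin (n + 1)), X) →₀ ℂ) :=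
    Limits.Cofan.IsColimit.desc (S.isColimitChainComplexXCofan (ModuleCat.of ℂ ℂ) n) k
  have hinv : ∀ x, S.ιChainComplex x ≫ inv = k x := fun x =>
    Limits.Cofan.IsColimit.fac (S.isColimitChainComplexXCofan (ModuleCat.of ℂ ℂ) n) k x
  refine Function.bijective_iff_has_inverse.2 ⟨inv.hom, ?_, ?_⟩
  · intro c
    have : inv.hom.comp (compareDeg X n) = LinearMap.id := by
      refine Finsupp.lhom_ext' fun τ => LinearMap.ext_ring ?_
      have h1 := congr(($(hinv (e.symm τ))).hom (1 : ℂ))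
      simp only [k, Equiv.apply_symm_apply] at h1
      simp only [LinearMap.comp_apply, compareDeg, Finsupp.lsingle_apply,
        Finsupp.linearCombination_single, one_smul, LinearMap.id_apply]
      exact h1
    exact congr($this c)
  · intro c
    have : inv ≫ ModuleCat.ofHom (compareDeg X n) = 𝟙 _ := by
      refine SSet.chainComplex_hom_ext fun x => ?_
      rw [← Category.assoc, hinv, Category.comp_id]
      refine ModuleCat.hom_ext (LinearMap.ext_ring ?_)
      simp only [k, ModuleCat.hom_comp, ModuleCat.hom_ofHom, LinearMap.comp_apply, compareDeg,
        Finsupp.lsingle_apply, Finsupp.linearCombination_single, one_smul]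
      rw [show ((TopCat.of X).toSSetObjEquiv (.op ⦋n⦌)).symm (e x) = x from e.symm_apply_apply x]
    exact congr(($this).hom c)

end Chains

section Compare
variable {X Y Z : Type} [TopologicalSpace X] [TopologicalSpace Y] [TopologicalSpace Z]

variable (X) in
/-- The degree `n` part of an ungraded chain, as an element of the singular chain complex. -/
def degPart (n : ℕ) : Chain X →ₗ[ℂ] (singularChains X).X n :=
  compareDeg X n ∘ₗ (DFinsupp.lapply n) ∘ₗ (sigmaFinsuppLequivDFinsupp ℂ).toLinearMap

theorem degPart_single_same (n : ℕ) (τ : C(stdSimplex ℝ (Fin (n + 1)), X)) :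
    degPart X n (Finsupp.single ⟨n, τ⟩ 1) =
      (show ModuleCat.of ℂ ℂ ⟶ (singularChains X).X n from
      (TopCat.toSSet.obj (TopCat.of X)).ιChainComplex
        (((TopCat.of X).toSSetObjEquiv (.op ⦋n⦌)).symm τ)).hom (1 : ℂ) := by
  simp [degPart, compareDeg]

theorem degPart_single_ne {n m : ℕ} (h : m ≠ n) (τ : C(stdSimplex ℝ (Fin (m + 1)), X)) :
    degPart X n (Finsupp.single ⟨m, τ⟩ 1) = 0 := by
  simp [degPart, DFinsupp.single_apply, h]

theorem degPart_injective {c : Chain X} (h : ∀ n, degPart X n c = 0) : c = 0 := by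
  apply (sigmaFinsuppLequivDFinsupp ℂ).injective
  rw [map_zero]
  ext n : 1
  apply (compareDeg_bijective X n).1
  rw [DFinsupp.zero_apply, map_zero]
  exact h n

theorem d_degPart (n : ℕ) (c : Chain X) :
    ((singularChains X).d (n + 1) n).hom (degPart X (n + 1) c) = degPart X n (bd X c) := by
  have : ((singularChains X).d (n + 1) n).hom ∘ₗ degPart X (n + 1) = degPart X n ∘ₗ bd X := by
    refine chain_hom_ext fun m τ => ?_
    simp only [LinearMap.comp_apply, bd_single]
    by_cases h : m = n + 1
    · subst h
      rw [degPart_single_same]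
      have := congr(($(SSet.ιChainComplex_d (TopCat.toSSet.obj (TopCat.of X))
        (((TopCat.of X).toSSetObjEquiv (.op ⦋n + 1⦌)).symm τ) (R := ModuleCat.of ℂ ℂ))).hom (1 : ℂ))
      refine Eq.trans this ?_
      simp only [bdSimp, map_sum, map_smul, degPart_single_same, ModuleCat.hom_sum,
        LinearMap.sum_apply]
      refine Finset.sum_congr rfl fun i _ => ?_
      rw [ModuleCat.hom_zsmul]
      rw [LinearMap.smul_apply, ← Int.cast_smul_eq_zsmul ℂ]
      push_cast
      rfl
    · rw [degPart_single_ne h, map_zero]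
      cases m with
      | zero => simp [bdSimp]
      | succ m =>
        simp only [bdSimp, map_sum, map_smul]
        rw [Finset.sum_eq_zero fun i _ => by rw [degPart_single_ne (by omega), smul_zero]]
  exact congr($this c)

theorem degPart_next_of_cycle {c : Chain X} (hc : bd X c = 0) (n : ℕ) :
    ((singularChains X).d n ((ComplexShape.down ℕ).next n)).hom (degPart X n c) = 0 := by
  cases n with
  | zero => rw [HomologicalComplex.shape _ _ _ (by simp)]; rfl
  | succ n =>
    rw [show (ComplexShape.down ℕ).next (n + 1) = n from ChainComplex.next_nat_succ n,
      d_degPart, hc, map_zero]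

theorem map_degPart (f : C(X, Y)) (n : ℕ) (c : Chain X) :
    ((SSet.chainComplexMap (TopCat.toSSet.map (TopCat.ofHom f)) (ModuleCat.of ℂ ℂ)).f n).hom
      (degPart X n c) = degPart Y n (push f c) := by
  have : ((SSet.chainComplexMap (TopCat.toSSet.map (TopCat.ofHom f))
      (ModuleCat.of ℂ ℂ)).f n).hom ∘ₗ degPart X n = degPart Y n ∘ₗ push f := by
    refine chain_hom_ext fun m τ => ?_
    simp only [LinearMap.comp_apply, push_single]
    by_cases h : m = n
    · subst h
      rw [degPart_single_same, degPart_single_same]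
      exact congr(($(SSet.ι_chainComplexMap_f _ _ (TopCat.toSSet.map (TopCat.ofHom f))
        (((TopCat.of X).toSSetObjEquiv (.op ⦋m⦌)).symm τ) (R := ModuleCat.of ℂ ℂ))).hom (1 : ℂ))
    · rw [degPart_single_ne h, degPart_single_ne h, map_zero]
  exact congr($this c)

variable (X) in
/-- The ungraded cycles. -/
abbrev Cyc : Submodule ℂ (Chain X) := LinearMap.ker (bd X)

variable (X) in
/-- The degree `n` part of a cycle, as a cycle of the singular chain complex. -/
def degCycle (n : ℕ) : Cyc X →ₗ[ℂ]
    LinearMap.ker ((singularChains X).d n ((ComplexShape.down ℕ).next n)).hom :=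
  (degPart X n ∘ₗ (Cyc X).subtype).codRestrict _ fun c => degPart_next_of_cycle c.2 n

theorem degPart_eq_zero_of_notMem {c : Chain X} {n : ℕ}
    (h : n ∉ c.support.image Sigma.fst) : degPart X n c = 0 := by
  have : (DFinsupp.lapply n ∘ₗ (sigmaFinsuppLequivDFinsupp ℂ).toLinearMap :
      Chain X →ₗ[ℂ] (C(stdSimplex ℝ (Fin (n + 1)), X) →₀ ℂ)) c = 0 := by
    ext τ
    by_contra h0
    exact h (Finset.mem_image.2 ⟨⟨n, τ⟩, Finsupp.mem_support_iff.2 h0, rfl⟩)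
  exact (congrArg (compareDeg X n) this).trans (map_zero _)

/-- The class of an ungraded cycle in the total homology, as a function. -/
def totClassFun (c : Cyc X) : HTot X :=
  DirectSum.mk (fun d => H X d) (c.1.support.image Sigma.fst)
    fun n => cycleClass (singularChains X) n (degCycle X n c)

theorem totClassFun_apply (c : Cyc X) (n : ℕ) :
    totClassFun c n = cycleClass (singularChains X) n (degCycle X n c) := by
  by_cases h : n ∈ c.1.support.image Sigma.fst
  · exact DirectSum.mk_apply_of_mem h
  · refine (DirectSum.mk_apply_of_notMem h).trans ?_
    rw [show degCycle X n c = 0 from Subtype.ext (degPart_eq_zero_of_notMem h), map_zero]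
    rfl

variable (X) in
/-- The class of an ungraded cycle in the total homology. -/
def totClass : Cyc X →ₗ[ℂ] HTot X where
  toFun := totClassFun
  map_add' c c' := DFinsupp.ext fun n => by
    rw [DFinsupp.add_apply]
    erw [totClassFun_apply, totClassFun_apply, totClassFun_apply]
    rw [map_add, map_add]
    rfl
  map_smul' r c := DFinsupp.ext fun n => by
    erw [totClassFun_apply, DFinsupp.smul_apply, totClassFun_apply]
    rw [map_smul, map_smul]
    rfl

theorem totClass_apply (c : Cyc X) (n : ℕ) :
    totClass X c n = cycleClass (singularChains X) n (degCycle X n c) :=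
  totClassFun_apply c n

/-- The inclusion of the `n`-chains into the ungraded chains. -/
def degIncl (n : ℕ) : (C(stdSimplex ℝ (Fin (n + 1)), X) →₀ ℂ) →ₗ[ℂ] Chain X :=
  Finsupp.lmapDomain ℂ ℂ fun τ => ⟨n, τ⟩

theorem degPart_degIncl_same (n : ℕ) (c : C(stdSimplex ℝ (Fin (n + 1)), X) →₀ ℂ) :
    degPart X n (degIncl n c) = compareDeg X n c := by
  have : degPart X n ∘ₗ degIncl n = compareDeg X n :=
    Finsupp.lhom_ext' fun τ => LinearMap.ext_ring (by
      simp [degIncl, degPart_single_same, compareDeg])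
  exact congr($this c)

theorem degPart_degIncl_ne {m n : ℕ} (h : m ≠ n) (c : C(stdSimplex ℝ (Fin (m + 1)), X) →₀ ℂ) :
    degPart X n (degIncl m c) = 0 := by
  have : degPart X n ∘ₗ degIncl m = 0 :=
    Finsupp.lhom_ext' fun τ => LinearMap.ext_ring (by
      simp [degIncl, degPart_single_ne h])
  exact congr($this c)

theorem bd_degIncl_eq_zero {n : ℕ} {c : C(stdSimplex ℝ (Fin (n + 1)), X) →₀ ℂ}
    (h : ((singularChains X).d n ((ComplexShape.down ℕ).next n)).hom (compareDeg X n c) = 0) :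
    bd X (degIncl n c) = 0 := by
  refine degPart_injective fun m => ?_
  rw [← d_degPart]
  by_cases hm : n = m + 1
  · subst hm
    rw [degPart_degIncl_same]
    rwa [show (ComplexShape.down ℕ).next (m + 1) = m from ChainComplex.next_nat_succ m] at h
  · rw [degPart_degIncl_ne hm, map_zero]

theorem totClass_degIncl {n : ℕ} (c : C(stdSimplex ℝ (Fin (n + 1)), X) →₀ ℂ)
    (x : LinearMap.ker ((singularChains X).d n ((ComplexShape.down ℕ).next n)).hom)
    (h : compareDeg X n c = x.1) (hb : bd X (degIncl n c) = 0) :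
    totClass X ⟨degIncl n c, hb⟩ =
      DirectSum.lof ℂ ℕ (fun d => H X d) n (cycleClass (singularChains X) n x) := by
  refine DFinsupp.ext fun m => ?_
  erw [totClass_apply]
  by_cases hm : n = m
  · subst hm
    erw [DirectSum.lof_apply]
    congr 1
    exact Subtype.ext ((degPart_degIncl_same n c).trans h)
  · have h0 : (DirectSum.lof ℂ ℕ (fun d => H X d) n (cycleClass (singularChains X) n x)) m = 0 :=
      DFinsupp.single_eq_of_ne (Ne.symm hm)
    refine Eq.trans ?_ h0.symm
    refine (congrArg _ (Subtype.ext ?_)).trans (map_zero (cycleClass (singularChains X) m))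
    exact degPart_degIncl_ne hm c

theorem totClass_surjective : Function.Surjective (totClass X) := by
  intro z
  rw [← LinearMap.mem_range]
  induction z using DirectSum.induction_on with
  | zero => exact zero_mem _
  | add x y hx hy => exact add_mem hx hy
  | of n y =>
    obtain ⟨x, rfl⟩ := cycleClass_surjective (singularChains X) n y
    obtain ⟨c, hc⟩ := (compareDeg_bijective X n).2 x.1
    exact ⟨⟨degIncl n c, bd_degIncl_eq_zero (by rw [hc]; exact x.2)⟩, totClass_degIncl c x hc _⟩

/-- Together with `totClass_surjective`: the homology of the ungraded chains is the total
homology. -/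
theorem totClass_eq_zero_iff (c : Cyc X) : totClass X c = 0 ↔ ∃ b, bd X b = c.1 := by
  constructor
  · intro h
    have h1 : ∀ n, ∃ y, ((singularChains X).d (n + 1) n).hom y = degPart X n c.1 := fun n =>
      (cycleClass_eq_zero_iff _ n _).1 ((totClass_apply c n).symm.trans congr($h n))
    choose y hy using h1
    choose b hb using fun n => (compareDeg_bijective X (n + 1)).2 (y n)
    refine ⟨∑ n ∈ c.1.support.image Sigma.fst, degIncl (n + 1) (b n), ?_⟩
    rw [← sub_eq_zero]
    refine degPart_injective fun n => ?_
    rw [map_sub, ← d_degPart, map_sum]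
    by_cases hn : n ∈ c.1.support.image Sigma.fst
    · rw [Finset.sum_eq_single_of_mem n hn fun m _ hm => degPart_degIncl_ne (by omega) _,
        degPart_degIncl_same, hb, hy, sub_self]
    · rw [Finset.sum_eq_zero fun m hm => degPart_degIncl_ne (fun h => hn (by
        rwa [← Nat.succ.inj h])) _, degPart_eq_zero_of_notMem hn, map_zero, sub_zero]
  · rintro ⟨b, hb⟩
    refine DFinsupp.ext fun n => ?_
    refine (totClass_apply c n).trans ((cycleClass_eq_zero_iff _ n _).2 ⟨degPart X (n + 1) b, ?_⟩)
    rw [d_degPart, hb]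
    rfl

/-- The map of cycles induced by a continuous map. -/
def pushCyc (f : C(X, Y)) : Cyc X →ₗ[ℂ] Cyc Y :=
  (push f ∘ₗ (Cyc X).subtype).codRestrict _ fun c => by
    rw [LinearMap.mem_ker]
    exact (bd_push f c.1).trans (by rw [c.2, map_zero])

theorem HTotMap_totClass (f : C(X, Y)) (c : Cyc X) :
    HTotMap f (totClass X c) = totClass Y (pushCyc f c) := by
  refine DFinsupp.ext fun n => ?_
  refine Eq.trans ?_ (totClass_apply _ n).symm
  refine (DirectSum.lmap_apply (fun d => HMap f d) _ n).trans ?_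
  rw [totClass_apply]
  exact homologyMap_cycleClass (SSet.chainComplexMap (TopCat.toSSet.map (TopCat.ofHom f))
    (ModuleCat.of ℂ ℂ)) n (degCycle X n c) (degCycle Y n (pushCyc f c)) (map_degPart f n c.1)

/-- The fundamental chain of the cube: the signed sum of the simplices of its triangulation. -/
def cubeCh (m : ℕ) : Chain (Fin m → I) :=
  ∑ π : Equiv.Perm (Fin m), (Equiv.Perm.sign π : ℂ) • Finsupp.single ⟨m, cubeSimplex π⟩ 1

/-- The class of a cube is represented by the image of the fundamental chain of the cube. -/
theorem totClass_cubeClass {m : ℕ} (f : C(Fin m → I, X)) (hf : IsClosedCube f) :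
    ∃ h : bd X (push f (cubeCh m)) = 0,
      totClass X ⟨push f (cubeCh m), h⟩ =
        DirectSum.lof ℂ ℕ (fun d => H X d) m (cubeClass f hf) := by
  set c : C(stdSimplex ℝ (Fin (m + 1)), X) →₀ ℂ :=
    ∑ π : Equiv.Perm (Fin m), (Equiv.Perm.sign π : ℂ) • Finsupp.single (f.comp (cubeSimplex π)) 1
  have hc : degIncl m c = push f (cubeCh m) := by
    simp [c, cubeCh, degIncl, push_single, map_sum]
  have hv : compareDeg X m c = (cubeChain f).hom (1 : ℂ) := by
    simp only [c, cubeChain, map_sum, map_smul, ModuleCat.hom_sum, LinearMap.sum_apply]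
    refine Finset.sum_congr rfl fun π _ => ?_
    rw [ModuleCat.hom_zsmul, LinearMap.smul_apply, ← Int.cast_smul_eq_zsmul ℂ]
    simp [compareDeg]
  have hk : ((singularChains X).d m ((ComplexShape.down ℕ).next m)).hom
      ((cubeChain f).hom (1 : ℂ)) = 0 := congr(($(cubeChain_d f hf)).hom (1 : ℂ))
  have hb : bd X (degIncl m c) = 0 := bd_degIncl_eq_zero (by rw [hv]; exact hk)
  refine ⟨hc ▸ hb, ?_⟩
  have : (⟨push f (cubeCh m), hc ▸ hb⟩ : Cyc X) = ⟨degIncl m c, hb⟩ := Subtype.ext hc.symm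
  rw [this, totClass_degIncl c ⟨_, hk⟩ hv hb]
  congr 1
  exact (liftCycles_class m (cubeChain f) (cubeChain_d f hf) ⟨_, hk⟩ rfl).symm

end Compare

/-! ### Affine simplices in convex spaces -/

/-- A space with convex combinations, which are computed by a family of real coordinates that
separates the points. -/
class ConvexComb (K : Type) [TopologicalSpace K] where
  /-- The affine simplex with given vertices. -/
  comb {m : ℕ} (v : Fin (m + 1) → K) : C(stdSimplex ℝ (Fin (m + 1)), K)
  /-- The index type of the coordinates. -/
  Ix : Type
  /-- The coordinates. -/
  coord : Ix → K → ℝ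
  coord_ext : ∀ x y : K, (∀ i, coord i x = coord i y) → x = y
  coord_comb : ∀ {m : ℕ} (v : Fin (m + 1) → K) (t : stdSimplex ℝ (Fin (m + 1))) (i : Ix),
    coord i (comb v t) = ∑ j, t j * coord i (v j)

open ConvexComb

instance {κ : Type} [Fintype κ] : ConvexComb (stdSimplex ℝ κ) where
  comb v := ⟨fun t => ⟨fun k => ∑ j, t j * v j k, fun k =>
      Finset.sum_nonneg fun j _ => mul_nonneg (t.2.1 j) ((v j).2.1 k), by
      rw [Finset.sum_comm]
      simp_rw [← Finset.mul_sum]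
      simp⟩, by
    refine Continuous.subtype_mk (continuous_pi fun k => continuous_finsetSum _ fun j _ => ?_) _
    exact ((continuous_apply j).comp continuous_subtype_val).mul continuous_const⟩
  Ix := κ
  coord k x := x k
  coord_ext x y h := stdSimplex.ext (funext h)
  coord_comb v t i := rfl

instance : ConvexComb I where
  comb v := ⟨fun t => ⟨∑ j, t j * (v j : ℝ),
      Finset.sum_nonneg fun j _ => mul_nonneg (t.2.1 j) (v j).2.1, by
      refine (Finset.sum_le_sum fun j _ => mul_le_mul_of_nonneg_left (v j).2.2 (t.2.1 j)).trans ?_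
      simpa using t.2.2.le⟩, by
    refine Continuous.subtype_mk (continuous_finsetSum _ fun j _ => ?_) _
    exact ((continuous_apply j).comp continuous_subtype_val).mul continuous_const⟩
  Ix := Unit
  coord _ x := x
  coord_ext x y h := Subtype.ext (h ())
  coord_comb v t i := rfl

variable {K L : Type} [TopologicalSpace K] [TopologicalSpace L] [ConvexComb K] [ConvexComb L]

instance : ConvexComb (K × L) where
  comb v := (comb fun j => (v j).1).prodMk (comb fun j => (v j).2)
  Ix := Ix K ⊕ Ix L
  coord i x := i.elim (fun i => coord i x.1) (fun i => coord i x.2)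
  coord_ext x y h :=
    Prod.ext (coord_ext _ _ fun i => h (.inl i)) (coord_ext _ _ fun i => h (.inr i))
  coord_comb v t i := by
    cases i with
    | inl i => exact coord_comb (fun j => (v j).1) t i
    | inr i => exact coord_comb (fun j => (v j).2) t i

instance {κ : Type} : ConvexComb (κ → K) where
  comb v := ⟨fun t k => comb (fun j => v j k) t, continuous_pi fun _ => (comb _).continuous⟩
  Ix := κ × Ix K
  coord i x := coord i.2 (x i.1)
  coord_ext _ _ h := funext fun k => coord_ext _ _ fun i => h (k, i)
  coord_comb v t i := coord_comb (fun j => v j i.1) t i.2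

/-- A continuous map that preserves convex combinations. -/
def IsAffine (g : C(K, L)) : Prop :=
  ∀ (m : ℕ) (v : Fin (m + 1) → K), g.comp (comb v) = comb (g ∘ v)

theorem comb_map {m n : ℕ} (v : Fin (n + 1) → K) (f : Fin (m + 1) → Fin (n + 1))
    (t : stdSimplex ℝ (Fin (m + 1))) : comb v (stdSimplex.map f t) = comb (v ∘ f) t := by
  refine coord_ext _ _ fun i => ?_
  rw [coord_comb, coord_comb]
  simp only [stdSimplex.map_coe, FunOnFinite.linearMap_apply_apply, Finset.sum_mul]
  rw [Finset.sum_sigma']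
  refine Finset.sum_bij' (fun x _ => x.2) (fun l _ => ⟨f l, l⟩) ?_ ?_ ?_ ?_ ?_ <;>
    simp +contextual

theorem comb_face {m : ℕ} (v : Fin (m + 2) → K) (i : Fin (m + 2)) :
    (comb v).comp (faceMap i) = comb (v ∘ i.succAbove) :=
  ContinuousMap.ext fun t => comb_map v _ t

/-- The vertices of the standard simplex. -/
def stdVert (n : ℕ) : Fin (n + 1) → stdSimplex ℝ (Fin (n + 1)) := stdSimplex.vertex

theorem comb_apply_stdVert {m : ℕ} (v : Fin (m + 1) → K) (i : Fin (m + 1)) :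
    comb v (stdVert m i) = v i := by
  refine coord_ext _ _ fun k => ?_
  rw [coord_comb, Finset.sum_eq_single i]
  · simp [stdVert, stdSimplex.vertex, DFunLike.coe]
  · intro j _ hj
    simp [stdVert, stdSimplex.vertex, DFunLike.coe, hj]
  · simp

theorem comb_stdVert (n : ℕ) : comb (stdVert n) = ContinuousMap.id _ := by
  refine ContinuousMap.ext fun t => coord_ext _ _ fun k => ?_
  rw [coord_comb]
  change ∑ j, t j * (Pi.single j 1 : Fin (n + 1) → ℝ) k = t k
  simp [Pi.single_apply]

theorem isAffine_comb {m : ℕ} (v : Fin (m + 1) → K) : IsAffine (comb v) := by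
  refine fun n w => ContinuousMap.ext fun t => coord_ext _ _ fun i => ?_
  rw [coord_comb, ContinuousMap.comp_apply, coord_comb]
  simp only [Function.comp_apply, coord_comb]
  change ∑ k, (∑ j, t j * w j k) * _ = _
  simp_rw [Finset.sum_mul, Finset.mul_sum]
  rw [Finset.sum_comm]
  simp [mul_assoc]

theorem IsAffine.prodMap_id {g : C(K, L)} (hg : IsAffine g) :
    IsAffine (g.prodMap (ContinuousMap.id I)) := by
  refine fun m v => ContinuousMap.ext fun t => Prod.ext ?_ rfl
  exact congr($(hg m fun j => (v j).1) t)

/-! ### Chains of lists of points -/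

/-- Formal linear combinations of lists of points; a nonempty list stands for the affine simplex
with these vertices. -/
abbrev ListCh (K : Type) : Type := List K →₀ ℂ

/-- The map of list chains given by a map of points. -/
def mapL {K L : Type} (g : K → L) : ListCh K →ₗ[ℂ] ListCh L := Finsupp.lmapDomain ℂ ℂ (List.map g)

/-- The cone operator: a new vertex is put in front. -/
def coneL {K : Type} (b : K) : ListCh K →ₗ[ℂ] ListCh K := Finsupp.lmapDomain ℂ ℂ (List.cons b)

theorem mapL_single {K L : Type} (g : K → L) (l : List K) (r : ℂ) :
    mapL g (Finsupp.single l r) = Finsupp.single (l.map g) r := by simp [mapL]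

theorem coneL_single {K : Type} (b : K) (l : List K) (r : ℂ) :
    coneL b (Finsupp.single l r) = Finsupp.single (b :: l) r := by simp [coneL]

theorem listCh_hom_ext {K : Type} {V : Type*} [AddCommGroup V] [Module ℂ V]
    {f g : ListCh K →ₗ[ℂ] V}
    (h : ∀ l, f (Finsupp.single l 1) = g (Finsupp.single l 1)) : f = g :=
  Finsupp.lhom_ext' fun l => LinearMap.ext_ring (by simpa using h l)

theorem mapL_coneL {K L : Type} (g : K → L) (b : K) (c : ListCh K) :
    mapL g (coneL b c) = coneL (g b) (mapL g c) := by
  have : mapL g ∘ₗ coneL b = coneL (g b) ∘ₗ mapL g :=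
    listCh_hom_ext fun l => by simp [mapL_single, coneL_single]
  exact congr($this c)

theorem mapL_mapL {K L M : Type} (h : L → M) (g : K → L) (c : ListCh K) :
    mapL h (mapL g c) = mapL (h ∘ g) c := by
  have : mapL h ∘ₗ mapL g = mapL (h ∘ g) :=
    listCh_hom_ext fun l => by simp [mapL_single]
  exact congr($this c)

/-- The augmented boundary of a list: `∂ [] = 0` and `∂ (b :: l) = l - b · ∂ l`. -/
def bdList {K : Type} (l : List K) : ListCh K :=
  match l with
  | [] => 0
  | b :: l => Finsupp.single l 1 - coneL b (bdList l)

/-- The augmented boundary of list chains. -/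
def bdL (K : Type) : ListCh K →ₗ[ℂ] ListCh K := Finsupp.linearCombination ℂ bdList

theorem bdL_single {K : Type} (l : List K) : bdL K (Finsupp.single l 1) = bdList l := by
  simp [bdL]

theorem bdL_coneL {K : Type} (b : K) (c : ListCh K) :
    bdL K (coneL b c) = c - coneL b (bdL K c) := by
  have : bdL K ∘ₗ coneL b = LinearMap.id - coneL b ∘ₗ bdL K :=
    listCh_hom_ext fun l => by simp [coneL_single, bdL_single, bdList]
  exact congr($this c)

theorem bdL_bdL {K : Type} (c : ListCh K) : bdL K (bdL K c) = 0 := by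
  have : bdL K ∘ₗ bdL K = 0 := by
    refine listCh_hom_ext fun l => ?_
    induction l with
    | nil => simp [bdL_single, bdList]
    | cons b l ih =>
      simp only [LinearMap.comp_apply, bdL_single, LinearMap.zero_apply] at ih
      simp [bdL_single, bdList, bdL_coneL, ih]
  exact congr($this c)

theorem bdL_mapL {K L : Type} (g : K → L) (c : ListCh K) :
    bdL L (mapL g c) = mapL g (bdL K c) := by
  have : bdL L ∘ₗ mapL g = mapL g ∘ₗ bdL K := by
    refine listCh_hom_ext fun l => ?_
    simp only [LinearMap.comp_apply, mapL_single, bdL_single]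
    induction l with
    | nil => simp [bdList]
    | cons b l ih => simp [bdList, ih, mapL_single, mapL_coneL]
  exact congr($this c)

theorem exists_eq_ofFn {K : Type} (l : List K) : ∃ (m : ℕ) (v : Fin m → K), l = List.ofFn v :=
  ⟨l.length, l.get, (List.ofFn_get l).symm⟩

theorem bdList_ofFn {K : Type} {m : ℕ} (v : Fin (m + 1) → K) :
    bdList (List.ofFn v) =
      ∑ i : Fin (m + 1), (-1 : ℂ) ^ (i : ℕ) • Finsupp.single (List.ofFn (v ∘ i.succAbove)) 1 := by
  induction m with
  | zero => simp [bdList]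
  | succ m ih =>
    rw [List.ofFn_succ, bdList, ih, Fin.sum_univ_succ (n := m + 1), map_sum, sub_eq_add_neg,
      ← Finset.sum_neg_distrib]
    refine congrArg₂ (· + ·) (by simp [Function.comp_def]) (Finset.sum_congr rfl fun i _ => ?_)
    rw [map_smul, coneL_single, Fin.val_succ, pow_succ, mul_neg_one, neg_smul,
      List.ofFn_succ (f := v ∘ i.succ.succAbove)]
    simp [Function.comp_def]

/-- The affine simplex given by a list of points, and zero for the empty list. -/
def realizeList (l : List K) : Chain K :=
  match l with
  | [] => 0
  | a :: l => Finsupp.single ⟨l.length, comb fun i => (a :: l).get i⟩ 1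

variable (K) in
/-- The map from list chains to singular chains. -/
def realize : ListCh K →ₗ[ℂ] Chain K := Finsupp.linearCombination ℂ realizeList

theorem realize_single (l : List K) : realize K (Finsupp.single l 1) = realizeList l := by
  simp [realize]

theorem realizeList_eq (l : List K) (m : ℕ) (h : l.length = m + 1) :
    realizeList l = Finsupp.single ⟨m, comb fun i => l.get (i.cast h.symm)⟩ 1 := by
  cases l with
  | nil => simp at h
  | cons a l =>
    obtain rfl : l.length = m := by simpa using h
    rfl

theorem realizeList_ofFn {m : ℕ} (v : Fin (m + 1) → K) :
    realizeList (List.ofFn v) = Finsupp.single ⟨m, comb v⟩ 1 := by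
  rw [realizeList_eq _ m (by simp)]
  congr 4
  funext i
  simp [-List.ofFn_succ]

theorem bd_realize (c : ListCh K) : bd K (realize K c) = realize K (bdL K c) := by
  have : bd K ∘ₗ realize K = realize K ∘ₗ bdL K := by
    refine listCh_hom_ext fun l => ?_
    simp only [LinearMap.comp_apply, realize_single, bdL_single]
    obtain ⟨m, v, rfl⟩ := exists_eq_ofFn l
    match m with
    | 0 => simp [realizeList, bdList]
    | 1 => simp [bdList, bd_single, bdSimp, realize_single, realizeList]
    | m + 2 =>
      rw [realizeList_ofFn, bdList_ofFn, bd_single]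
      simp only [bdSimp, map_sum, map_smul, realize_single, realizeList_ofFn, comb_face]
  exact congr($this c)

theorem realize_mapL {g : C(K, L)} (hg : IsAffine g) (c : ListCh K) :
    realize L (mapL g c) = push g (realize K c) := by
  have : realize L ∘ₗ mapL g = push g ∘ₗ realize K := by
    refine listCh_hom_ext fun l => ?_
    simp only [LinearMap.comp_apply, realize_single, mapL_single]
    obtain ⟨m, v, rfl⟩ := exists_eq_ofFn l
    cases m with
    | zero => simp [realizeList]
    | succ m => rw [List.map_ofFn, realizeList_ofFn, realizeList_ofFn, push_single, hg]
  exact congr($this c)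

/-- The vertices of the standard simplex as a list chain. -/
def stdL (n : ℕ) : ListCh (stdSimplex ℝ (Fin (n + 1))) := Finsupp.single (List.ofFn (stdVert n)) 1

theorem realize_stdL (n : ℕ) :
    realize _ (stdL n) = Finsupp.single ⟨n, ContinuousMap.id _⟩ 1 := by
  rw [stdL, realize_single, realizeList_ofFn, comb_stdVert]

section Spaces
variable {X Y Z : Type} [TopologicalSpace X] [TopologicalSpace Y] [TopologicalSpace Z]

theorem single_eq_push {n : ℕ} (τ : C(stdSimplex ℝ (Fin (n + 1)), X)) :
    (Finsupp.single ⟨n, τ⟩ 1 : Chain X) = push τ (realize _ (stdL n)) := by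
  rw [realize_stdL, push_single, ContinuousMap.comp_id]

theorem bd_bd (c : Chain X) : bd X (bd X c) = 0 := by
  have : bd X ∘ₗ bd X = 0 := by
    refine chain_hom_ext fun n τ => ?_
    rw [single_eq_push]
    simp [bd_push, bd_realize, bdL_bdL]
  exact congr($this c)

/-! ### The prism operator -/

/-- The prism over a list: `P [] = 0` and `P (v :: l) = (v,0) (v,1) (l,1) - (v,0) · P l`. -/
def prismList {K : Type} (l : List K) : ListCh (K × I) :=
  match l with
  | [] => 0
  | v :: l => Finsupp.single ((v, 0) :: (v, 1) :: l.map (·, 1)) 1 - coneL (v, 0) (prismList l)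

/-- The prism operator on list chains. -/
def prismL (K : Type) : ListCh K →ₗ[ℂ] ListCh (K × I) := Finsupp.linearCombination ℂ prismList

theorem prismL_single {K : Type} (l : List K) : prismL K (Finsupp.single l 1) = prismList l := by
  simp [prismL]

theorem prismL_coneL {K : Type} (v : K) (c : ListCh K) :
    prismL K (coneL v c) = coneL (v, 0) (coneL (v, 1) (mapL (·, 1) c)) -
      coneL (v, 0) (prismL K c) := by
  have : prismL K ∘ₗ coneL v = coneL (v, 0) ∘ₗ coneL (v, 1) ∘ₗ mapL (·, 1) -
      coneL (v, 0) ∘ₗ prismL K :=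
    listCh_hom_ext fun l => by simp [coneL_single, prismL_single, mapL_single, prismList]
  exact congr($this c)

theorem bdL_prismL {K : Type} (c : ListCh K) :
    bdL _ (prismL K c) = mapL (·, 1) c - mapL (·, 0) c - prismL K (bdL K c) := by
  have : bdL _ ∘ₗ prismL K = mapL (·, 1) - mapL (·, 0) - prismL K ∘ₗ bdL K := by
    refine listCh_hom_ext fun l => ?_
    simp only [LinearMap.comp_apply, LinearMap.sub_apply, prismL_single, bdL_single, mapL_single]
    induction l with
    | nil => simp [prismList, bdList]
    | cons v l ih =>
      have h := bdL_mapL (·, (1 : I)) (Finsupp.single l (1 : ℂ))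
      rw [mapL_single, bdL_single, bdL_single] at h
      simp only [prismList, bdList, map_sub, bdL_coneL, bdL_single, prismL_single, ih,
        prismL_coneL, h, coneL_single, List.map_cons]
      abel
  exact congr($this c)

theorem prismL_mapL {K L : Type} (g : K → L) (c : ListCh K) :
    prismL L (mapL g c) = mapL (Prod.map g id) (prismL K c) := by
  have : prismL L ∘ₗ mapL g = mapL (Prod.map g id) ∘ₗ prismL K := by
    refine listCh_hom_ext fun l => ?_
    simp only [LinearMap.comp_apply, mapL_single, prismL_single]
    induction l with
    | nil => simp [prismList]
    | cons b l ih => simp [prismList, ih, mapL_single, mapL_coneL, Function.comp_def]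
  exact congr($this c)

/-- The inclusion of `X` into the cylinder `X × I` at the time `t`. -/
def atTime (X : Type) [TopologicalSpace X] (t : I) : C(X, X × I) :=
  (ContinuousMap.id X).prodMk (ContinuousMap.const X t)

theorem isAffine_atTime_zero : IsAffine (atTime K 0) := by
  refine fun m v => ContinuousMap.ext fun t => Prod.ext rfl ?_
  refine coord_ext _ _ fun i => ?_
  refine Eq.trans ?_ (coord_comb (K := I) _ t i).symm
  simp [atTime, coord]

theorem isAffine_atTime_one : IsAffine (atTime K 1) := by
  refine fun m v => ContinuousMap.ext fun t => Prod.ext rfl ?_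
  refine coord_ext _ _ fun i => ?_
  refine Eq.trans ?_ (coord_comb (K := I) _ t i).symm
  simp [atTime, coord]

/-- The prism over a singular simplex. -/
def prismSimp (s : Simp X) : Chain (X × I) :=
  push (s.2.prodMap (ContinuousMap.id I)) (realize _ (prismL _ (stdL s.1)))

variable (X) in
/-- The prism operator on singular chains. -/
def prism : Chain X →ₗ[ℂ] Chain (X × I) := Finsupp.linearCombination ℂ prismSimp

theorem prism_single (s : Simp X) : prism X (Finsupp.single s 1) = prismSimp s := by
  simp [prism]

theorem prism_push (f : C(X, Y)) (c : Chain X) :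
    prism Y (push f c) = push (f.prodMap (ContinuousMap.id I)) (prism X c) := by
  have : prism Y ∘ₗ push f = push (f.prodMap (ContinuousMap.id I)) ∘ₗ prism X := by
    refine chain_hom_ext fun n τ => ?_
    simp only [LinearMap.comp_apply, push_single, prism_single, prismSimp, push_comp]
    rfl
  exact congr($this c)

theorem prism_realize (c : ListCh K) : prism K (realize K c) = realize _ (prismL K c) := by
  have : prism K ∘ₗ realize K = realize _ ∘ₗ prismL K := by
    refine listCh_hom_ext fun l => ?_
    simp only [LinearMap.comp_apply, realize_single, prismL_single]
    obtain ⟨m, v, rfl⟩ := exists_eq_ofFn l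
    cases m with
    | zero => simp [realizeList, prismList]
    | succ m =>
      rw [realizeList_ofFn, prism_single, prismSimp, ← realize_mapL (isAffine_comb v).prodMap_id]
      rw [show (⇑((comb v).prodMap (ContinuousMap.id I)) : _ → K × I) =
        Prod.map (comb v) id from rfl, ← prismL_mapL, stdL, mapL_single, List.map_ofFn]
      rw [show comb v ∘ stdVert m = v from funext fun i => comb_apply_stdVert v i, prismL_single]
  exact congr($this c)

theorem bd_prism (c : Chain X) :
    bd _ (prism X c) = push (atTime X 1) c - push (atTime X 0) c - prism X (bd X c) := by
  have : bd _ ∘ₗ prism X = push (atTime X 1) - push (atTime X 0) - prism X ∘ₗ bd X := by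
    refine chain_hom_ext fun n τ => ?_
    rw [single_eq_push]
    simp only [LinearMap.comp_apply, LinearMap.sub_apply, prism_push, bd_push, push_comp,
      prism_realize, bd_realize, bdL_prismL, map_sub]
    have h1 : push (τ.prodMap (ContinuousMap.id I)) (realize _ (mapL (·, 1) (stdL n))) =
        push ((atTime X 1).comp τ) (realize _ (stdL n)) := by
      rw [show (fun x : stdSimplex ℝ (Fin (n + 1)) => (x, (1 : I))) = atTime _ 1 from rfl,
        realize_mapL isAffine_atTime_one, push_comp]
      rfl
    have h0 : push (τ.prodMap (ContinuousMap.id I)) (realize _ (mapL (·, 0) (stdL n))) =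
        push ((atTime X 0).comp τ) (realize _ (stdL n)) := by
      rw [show (fun x : stdSimplex ℝ (Fin (n + 1)) => (x, (0 : I))) = atTime _ 0 from rfl,
        realize_mapL isAffine_atTime_zero, push_comp]
      rfl
    rw [h1, h0]
  exact congr($this c)

theorem prismL_prismList_cons {K : Type} (v : K) (l : List K) :
    prismL _ (prismList (v :: l)) =
      (Finsupp.single (((v, 0), 0) :: ((v, 0), 1) :: ((v, 1), 1) :: l.map fun x => ((x, 1), 1)) 1 -
        Finsupp.single (((v, 0), 0) :: ((v, 1), 0) :: ((v, 1), 1) ::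
          l.map fun x => ((x, 1), 1)) 1) +
      (coneL ((v, 0), 0) (coneL ((v, 1), 0) (mapL (fun x => ((x.1, 1), x.2)) (prismList l))) -
        coneL ((v, 0), 0) (coneL ((v, 0), 1) (mapL (·, 1) (prismList l)))) +
      coneL ((v, 0), 0) (prismL _ (prismList l)) := by
  have h : prismList (l.map (·, (1 : I))) = mapL (fun x => ((x.1, 1), x.2)) (prismList l) := by
    rw [← prismL_single, ← mapL_single, prismL_mapL, prismL_single]
    rfl
  rw [prismList, map_sub, prismL_single, prismL_coneL, prismList, prismList, h, map_sub]
  simp only [List.map_cons, List.map_map, Function.comp_def, coneL_single]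
  abel

/-- Iterated prisms are antisymmetric in the two time coordinates, exactly on chains. -/
theorem prismL_swap {K : Type} (c : ListCh K) :
    mapL (fun x : (K × I) × I => ((x.1.1, x.2), x.1.2)) (prismL _ (prismL K c)) =
      - prismL _ (prismL K c) := by
  have : mapL (fun x : (K × I) × I => ((x.1.1, x.2), x.1.2)) ∘ₗ prismL _ ∘ₗ prismL K =
      - (prismL _ ∘ₗ prismL K) := by
    refine listCh_hom_ext fun l => ?_
    simp only [LinearMap.comp_apply, prismL_single, LinearMap.neg_apply]
    induction l with
    | nil => simp [prismList]
    | cons v l ih =>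
      rw [prismL_prismList_cons, map_add, map_add, map_sub, map_sub, mapL_coneL, mapL_coneL,
        mapL_coneL, mapL_coneL, mapL_coneL, ih, mapL_single, mapL_single, mapL_mapL, mapL_mapL,
        map_neg]
      simp only [List.map_cons, List.map_map, Function.comp_def]
      abel
  exact congr($this c)

/-- The exchange of the two time coordinates. -/
def swapTimes (X : Type) [TopologicalSpace X] : C((X × I) × I, (X × I) × I) :=
  ⟨fun x => ((x.1.1, x.2), x.1.2), by fun_prop⟩

theorem push_swap_prism_prism (c : Chain X) :
    push (swapTimes X) (prism _ (prism X c)) = - prism _ (prism X c) := by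
  have : push (swapTimes X) ∘ₗ prism _ ∘ₗ prism X = - (prism _ ∘ₗ prism X) := by
    refine chain_hom_ext fun n τ => ?_
    have ha : IsAffine (swapTimes (stdSimplex ℝ (Fin (n + 1)))) := fun m v => rfl
    have h := realize_mapL ha (prismL _ (prismL _ (stdL n)))
    have h2 : mapL (swapTimes _) _ = _ := prismL_swap (stdL n)
    rw [h2, map_neg, ← prism_realize, ← prism_realize] at h
    rw [single_eq_push]
    simp only [LinearMap.comp_apply, LinearMap.neg_apply, prism_push]
    rw [← map_neg, h, push_comp, push_comp]
    rfl
  exact congr($this c)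

end Spaces

/-! ### Barycentric subdivision of lists -/

section Lists
variable {K L : Type} [TopologicalSpace K] [TopologicalSpace L] [ConvexComb K] [ConvexComb L]

/-- The barycenter of the affine simplex with vertices `v`. -/
def bary {m : ℕ} (v : Fin (m + 1) → K) : K := comb v stdSimplex.barycenter

theorem coord_bary {m : ℕ} (v : Fin (m + 1) → K) (i : Ix K) :
    coord i (bary v) = (∑ j, coord i (v j)) / (m + 1) := by
  rw [bary, coord_comb, Finset.sum_div]
  refine Finset.sum_congr rfl fun j _ => ?_
  have : (stdSimplex.barycenter : stdSimplex ℝ (Fin (m + 1))) j = ((m : ℝ) + 1)⁻¹ := by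
    change ((Fintype.card (Fin (m + 1)) : ℕ) : ℝ)⁻¹ = _
    simp
  rw [this]
  field_simp

theorem IsAffine.map_bary {g : C(K, L)} (hg : IsAffine g) {m : ℕ} (v : Fin (m + 1) → K) :
    bary (g ∘ v) = g (bary v) := by
  rw [bary, ← hg]
  rfl

/-- The barycentric subdivision of the affine simplex with vertices `v`. -/
def sdFin {m : ℕ} (v : Fin m → K) : ListCh K :=
  match m, v with
  | 0, _ => Finsupp.single [] 1
  | m + 1, v => coneL (bary v) (∑ i : Fin (m + 1), (-1 : ℂ) ^ (i : ℕ) • sdFin (v ∘ i.succAbove))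

/-- The chain homotopy from the identity to the barycentric subdivision. -/
def tdFin {m : ℕ} (v : Fin m → K) : ListCh K :=
  match m, v with
  | 0, _ => 0
  | m + 1, v => coneL (bary v) (Finsupp.single (List.ofFn v) 1 -
      ∑ i : Fin (m + 1), (-1 : ℂ) ^ (i : ℕ) • tdFin (v ∘ i.succAbove))

variable (K) in
/-- Barycentric subdivision of list chains. -/
def sdL : ListCh K →ₗ[ℂ] ListCh K := Finsupp.linearCombination ℂ fun l => sdFin l.get

variable (K) in
/-- The chain homotopy from the identity to the barycentric subdivision of list chains. -/
def tdL : ListCh K →ₗ[ℂ] ListCh K := Finsupp.linearCombination ℂ fun l => tdFin l.get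

theorem apply_get_ofFn {K : Type} {V : Type*} (F : ∀ {m : ℕ}, (Fin m → K) → V) {m : ℕ}
    (v : Fin m → K) :
    F (List.ofFn v).get = F v := by
  have : ∀ (l : List K) (h : l.length = m), F l.get = F fun i => l.get (i.cast h.symm) := by
    rintro l rfl
    rfl
  rw [this _ (List.length_ofFn)]
  congr 1
  funext i
  simp [-List.ofFn_succ]

theorem sdL_ofFn {m : ℕ} (v : Fin m → K) : sdL K (Finsupp.single (List.ofFn v) 1) = sdFin v := by
  simp only [sdL, Finsupp.linearCombination_single, one_smul]
  exact apply_get_ofFn (fun v => sdFin v) v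

theorem tdL_ofFn {m : ℕ} (v : Fin m → K) : tdL K (Finsupp.single (List.ofFn v) 1) = tdFin v := by
  simp only [tdL, Finsupp.linearCombination_single, one_smul]
  exact apply_get_ofFn (fun v => tdFin v) v

theorem sdFin_succ {m : ℕ} (v : Fin (m + 1) → K) :
    sdFin v = coneL (bary v) (sdL K (bdList (List.ofFn v))) := by
  simp only [sdFin, bdList_ofFn, map_sum, map_smul, sdL_ofFn]

theorem tdFin_succ {m : ℕ} (v : Fin (m + 1) → K) :
    tdFin v = coneL (bary v) (Finsupp.single (List.ofFn v) 1 -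
      tdL K (bdList (List.ofFn v))) := by
  simp only [tdFin, bdList_ofFn, map_sum, map_smul, tdL_ofFn]

theorem ofFn_hom_ext {K : Type} {V : Type*} [AddCommGroup V] [Module ℂ V] {f g : ListCh K →ₗ[ℂ] V}
    (h : ∀ m (v : Fin m → K),
      f (Finsupp.single (List.ofFn v) 1) = g (Finsupp.single (List.ofFn v) 1)) : f = g :=
  listCh_hom_ext fun l => by
    obtain ⟨m, v, rfl⟩ := exists_eq_ofFn l
    exact h m v

theorem bdL_sdL (c : ListCh K) : bdL K (sdL K c) = sdL K (bdL K c) := by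
  have : bdL K ∘ₗ sdL K = sdL K ∘ₗ bdL K := by
    refine ofFn_hom_ext fun m => ?_
    simp only [LinearMap.comp_apply, sdL_ofFn, bdL_single]
    induction m with
    | zero => intro v; simp [sdFin, bdList, bdL_single]
    | succ m ih =>
      intro v
      have h : bdL K (sdL K (bdList (List.ofFn v))) = sdL K (bdL K (bdList (List.ofFn v))) := by
        simp only [bdList_ofFn, map_sum, map_smul, sdL_ofFn, ih, bdL_single]
      rw [sdFin_succ, bdL_coneL, h, ← bdL_single, bdL_bdL, map_zero, map_zero, sub_zero]
  exact congr($this c)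

theorem bdL_tdL (c : ListCh K) : bdL K (tdL K c) = c - sdL K c - tdL K (bdL K c) := by
  have : bdL K ∘ₗ tdL K = LinearMap.id - sdL K - tdL K ∘ₗ bdL K := by
    refine ofFn_hom_ext fun m => ?_
    simp only [LinearMap.comp_apply, LinearMap.sub_apply, sdL_ofFn, tdL_ofFn, bdL_single,
      LinearMap.id_apply]
    induction m with
    | zero => intro v; simp [sdFin, tdFin, bdList]
    | succ m ih =>
      intro v
      have h : bdL K (tdL K (bdList (List.ofFn v))) = bdList (List.ofFn v) -
          sdL K (bdList (List.ofFn v)) - tdL K (bdL K (bdList (List.ofFn v))) := by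
        simp only [bdList_ofFn, map_sum, map_smul, sdL_ofFn, tdL_ofFn, ih, bdL_single, smul_sub,
          Finset.sum_sub_distrib]
      have h0 : bdL K (bdList (List.ofFn v)) = 0 := by rw [← bdL_single, bdL_bdL]
      rw [sdFin_succ, tdFin_succ, bdL_coneL, map_sub, h, h0, bdL_single]
      simp
      abel
  exact congr($this c)

theorem sdL_mapL {g : C(K, L)} (hg : IsAffine g) (c : ListCh K) :
    sdL L (mapL g c) = mapL g (sdL K c) := by
  have : sdL L ∘ₗ mapL g = mapL g ∘ₗ sdL K := by
    refine ofFn_hom_ext fun m => ?_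
    simp only [LinearMap.comp_apply, mapL_single, List.map_ofFn, sdL_ofFn]
    induction m with
    | zero => intro v; simp [sdFin, mapL_single]
    | succ m ih =>
      intro v
      simp only [sdFin, mapL_coneL, map_sum, map_smul, hg.map_bary, ← ih]
      rfl
  exact congr($this c)

theorem tdL_mapL {g : C(K, L)} (hg : IsAffine g) (c : ListCh K) :
    tdL L (mapL g c) = mapL g (tdL K c) := by
  have : tdL L ∘ₗ mapL g = mapL g ∘ₗ tdL K := by
    refine ofFn_hom_ext fun m => ?_
    simp only [LinearMap.comp_apply, mapL_single, List.map_ofFn, tdL_ofFn]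
    induction m with
    | zero => intro v; simp [tdFin]
    | succ m ih =>
      intro v
      simp only [tdFin, mapL_coneL, map_sub, map_sum, map_smul, hg.map_bary, ← ih, mapL_single,
        List.map_ofFn]
      rfl
  exact congr($this c)

/-! ### The mesh of the subdivision -/

variable (K) in
/-- The list chains of simplices with at most `N` vertices whose coordinates differ by at most
`r`. -/
def smallL (N : ℕ) (r : ℝ) : Submodule ℂ (ListCh K) :=
  Finsupp.supported ℂ ℂ {l | l.length ≤ N ∧ ∀ x ∈ l, ∀ y ∈ l, ∀ i, |coord i x - coord i y| ≤ r}

variable (K) in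
/-- The list chains of simplices whose `i`-th coordinates lie between `lo` and `hi`. -/
def boxL (i : Ix K) (lo hi : ℝ) : Submodule ℂ (ListCh K) :=
  Finsupp.supported ℂ ℂ {l | ∀ x ∈ l, coord i x ∈ Set.Icc lo hi}

theorem coneL_mem {K : Type} {b : K} {s t : Set (List K)} (h : ∀ l ∈ s, b :: l ∈ t) {c : ListCh K}
    (hc : c ∈ Finsupp.supported ℂ ℂ s) : coneL b c ∈ Finsupp.supported ℂ ℂ t := by
  have : Finsupp.supported ℂ ℂ s ≤ (Finsupp.supported ℂ ℂ t).comap (coneL b) := by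
    rw [Finsupp.supported_eq_span_single, Submodule.span_le]
    rintro _ ⟨l, hl, rfl⟩
    rw [SetLike.mem_coe, Submodule.mem_comap, coneL_single]
    exact Finsupp.single_mem_supported ℂ (1 : ℂ) (h l hl)
  exact this hc

theorem sdFin_mem_boxL {m : ℕ} (v : Fin m → K) {i : Ix K} {lo hi : ℝ}
    (h : ∀ j, coord i (v j) ∈ Set.Icc lo hi) : sdFin v ∈ boxL K i lo hi := by
  induction m with
  | zero => exact Finsupp.single_mem_supported ℂ (1 : ℂ) (by simp)
  | succ m ih =>
    have hb : coord i (bary v) ∈ Set.Icc lo hi := by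
      have hm : (0 : ℝ) < m + 1 := by positivity
      rw [coord_bary, Set.mem_Icc, le_div_iff₀ hm, div_le_iff₀ hm]
      constructor
      · have := Finset.card_nsmul_le_sum Finset.univ (fun j => coord i (v j)) lo fun j _ => (h j).1
        simp at this
        linarith
      · have := Finset.sum_le_card_nsmul Finset.univ (fun j => coord i (v j)) hi fun j _ => (h j).2
        simp at this
        linarith
    refine coneL_mem (s := {l | ∀ x ∈ l, coord i x ∈ Set.Icc lo hi}) (fun l hl => ?_)
      (sum_mem fun j _ => Submodule.smul_mem (boxL K i lo hi) _ (ih _ fun k => h _))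
    exact List.forall_mem_cons.2 ⟨hb, hl⟩

theorem abs_bary_sub_le {m : ℕ} (v : Fin (m + 1) → K) {r : ℝ}
    (h : ∀ j k i, |coord i (v j) - coord i (v k)| ≤ r) (k : Fin (m + 1)) (i : Ix K) :
    |coord i (bary v) - coord i (v k)| ≤ m / (m + 1) * r := by
  have hm : (0 : ℝ) < m + 1 := by positivity
  have : coord i (bary v) - coord i (v k) =
      (∑ j ∈ Finset.univ.erase k, (coord i (v j) - coord i (v k))) / (m + 1) := by
    rw [coord_bary, Finset.sum_erase _ (by simp), Finset.sum_sub_distrib]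
    simp
    field_simp
  rw [this, abs_div, abs_of_pos hm, div_mul_eq_mul_div, div_le_div_iff_of_pos_right hm]
  refine (Finset.abs_sum_le_sum_abs _ _).trans ((Finset.sum_le_card_nsmul _ _ r fun j _ =>
    h j k i).trans ?_)
  simp

theorem sdFin_mem_smallL {m : ℕ} (v : Fin m → K) {N : ℕ} (hN : m ≤ N + 1) {r : ℝ} (hr : 0 ≤ r)
    (h : ∀ j k i, |coord i (v j) - coord i (v k)| ≤ r) :
    sdFin v ∈ smallL K m (N / (N + 1) * r) := by
  induction m with
  | zero => exact Finsupp.single_mem_supported ℂ (1 : ℂ) (by simp)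
  | succ m ih =>
    -- By induction the faces are subdivided finely enough; it remains to compare their vertices
    -- with the barycenter.
    let s : Set (List K) := {l | (l.length ≤ m ∧ ∀ x ∈ l, ∀ y ∈ l, ∀ i,
      |coord i x - coord i y| ≤ N / (N + 1) * r) ∧
      ∀ i, ∀ x ∈ l, coord i x ∈ Set.Icc (coord i (bary v) - N / (N + 1) * r)
        (coord i (bary v) + N / (N + 1) * r)}
    have hN' : (m : ℝ) / (m + 1) ≤ N / (N + 1) := by
      rw [div_le_div_iff₀ (by positivity) (by positivity)]
      have : (m : ℝ) ≤ N := by exact_mod_cast (by omega : m ≤ N)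
      linarith
    have hs : ∀ j : Fin (m + 1), sdFin (v ∘ j.succAbove) ∈ Finsupp.supported ℂ ℂ s := by
      intro j l hl
      refine ⟨ih (v ∘ j.succAbove) (by omega) (fun _ _ _ => h _ _ _) hl, fun i => ?_⟩
      refine sdFin_mem_boxL (v ∘ j.succAbove) (fun k => ?_) hl
      have h1 := abs_le.1 (abs_bary_sub_le v h (j.succAbove k) i)
      have h2 := mul_le_mul_of_nonneg_right hN' hr
      constructor <;> simp only [Function.comp_apply] <;> linarith
    refine coneL_mem (s := s) (fun l hl => ?_) (sum_mem fun j _ =>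
      Submodule.smul_mem (Finsupp.supported ℂ ℂ s) _ (hs j))
    obtain ⟨⟨h1, h2⟩, h3⟩ := hl
    refine ⟨by simpa using h1, fun x hx y hy i => ?_⟩
    have hpos : 0 ≤ (N : ℝ) / (N + 1) * r := by positivity
    rcases List.mem_cons.1 hx with rfl | hx <;> rcases List.mem_cons.1 hy with rfl | hy
    · simpa using hpos
    · have := h3 i y hy
      rw [abs_le]
      constructor <;> linarith [this.1, this.2]
    · have := h3 i x hx
      rw [abs_le]
      constructor <;> linarith [this.1, this.2]
    · exact h2 x hx y hy i

theorem sdL_mem_smallL {N : ℕ} {r : ℝ} (hr : 0 ≤ r) {c : ListCh K} (hc : c ∈ smallL K (N + 1) r) :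
    sdL K c ∈ smallL K (N + 1) (N / (N + 1) * r) := by
  have : smallL K (N + 1) r ≤ (smallL K (N + 1) (N / (N + 1) * r)).comap (sdL K) := by
    rw [smallL, Finsupp.supported_eq_span_single, Submodule.span_le]
    rintro _ ⟨l, hl, rfl⟩
    obtain ⟨m, v, rfl⟩ := exists_eq_ofFn l
    have hm : m ≤ N + 1 := by simpa using hl.1
    rw [SetLike.mem_coe, Submodule.mem_comap, sdL_ofFn]
    intro l' hl'
    have h1 := sdFin_mem_smallL v hm hr (fun j k i =>
      hl.2 _ ((List.mem_ofFn' v _).2 ⟨j, rfl⟩) _ ((List.mem_ofFn' v _).2 ⟨k, rfl⟩) i) hl'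
    exact ⟨h1.1.trans hm, h1.2⟩
  exact this hc

end Lists

/-! ### Supports of singular chains -/

section Spaces
variable {X Y Z : Type} [TopologicalSpace X] [TopologicalSpace Y] [TopologicalSpace Z]

/-- The singular chains all of whose simplices lie in `W`. -/
def supp (W : Set X) : Submodule ℂ (Chain X) := Finsupp.supported ℂ ℂ {s | ∀ t, s.2 t ∈ W}

theorem single_mem_supp {W : Set X} {n : ℕ} {τ : C(stdSimplex ℝ (Fin (n + 1)), X)}
    (h : ∀ t, τ t ∈ W) : (Finsupp.single ⟨n, τ⟩ 1 : Chain X) ∈ supp W :=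
  Finsupp.single_mem_supported ℂ (1 : ℂ) h

theorem supp_mono {V W : Set X} (h : V ⊆ W) : supp V ≤ supp W :=
  Finsupp.supported_mono fun _ hs t => h (hs t)

theorem mem_supp_inter {V W : Set X} {c : Chain X} (hV : c ∈ supp V) (hW : c ∈ supp W) :
    c ∈ supp (V ∩ W) := fun _ hs t => ⟨hV hs t, hW hs t⟩

theorem mem_supp_univ (c : Chain X) : c ∈ supp (Set.univ : Set X) := fun _ _ _ => trivial

/-- A linear condition on the chains in `W` needs to be checked on simplices only. -/
theorem supp_le_of_simplices {W : Set X} {p : Submodule ℂ (Chain X)}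
    (h : ∀ n (τ : C(stdSimplex ℝ (Fin (n + 1)), X)), (∀ t, τ t ∈ W) →
      (Finsupp.single ⟨n, τ⟩ 1 : Chain X) ∈ p) : supp W ≤ p := by
  rw [supp, Finsupp.supported_eq_span_single, Submodule.span_le]
  rintro _ ⟨s, hs, rfl⟩
  exact h s.1 s.2 hs

theorem push_mem_supp (f : C(X, Y)) {W : Set X} {V : Set Y} (h : ∀ x ∈ W, f x ∈ V) {c : Chain X}
    (hc : c ∈ supp W) : push f c ∈ supp V := by
  have : supp W ≤ (supp V).comap (push f) := supp_le_of_simplices fun n τ hτ => by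
    rw [Submodule.mem_comap, push_single]
    exact single_mem_supp fun t => h _ (hτ t)
  exact this hc

theorem push_mem_supp_of_forall (f : C(X, Y)) {V : Set Y} (h : ∀ x, f x ∈ V) (c : Chain X) :
    push f c ∈ supp V :=
  push_mem_supp f (fun x _ => h x) (mem_supp_univ c)

theorem bd_mem_supp {W : Set X} {c : Chain X} (hc : c ∈ supp W) : bd X c ∈ supp W := by
  have : supp W ≤ (supp W).comap (bd X) := supp_le_of_simplices fun n τ hτ => by
    rw [Submodule.mem_comap, single_eq_push, bd_push]
    exact push_mem_supp_of_forall _ hτ _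
  exact this hc

/-! ### Barycentric subdivision of singular chains -/

variable (X) in
/-- Barycentric subdivision of singular chains. -/
def sd : Chain X →ₗ[ℂ] Chain X :=
  Finsupp.linearCombination ℂ fun s => push s.2 (realize _ (sdL _ (stdL s.1)))

variable (X) in
/-- The chain homotopy from the identity to the barycentric subdivision of singular chains. -/
def td : Chain X →ₗ[ℂ] Chain X :=
  Finsupp.linearCombination ℂ fun s => push s.2 (realize _ (tdL _ (stdL s.1)))

theorem sd_single {n : ℕ} (τ : C(stdSimplex ℝ (Fin (n + 1)), X)) :
    sd X (Finsupp.single ⟨n, τ⟩ 1) = push τ (realize _ (sdL _ (stdL n))) := by simp [sd]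

theorem td_single {n : ℕ} (τ : C(stdSimplex ℝ (Fin (n + 1)), X)) :
    td X (Finsupp.single ⟨n, τ⟩ 1) = push τ (realize _ (tdL _ (stdL n))) := by simp [td]

theorem sd_push (f : C(X, Y)) (c : Chain X) : sd Y (push f c) = push f (sd X c) := by
  have : sd Y ∘ₗ push f = push f ∘ₗ sd X :=
    chain_hom_ext fun n τ => by
      simp only [LinearMap.comp_apply, push_single, sd_single, push_comp]
  exact congr($this c)

theorem td_push (f : C(X, Y)) (c : Chain X) : td Y (push f c) = push f (td X c) := by
  have : td Y ∘ₗ push f = push f ∘ₗ td X :=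
    chain_hom_ext fun n τ => by
      simp only [LinearMap.comp_apply, push_single, td_single, push_comp]
  exact congr($this c)

section Affine
variable {K : Type} [TopologicalSpace K] [ConvexComb K]

theorem mapL_comb_stdL {m : ℕ} (v : Fin (m + 1) → K) :
    mapL (comb v) (stdL m) = Finsupp.single (List.ofFn v) 1 := by
  rw [stdL, mapL_single, List.map_ofFn]
  congr 2
  exact funext fun i => comb_apply_stdVert v i

theorem sd_realize (c : ListCh K) : sd K (realize K c) = realize K (sdL K c) := by
  have : sd K ∘ₗ realize K = realize K ∘ₗ sdL K := by
    refine ofFn_hom_ext fun m v => ?_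
    simp only [LinearMap.comp_apply, realize_single]
    cases m with
    | zero => rw [sdL_ofFn]; simp [realizeList, sdFin, realize_single]
    | succ m =>
      rw [realizeList_ofFn, sd_single, ← realize_mapL (isAffine_comb v),
        ← sdL_mapL (isAffine_comb v), mapL_comb_stdL]
  exact congr($this c)

theorem td_realize (c : ListCh K) : td K (realize K c) = realize K (tdL K c) := by
  have : td K ∘ₗ realize K = realize K ∘ₗ tdL K := by
    refine ofFn_hom_ext fun m v => ?_
    simp only [LinearMap.comp_apply, realize_single]
    cases m with
    | zero => rw [tdL_ofFn]; simp [realizeList, tdFin]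
    | succ m =>
      rw [realizeList_ofFn, td_single, ← realize_mapL (isAffine_comb v),
        ← tdL_mapL (isAffine_comb v), mapL_comb_stdL]
  exact congr($this c)

end Affine

theorem bd_sd (c : Chain X) : bd X (sd X c) = sd X (bd X c) := by
  have : bd X ∘ₗ sd X = sd X ∘ₗ bd X := chain_hom_ext fun n τ => by
    simp only [LinearMap.comp_apply]
    rw [single_eq_push]
    simp only [sd_push, bd_push, sd_realize, bd_realize, bdL_sdL]
  exact congr($this c)

theorem bd_td (c : Chain X) : bd X (td X c) = c - sd X c - td X (bd X c) := by
  have : bd X ∘ₗ td X = LinearMap.id - sd X - td X ∘ₗ bd X := chain_hom_ext fun n τ => by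
    simp only [LinearMap.comp_apply, LinearMap.sub_apply, LinearMap.id_apply]
    rw [single_eq_push]
    simp only [sd_push, td_push, bd_push, sd_realize, td_realize, bd_realize, bdL_tdL, map_sub]
  exact congr($this c)

theorem sd_mem_supp {W : Set X} {c : Chain X} (hc : c ∈ supp W) : sd X c ∈ supp W := by
  have : supp W ≤ (supp W).comap (sd X) := supp_le_of_simplices fun n τ hτ => by
    rw [Submodule.mem_comap, sd_single]
    exact push_mem_supp_of_forall _ hτ _
  exact this hc

theorem td_mem_supp {W : Set X} {c : Chain X} (hc : c ∈ supp W) : td X c ∈ supp W := by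
  have : supp W ≤ (supp W).comap (td X) := supp_le_of_simplices fun n τ hτ => by
    rw [Submodule.mem_comap, td_single]
    exact push_mem_supp_of_forall _ hτ _
  exact this hc

theorem sd_pow_mem_supp (m : ℕ) {W : Set X} {c : Chain X} (hc : c ∈ supp W) :
    (sd X ^ m) c ∈ supp W := by
  induction m with
  | zero => exact hc
  | succ m ih => rw [pow_succ', Module.End.mul_apply]; exact sd_mem_supp ih

theorem bd_sd_pow (m : ℕ) (c : Chain X) : bd X ((sd X ^ m) c) = (sd X ^ m) (bd X c) := by
  induction m with
  | zero => rfl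
  | succ m ih => rw [pow_succ', Module.End.mul_apply, Module.End.mul_apply, bd_sd, ih]

theorem sd_pow_push (m : ℕ) (f : C(X, Y)) (c : Chain X) :
    (sd Y ^ m) (push f c) = push f ((sd X ^ m) c) := by
  induction m with
  | zero => rfl
  | succ m ih => rw [pow_succ', pow_succ', Module.End.mul_apply, Module.End.mul_apply, ih, sd_push]

/-- The iterated subdivision is chain homotopic to the identity, within every subspace. -/
theorem exists_homotopy_sd_pow (m : ℕ) : ∃ T : Chain X →ₗ[ℂ] Chain X,
    (∀ c, bd X (T c) = c - (sd X ^ m) c - T (bd X c)) ∧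
    ∀ (W : Set X) (c : Chain X), c ∈ supp W → T c ∈ supp W := by
  induction m with
  | zero => exact ⟨0, by simp, fun W c _ => zero_mem _⟩
  | succ m ih =>
    obtain ⟨T, h1, h2⟩ := ih
    refine ⟨T + td X ∘ₗ (sd X ^ m), fun c => ?_, fun W c hc =>
      add_mem (h2 W c hc) (td_mem_supp (sd_pow_mem_supp m hc))⟩
    simp only [LinearMap.add_apply, LinearMap.comp_apply, map_add, h1, bd_td, bd_sd_pow,
      pow_succ', Module.End.mul_apply]
    abel

/-- A list chain of small mesh gives small simplices. -/
theorem push_realize_mem_of_small {n N : ℕ} (τ : C(stdSimplex ℝ (Fin (n + 1)), X)) {U V : Set X}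
    {r δ : ℝ} (hr : r < δ) (hδ : ∀ x, Metric.ball x δ ⊆ τ ⁻¹' U ∨ Metric.ball x δ ⊆ τ ⁻¹' V)
    {c : ListCh (stdSimplex ℝ (Fin (n + 1)))} (hc : c ∈ smallL _ N r) :
    push τ (realize _ c) ∈ supp U ⊔ supp V := by
  have : smallL (stdSimplex ℝ (Fin (n + 1))) N r ≤
      (supp U ⊔ supp V).comap (push τ ∘ₗ realize _) := by
    rw [smallL, Finsupp.supported_eq_span_single, Submodule.span_le]
    rintro _ ⟨l, hl, rfl⟩
    obtain ⟨m, v, rfl⟩ := exists_eq_ofFn l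
    rw [SetLike.mem_coe, Submodule.mem_comap, LinearMap.comp_apply, realize_single]
    cases m with
    | zero => simp [realizeList]
    | succ m =>
      rw [realizeList_ofFn, push_single]
      have hv : ∀ t, comb v t ∈ Metric.ball (v 0) δ := by
        intro t
        rw [Metric.mem_ball]
        have h0 : 0 ≤ r := (abs_nonneg _).trans (hl.2 (v 0) (by simp) (v 0) (by simp)
          (0 : Fin (n + 1)))
        refine lt_of_le_of_lt ?_ hr
        rw [Subtype.dist_eq]
        refine (dist_pi_le_iff h0).2 fun i => ?_
        have h1 := coord_comb v t i
        have h2 : coord i (v 0) = ∑ j, t j * coord i (v 0) := by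
          rw [← Finset.sum_mul, stdSimplex.sum_eq_one, one_mul]
        rw [Real.dist_eq]
        change |coord i (comb v t) - coord i (v 0)| ≤ r
        rw [h1, h2, ← Finset.sum_sub_distrib]
        refine (Finset.abs_sum_le_sum_abs _ _).trans ?_
        calc ∑ j, |t j * coord i (v j) - t j * coord i (v 0)|
            ≤ ∑ j, t j * r := by
              refine Finset.sum_le_sum fun j _ => ?_
              rw [← mul_sub, abs_mul, abs_of_nonneg (show 0 ≤ t j from t.2.1 j)]
              exact mul_le_mul_of_nonneg_left (hl.2 _ (by simp [-List.ofFn_succ]) _ (by simp) i)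
                (t.2.1 j)
          _ = r := by rw [← Finset.sum_mul, stdSimplex.sum_eq_one, one_mul]
      rcases hδ (v 0) with h | h
      · exact Submodule.mem_sup_left (single_mem_supp fun t => h (hv t))
      · exact Submodule.mem_sup_right (single_mem_supp fun t => h (hv t))
  exact this hc

theorem stdL_mem_smallL (n : ℕ) : stdL n ∈ smallL _ (n + 1) 1 := by
  refine Finsupp.single_mem_supported ℂ (1 : ℂ) ⟨by simp, fun x _ y _ i => ?_⟩
  have h1 := x.2.1 i
  have h2 := stdSimplex.le_one x i
  have h3 := y.2.1 i
  have h4 := stdSimplex.le_one y i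
  change |x i - y i| ≤ 1
  change 0 ≤ x i at h1
  change 0 ≤ y i at h3
  rw [abs_le]
  constructor <;> linarith

theorem sdL_pow_stdL_mem (n m : ℕ) :
    (sdL _ ^ m) (stdL n) ∈ smallL _ (n + 1) (((n : ℝ) / (n + 1)) ^ m) := by
  induction m with
  | zero => simpa using stdL_mem_smallL n
  | succ m ih =>
    rw [pow_succ', pow_succ', Module.End.mul_apply]
    exact sdL_mem_smallL (by positivity) ih

theorem sd_pow_mem_mono {U V : Set X} {m : ℕ} {c : Chain X}
    (h : (sd X ^ m) c ∈ supp U ⊔ supp V) {k : ℕ} (hk : m ≤ k) :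
    (sd X ^ k) c ∈ supp U ⊔ supp V := by
  induction k, hk using Nat.le_induction with
  | base => exact h
  | succ k _ ih =>
    rw [pow_succ', Module.End.mul_apply]
    obtain ⟨a, ha, b, hb, hab⟩ := Submodule.mem_sup.1 ih
    rw [← hab, map_add]
    exact add_mem (Submodule.mem_sup_left (sd_mem_supp ha))
      (Submodule.mem_sup_right (sd_mem_supp hb))

/-- After sufficiently many subdivisions a chain in the union of two open sets is a sum of chains
in these sets. -/
theorem exists_sd_pow_mem {U V : Set X} (hU : IsOpen U) (hV : IsOpen V) {c : Chain X}
    (hc : c ∈ supp (U ∪ V)) : ∃ m, (sd X ^ m) c ∈ supp U ⊔ supp V := by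
  let p : Submodule ℂ (Chain X) :=
    { carrier := {c | ∃ m, (sd X ^ m) c ∈ supp U ⊔ supp V}
      zero_mem' := ⟨0, by simp⟩
      add_mem' := by
        rintro a b ⟨m, hm⟩ ⟨k, hk⟩
        refine ⟨max m k, ?_⟩
        rw [map_add]
        exact add_mem (sd_pow_mem_mono hm (le_max_left _ _))
          (sd_pow_mem_mono hk (le_max_right _ _))
      smul_mem' := by
        rintro r a ⟨m, hm⟩
        exact ⟨m, by rw [map_smul]; exact Submodule.smul_mem _ _ hm⟩ }
  have : supp (U ∪ V) ≤ p := supp_le_of_simplices fun n τ hτ => by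
    obtain ⟨δ, hδ0, hδ⟩ := lebesgue_number_lemma_of_metric (s := Set.univ)
      (c := fun b : Bool => if b then τ ⁻¹' U else τ ⁻¹' V) isCompact_univ
      (fun b => by cases b; exacts [hV.preimage τ.continuous, hU.preimage τ.continuous])
      (fun x _ => by
        rcases hτ x with h | h
        · exact Set.mem_iUnion.2 ⟨true, h⟩
        · exact Set.mem_iUnion.2 ⟨false, h⟩)
    obtain ⟨m, hm⟩ := exists_pow_lt_of_lt_one hδ0
      (show ((n : ℝ) / (n + 1)) < 1 by rw [div_lt_one (by positivity)]; linarith)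
    refine ⟨m, ?_⟩
    have h1 : (sd X ^ m) (Finsupp.single ⟨n, τ⟩ 1) =
        push τ (realize _ ((sdL _ ^ m) (stdL n))) := by
      rw [single_eq_push, sd_pow_push]
      congr 1
      clear hm
      induction m with
      | zero => rfl
      | succ m ih => rw [pow_succ', pow_succ', Module.End.mul_apply, Module.End.mul_apply, ih,
          sd_realize]
    rw [h1]
    refine push_realize_mem_of_small τ hm (fun x => ?_) (sdL_pow_stdL_mem n m)
    obtain ⟨b, hb⟩ := hδ x trivial
    cases b
    · exact .inr hb
    · exact .inl hb
  exact this hc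

/-! ### Excision -/

/-- Two chains are homologous within `W`. -/
def HomologousIn (W : Set X) (a b : Chain X) : Prop := ∃ c ∈ supp W, a - b = bd X c

theorem HomologousIn.refl (W : Set X) (a : Chain X) : HomologousIn W a a :=
  ⟨0, zero_mem _, by simp⟩

theorem HomologousIn.of_eq {W : Set X} {a b : Chain X} (h : a = b) : HomologousIn W a b :=
  h ▸ .refl W a

theorem HomologousIn.symm {W : Set X} {a b : Chain X} (h : HomologousIn W a b) :
    HomologousIn W b a := by
  obtain ⟨c, hc, h⟩ := h
  exact ⟨-c, neg_mem hc, by rw [map_neg, ← h, neg_sub]⟩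

theorem HomologousIn.trans {W : Set X} {a b c : Chain X} (h : HomologousIn W a b)
    (h' : HomologousIn W b c) : HomologousIn W a c := by
  obtain ⟨e, he, h⟩ := h
  obtain ⟨e', he', h'⟩ := h'
  exact ⟨e + e', add_mem he he', by rw [map_add, ← h, ← h', sub_add_sub_cancel]⟩

theorem HomologousIn.add {W : Set X} {a b a' b' : Chain X} (h : HomologousIn W a b)
    (h' : HomologousIn W a' b') : HomologousIn W (a + a') (b + b') := by
  obtain ⟨e, he, h⟩ := h
  obtain ⟨e', he', h'⟩ := h'
  exact ⟨e + e', add_mem he he', by rw [map_add, ← h, ← h', add_sub_add_comm]⟩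

theorem HomologousIn.smul {W : Set X} {a b : Chain X} (r : ℂ) (h : HomologousIn W a b) :
    HomologousIn W (r • a) (r • b) := by
  obtain ⟨e, he, h⟩ := h
  exact ⟨r • e, Submodule.smul_mem _ _ he, by rw [map_smul, ← h, smul_sub]⟩

theorem HomologousIn.neg {W : Set X} {a b : Chain X} (h : HomologousIn W a b) :
    HomologousIn W (-a) (-b) := by
  simpa using h.smul (-1)

theorem HomologousIn.sub {W : Set X} {a b a' b' : Chain X} (h : HomologousIn W a b)
    (h' : HomologousIn W a' b') : HomologousIn W (a - a') (b - b') := by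
  simpa [sub_eq_add_neg] using h.add h'.neg

theorem HomologousIn.mono {V W : Set X} {a b : Chain X} (h : HomologousIn V a b) (hVW : V ⊆ W) :
    HomologousIn W a b := by
  obtain ⟨e, he, h⟩ := h
  exact ⟨e, supp_mono hVW he, h⟩

theorem HomologousIn.push {V : Set X} {W : Set Y} {a b : Chain X} (h : HomologousIn V a b)
    (f : C(X, Y)) (hf : ∀ x ∈ V, f x ∈ W) : HomologousIn W (push f a) (push f b) := by
  obtain ⟨e, he, h⟩ := h
  exact ⟨SpringerTwoRow.push f e, push_mem_supp f hf he, by rw [bd_push, ← h, map_sub]⟩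

theorem HomologousIn.bd_eq {W : Set X} {a b : Chain X} (h : HomologousIn W a b) :
    bd X a = bd X b := by
  obtain ⟨e, -, h⟩ := h
  rw [← sub_eq_zero, ← map_sub, h, bd_bd]

/-- A lift of a chain along a map through which its simplices lift. -/
theorem exists_lift_chain (f : C(X, Y)) {A : Set Y}
    (hlift : ∀ n (τ : C(stdSimplex ℝ (Fin (n + 1)), Y)), (∀ t, τ t ∉ A) →
      ∃ τ' : C(stdSimplex ℝ (Fin (n + 1)), X), f.comp τ' = τ)
    {c : Chain Y} (hc : c ∈ supp Aᶜ) : ∃ c' ∈ supp (f ⁻¹' A)ᶜ, push f c' = c := by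
  have : supp Aᶜ ≤ (supp (f ⁻¹' A)ᶜ).map (push f) := supp_le_of_simplices fun n τ hτ => by
    obtain ⟨τ', h⟩ := hlift n τ hτ
    refine ⟨_, single_mem_supp (τ := τ') fun t ht => hτ t ?_, by rw [push_single, h]⟩
    rw [← h]
    exact ht
  exact this hc

/-- The excision argument: a map `f : X → Y` that restricts to a homeomorphism from the complement
of `f ⁻¹ A` onto the complement of the closed set `A` (which is expressed by the lifting of
simplices), and a neighbourhood `N` of `A`. A cycle of `X` whose image bounds is homologous to a
cycle in `f ⁻¹ N` whose image bounds in `N`. -/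
theorem excision (f : C(X, Y)) {A N : Set Y} (hA : IsClosed A) (hN : IsOpen N) (hAN : A ⊆ N)
    (hinj : ∀ x x', f x ∉ A → f x = f x' → x = x')
    (hlift : ∀ n (τ : C(stdSimplex ℝ (Fin (n + 1)), Y)), (∀ t, τ t ∉ A) →
      ∃ τ' : C(stdSimplex ℝ (Fin (n + 1)), X), f.comp τ' = τ)
    {z : Chain X} (hz : bd X z = 0) {b : Chain Y} (hb : push f z = bd Y b) :
    ∃ w ∈ supp (f ⁻¹' N), bd X w = 0 ∧ HomologousIn Set.univ z w ∧
      HomologousIn N (push f w) 0 := by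
  have hcover : N ∪ Aᶜ = Set.univ :=
    Set.eq_univ_of_forall fun y => (em (y ∈ A)).imp (fun h => hAN h) id
  obtain ⟨m₁, hm₁⟩ := exists_sd_pow_mem hN hA.isOpen_compl (hcover ▸ mem_supp_univ b)
  obtain ⟨m₂, hm₂⟩ := exists_sd_pow_mem (U := f ⁻¹' N) (V := (f ⁻¹' A)ᶜ) (c := z)
    (hN.preimage f.continuous) (hA.preimage f.continuous).isOpen_compl (by
      rw [← Set.preimage_compl, ← Set.preimage_union, hcover]
      exact mem_supp_univ z)
  set m := max m₁ m₂
  -- Of the subdivided bounding chain, the part `c₂` away from `A` is lifted to `X`, and the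
  -- boundary of the lift is subtracted from the subdivided cycle.
  obtain ⟨c₁, hc₁, c₂, hc₂, hc⟩ := Submodule.mem_sup.1 (sd_pow_mem_mono hm₁ (le_max_left m₁ m₂))
  obtain ⟨c₂', hc₂', hpush⟩ := exists_lift_chain f hlift hc₂
  obtain ⟨z₁, hz₁, z₂, hz₂, hzz⟩ := Submodule.mem_sup.1 (sd_pow_mem_mono hm₂ (le_max_right m₁ m₂))
  obtain ⟨T, hT, -⟩ := exists_homotopy_sd_pow (X := X) m
  have hfw : push f ((sd X ^ m) z - bd X c₂') = bd Y c₁ := by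
    rw [map_sub, ← sd_pow_push, hb, ← bd_sd_pow, ← hc, map_add, ← bd_push, hpush,
      add_sub_cancel_right]
  refine ⟨(sd X ^ m) z - bd X c₂', ?_, ?_, ?_, ?_⟩
  · have hw2 : push f (z₂ - bd X c₂') ∈ supp N := by
      have : push f (z₂ - bd X c₂') = bd Y c₁ - push f z₁ := by
        rw [← hfw, ← map_sub, ← hzz]
        congr 1
        abel
      rw [this]
      exact sub_mem (bd_mem_supp hc₁) (push_mem_supp f (fun _ h => h) hz₁)
    have hw2' : z₂ - bd X c₂' ∈ supp (f ⁻¹' A)ᶜ := sub_mem hz₂ (bd_mem_supp hc₂')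
    rw [← hzz, add_sub_assoc]
    refine add_mem hz₁ fun s hs t => ?_
    -- On the simplices outside `f ⁻¹ A` the map `f` is injective, so nothing cancels.
    have hval := Finsupp.mapDomain_apply' ({s | ∀ t, s.2 t ∈ (f ⁻¹' A)ᶜ} : Set (Simp X))
      (f := fun s : Simp X => (⟨s.1, f.comp s.2⟩ : Simp Y)) (z₂ - bd X c₂') hw2'
      (fun s hs s' hs' h => by
        obtain ⟨n, τ⟩ := s
        obtain ⟨n', τ'⟩ := s'
        simp only [Sigma.mk.injEq] at h
        obtain ⟨rfl, h⟩ := h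
        congr 1
        exact ContinuousMap.ext fun t => hinj _ _ (hs t) congr($(eq_of_heq h) t)) (hw2' hs)
    have hmem : (⟨s.1, f.comp s.2⟩ : Simp Y) ∈ (push f (z₂ - bd X c₂')).support := by
      rw [Finsupp.mem_support_iff]
      exact fun h => (Finsupp.mem_support_iff.1 hs) (hval.symm.trans h)
    exact hw2 hmem t
  · rw [map_sub, bd_sd_pow, hz, map_zero, bd_bd, sub_zero]
  · refine ⟨T z + c₂', mem_supp_univ _, ?_⟩
    rw [map_add, hT, hz, map_zero]
    abel
  · exact ⟨c₁, hc₁, by rw [sub_zero, hfw]⟩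

end Spaces

/-! ### Homotopies -/

section Spaces
variable {X Y Z : Type} [TopologicalSpace X] [TopologicalSpace Y] [TopologicalSpace Z]

/-- The chain swept out by a chain under a homotopy. -/
def sweep (F : C(X × I, Y)) : Chain X →ₗ[ℂ] Chain Y := push F ∘ₗ prism X

theorem sweep_push (F : C(Y × I, Z)) (f : C(X, Y)) (c : Chain X) :
    sweep F (push f c) = sweep (F.comp (f.prodMap (ContinuousMap.id I))) c := by
  simp only [sweep, LinearMap.comp_apply, prism_push, push_comp]

theorem push_sweep (g : C(Y, Z)) (F : C(X × I, Y)) (c : Chain X) :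
    push g (sweep F c) = sweep (g.comp F) c := by
  simp only [sweep, LinearMap.comp_apply, push_comp]

theorem bd_sweep (F : C(X × I, Y)) (c : Chain X) :
    bd Y (sweep F c) = push (F.comp (atTime X 1)) c - push (F.comp (atTime X 0)) c -
      sweep F (bd X c) := by
  simp only [sweep, LinearMap.comp_apply, bd_push, bd_prism, map_sub, push_comp]

theorem sweep_mem_supp_of_forall {F : C(X × I, Y)} {V : Set Y} (h : ∀ x, F x ∈ V) (c : Chain X) :
    sweep F c ∈ supp V :=
  push_mem_supp_of_forall F h _

theorem HomologousIn.of_homotopy (F : C(X × I, Y)) {V : Set Y} (h : ∀ x, F x ∈ V) {z : Chain X}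
    (hz : bd X z = 0) :
    HomologousIn V (SpringerTwoRow.push (F.comp (atTime X 1)) z)
      (SpringerTwoRow.push (F.comp (atTime X 0)) z) :=
  ⟨sweep F z, sweep_mem_supp_of_forall h z, by rw [bd_sweep, hz, map_zero, sub_zero]⟩

/-- The inclusion of a subspace. -/
def valMap (W : Set X) : C(W, X) := ⟨Subtype.val, continuous_subtype_val⟩

theorem push_valMap_injective (W : Set X) : Function.Injective (push (valMap W)) :=
  Finsupp.mapDomain_injective fun s s' h => by
    obtain ⟨n, τ⟩ := s
    obtain ⟨n', τ'⟩ := s'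
    simp only [Sigma.mk.injEq] at h
    obtain ⟨rfl, h⟩ := h
    congr 1
    exact ContinuousMap.ext fun t => Subtype.ext congr($(eq_of_heq h) t)

theorem exists_restrict {W : Set X} {c : Chain X} (hc : c ∈ supp W) :
    ∃ c' : Chain W, push (valMap W) c' = c := by
  have : supp W ≤ LinearMap.range (push (valMap W)) := supp_le_of_simplices fun n τ hτ =>
    ⟨Finsupp.single ⟨n, ⟨fun t => ⟨τ t, hτ t⟩, by fun_prop⟩⟩ 1, by rw [push_single]; rfl⟩
  exact this hc

/-- A homotopy on `W`, within `V`, from the identity to the restriction of a map `r`. -/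
theorem HomologousIn.of_homotopy_on {W V : Set X} (F : C(W × I, X)) (r : C(X, X))
    (h0 : ∀ x, F (x, 0) = x) (h1 : ∀ x : W, F (x, 1) = r x) (hF : ∀ x, F x ∈ V)
    {z : Chain X} (hz : bd X z = 0) (hzW : z ∈ supp W) :
    HomologousIn V z (SpringerTwoRow.push r z) := by
  obtain ⟨z', rfl⟩ := exists_restrict hzW
  have hz' : bd W z' = 0 := push_valMap_injective W (by rw [← bd_push, hz, map_zero])
  have := (HomologousIn.of_homotopy F hF hz').symm
  rw [push_comp]
  convert this using 2
  · congr 1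
    exact ContinuousMap.ext fun x => (h0 x).symm
  · congr 1
    exact ContinuousMap.ext fun x => (h1 x).symm

theorem supp_empty : supp (∅ : Set X) = ⊥ := by
  rw [eq_bot_iff]
  refine supp_le_of_simplices fun n τ hτ => (hτ (stdVert n 0)).elim

/-! ### The Mayer-Vietoris relation -/

/-- `e` represents the image of the class of `z` under the connecting homomorphism of the
Mayer-Vietoris sequence for the union of `U` and `V`. -/
def MVRel (U V : Set X) (z e : Chain X) : Prop :=
  ∃ w₁ ∈ supp U, ∃ w₂ ∈ supp V, HomologousIn (U ∪ V) z (w₁ + w₂) ∧ e = bd X w₁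

theorem MVRel.add {U V : Set X} {z e z' e' : Chain X} (h : MVRel U V z e) (h' : MVRel U V z' e') :
    MVRel U V (z + z') (e + e') := by
  obtain ⟨w₁, h₁, w₂, h₂, hz, rfl⟩ := h
  obtain ⟨w₁', h₁', w₂', h₂', hz', rfl⟩ := h'
  refine ⟨w₁ + w₁', add_mem h₁ h₁', w₂ + w₂', add_mem h₂ h₂', ?_, (map_add _ _ _).symm⟩
  rw [add_add_add_comm]
  exact hz.add hz'

theorem MVRel.smul {U V : Set X} {z e : Chain X} (r : ℂ) (h : MVRel U V z e) :
    MVRel U V (r • z) (r • e) := by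
  obtain ⟨w₁, h₁, w₂, h₂, hz, rfl⟩ := h
  refine ⟨r • w₁, Submodule.smul_mem _ _ h₁, r • w₂, Submodule.smul_mem _ _ h₂, ?_,
    (map_smul _ _ _).symm⟩
  rw [← smul_add]
  exact hz.smul r

theorem MVRel.swap {U V : Set X} {z e : Chain X} (h : MVRel U V z e) (hz : bd X z = 0) :
    MVRel V U z (-e) := by
  obtain ⟨w₁, h₁, w₂, h₂, hw, rfl⟩ := h
  refine ⟨w₂, h₂, w₁, h₁, ?_, ?_⟩
  · rw [add_comm, Set.union_comm]
    exact hw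
  · have := hw.bd_eq
    rw [hz, map_add] at this
    exact neg_eq_of_add_eq_zero_right this.symm

theorem MVRel.bd_eq_zero {U V : Set X} {z e : Chain X} (h : MVRel U V z e) : bd X e = 0 := by
  obtain ⟨w₁, -, w₂, -, -, rfl⟩ := h
  exact bd_bd w₁

theorem MVRel.mem_supp {U V : Set X} {z e : Chain X} (h : MVRel U V z e) (hz : bd X z = 0) :
    e ∈ supp (U ∩ V) := by
  obtain ⟨w₁, h₁, w₂, h₂, hw, rfl⟩ := h
  have := hw.bd_eq
  rw [hz, map_add] at this
  refine mem_supp_inter (bd_mem_supp h₁) ?_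
  rw [eq_neg_of_add_eq_zero_left this.symm]
  exact neg_mem (bd_mem_supp h₂)

theorem MVRel.push_homologous {U V : Set X} {z e : Chain X} (h : MVRel U V z e) (f : C(X, Y)) :
    HomologousIn Set.univ (push f e) 0 := by
  obtain ⟨w₁, -, w₂, -, -, rfl⟩ := h
  exact ⟨push f w₁, mem_supp_univ _, by rw [bd_push, sub_zero]⟩

theorem exists_mvRel {U V : Set X} (hU : IsOpen U) (hV : IsOpen V) {z : Chain X}
    (hz : bd X z = 0) (hzW : z ∈ supp (U ∪ V)) : ∃ e, MVRel U V z e := by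
  obtain ⟨m, hm⟩ := exists_sd_pow_mem hU hV hzW
  obtain ⟨w₁, h₁, w₂, h₂, hw⟩ := Submodule.mem_sup.1 hm
  obtain ⟨T, hT, hTW⟩ := exists_homotopy_sd_pow (X := X) m
  exact ⟨_, w₁, h₁, w₂, h₂, ⟨T z, hTW _ _ hzW, by rw [hw, hT, hz, map_zero, sub_zero]⟩, rfl⟩

theorem homologousIn_sd_pow (m : ℕ) {W : Set X} {z : Chain X} (hz : bd X z = 0)
    (hzW : z ∈ supp W) : HomologousIn W z ((sd X ^ m) z) := by
  obtain ⟨T, hT, hTW⟩ := exists_homotopy_sd_pow (X := X) m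
  exact ⟨T z, hTW _ _ hzW, by rw [hT, hz, map_zero, sub_zero]⟩

/-- If a sum of chains in two open sets bounds in their union, then after subdivision the first
chain is a boundary up to a chain in the intersection. -/
theorem exists_of_sum_bounds {U V : Set X} (hU : IsOpen U) (hV : IsOpen V) {w₁ w₂ : Chain X}
    (h₁ : w₁ ∈ supp U) (h₂ : w₂ ∈ supp V) (h : HomologousIn (U ∪ V) (w₁ + w₂) 0) :
    ∃ m, ∃ f ∈ supp (U ∩ V), ∃ c ∈ supp U, (sd X ^ m) w₁ = f + bd X c := by
  obtain ⟨c, hc, h⟩ := h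
  obtain ⟨m, hm⟩ := exists_sd_pow_mem hU hV hc
  obtain ⟨c₁, hc₁, c₂, hc₂, hcc⟩ := Submodule.mem_sup.1 hm
  have key : (sd X ^ m) w₁ - bd X c₁ = bd X c₂ - (sd X ^ m) w₂ := by
    have h3 : (sd X ^ m) (w₁ + w₂) = bd X c₁ + bd X c₂ := by
      rw [← map_add, hcc, bd_sd_pow, ← h, sub_zero]
    rw [map_add] at h3
    rw [sub_eq_sub_iff_add_eq_add, h3, add_comm]
  refine ⟨m, (sd X ^ m) w₁ - bd X c₁, mem_supp_inter
    (sub_mem (sd_pow_mem_supp m h₁) (bd_mem_supp hc₁)) ?_, c₁, hc₁, (sub_add_cancel _ _).symm⟩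
  rw [key]
  exact sub_mem (bd_mem_supp hc₂) (sd_pow_mem_supp m h₂)

/-- The Mayer-Vietoris relation is well defined on homology classes. -/
theorem MVRel.homologous_zero {U V : Set X} (hU : IsOpen U) (hV : IsOpen V) {z e : Chain X}
    (h : MVRel U V z e) (hz : bd X z = 0) (hz0 : HomologousIn (U ∪ V) z 0) :
    HomologousIn (U ∩ V) e 0 := by
  have he := h.mem_supp hz
  obtain ⟨w₁, h₁, w₂, h₂, hw, rfl⟩ := h
  obtain ⟨m, f, hf, c, hc, hm⟩ := exists_of_sum_bounds hU hV h₁ h₂ (hw.symm.trans hz0)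
  refine (homologousIn_sd_pow m (bd_bd w₁) he).trans ⟨f, hf, ?_⟩
  rw [sub_zero, ← bd_sd_pow, hm, map_add, bd_bd, add_zero]

theorem homologous_zero_of_disjoint {U V : Set X} (hU : IsOpen U) (hV : IsOpen V)
    (hUV : U ∩ V = ∅) {w₁ w₂ : Chain X} (h₁ : w₁ ∈ supp U) (h₂ : w₂ ∈ supp V)
    (hw₁ : bd X w₁ = 0) (h : HomologousIn (U ∪ V) (w₁ + w₂) 0) : HomologousIn U w₁ 0 := by
  obtain ⟨m, f, hf, c, hc, hm⟩ := exists_of_sum_bounds hU hV h₁ h₂ h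
  rw [hUV, supp_empty, Submodule.mem_bot] at hf
  exact (homologousIn_sd_pow m hw₁ h₁).trans ⟨c, hc, by rw [hm, hf, zero_add, sub_zero]⟩

/-- If the cycles in `U` and in `V` are homologous to their images under `r`, and the connecting
homomorphism kills `z`, then `z` bounds as soon as its image under `r` does. -/
theorem MVRel.homologous_zero_of_push {U V : Set X} {z e : Chain X} (h : MVRel U V z e)
    (he : HomologousIn (U ∩ V) e 0) (hz : bd X z = 0) (r : C(X, X))
    (hrU : ∀ w ∈ supp U, bd X w = 0 → HomologousIn U w (push r w))
    (hrV : ∀ w ∈ supp V, bd X w = 0 → HomologousIn V w (push r w))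
    (hr : ∀ x ∈ U ∪ V, r x ∈ U ∪ V) (hrz : HomologousIn (U ∪ V) (push r z) 0) :
    HomologousIn (U ∪ V) z 0 := by
  obtain ⟨w₁, h₁, w₂, h₂, hw, rfl⟩ := h
  obtain ⟨f, hf, hfe⟩ := he
  have hb : bd X w₂ = - bd X w₁ := by
    have := hw.bd_eq
    rw [hz, map_add] at this
    exact eq_neg_of_add_eq_zero_right this.symm
  rw [sub_zero] at hfe
  have e₁ := hrU (w₁ - f) (sub_mem h₁ (supp_mono Set.inter_subset_left hf))
    (by rw [map_sub, hfe, sub_self])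
  have e₂ := hrV (w₂ + f) (add_mem h₂ (supp_mono Set.inter_subset_right hf))
    (by rw [map_add, ← hfe, hb, neg_add_cancel])
  have e₃ := (e₁.mono Set.subset_union_left).add (e₂.mono Set.subset_union_right)
  rw [← map_add, show w₁ - f + (w₂ + f) = w₁ + w₂ by abel] at e₃
  exact hw.trans (e₃.trans ((hw.symm.push r hr).trans hrz))

/-! ### Double sweeps -/

/-- The chain swept out by a chain under a two-parameter family of maps. -/
def sweep₂ (F : C((X × I) × I, Y)) : Chain X →ₗ[ℂ] Chain Y := sweep F ∘ₗ prism X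

theorem sweep₂_apply (F : C((X × I) × I, Y)) (c : Chain X) : sweep₂ F c = sweep F (prism X c) := rfl

theorem push_sweep₂ (g : C(Y, Z)) (F : C((X × I) × I, Y)) (c : Chain X) :
    push g (sweep₂ F c) = sweep₂ (g.comp F) c := push_sweep g F _

theorem sweep₂_push (F : C((Y × I) × I, Z)) (f : C(X, Y)) (c : Chain X) :
    sweep₂ F (push f c) =
      sweep₂ (F.comp ((f.prodMap (ContinuousMap.id I)).prodMap (ContinuousMap.id I))) c := by
  simp only [sweep₂, LinearMap.comp_apply, prism_push, sweep_push]

theorem bd_sweep₂ (F : C((X × I) × I, Y)) (h0 : ∀ x b, F ((x, 0), b) = F ((x, 1), b))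
    (h1 : ∀ x a, F ((x, a), 0) = F ((x, a), 1)) (c : Chain X) :
    bd Y (sweep₂ F c) = sweep₂ F (bd X c) := by
  have e0 : F.comp (atTime (X × I) 1) = F.comp (atTime (X × I) 0) :=
    ContinuousMap.ext fun x => (h1 x.1 x.2).symm
  have e1 : F.comp ((atTime X 1).prodMap (ContinuousMap.id I)) =
      F.comp ((atTime X 0).prodMap (ContinuousMap.id I)) :=
    ContinuousMap.ext fun x => (h0 x.1 x.2).symm
  rw [sweep₂_apply, bd_sweep, e0, bd_prism, map_sub, map_sub, sweep_push, sweep_push, e1]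
  simp [sweep₂_apply]

theorem sweep₂_eq_zero_of_swap (F : C((X × I) × I, Y)) (h : F.comp (swapTimes X) = F)
    (c : Chain X) : sweep₂ F c = 0 := by
  have h1 : sweep₂ F c = - sweep₂ F c := by
    have := congrArg (push F) (push_swap_prism_prism c)
    rw [push_comp, h, map_neg] at this
    exact this
  have h2 : (2 : ℂ) • sweep₂ F c = 0 := by
    rw [two_smul]
    nth_rewrite 1 [h1]
    exact neg_add_cancel _
  exact (smul_eq_zero.1 h2).resolve_left two_ne_zero

/-- The square `κ(s, t) = s (1 + t) / 2`, with `κ(s, 1) = s`, `κ(s, 0) = s / 2`,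
`κ(1, t) = (1 + t) / 2` and `κ(0, t) = 0`. -/
def kappa (s t : I) : I := ⟨s * (1 + t) / 2, by
  have hs := s.2; have ht := t.2
  constructor
  · have := mul_nonneg hs.1 (by linarith [ht.1] : (0 : ℝ) ≤ 1 + t)
    linarith
  · have := mul_le_mul hs.2 (by linarith [ht.2] : (1 : ℝ) + t ≤ 2) (by linarith [ht.1]) zero_le_one
    linarith⟩

theorem continuous_kappa : Continuous fun x : I × I => kappa x.1 x.2 := by
  unfold kappa
  fun_prop

/-- The first half of a homotopy. -/
def firstHalf (F : C(X × I, Y)) : C(X × I, Y) :=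
  F.comp ⟨fun x => (x.1, kappa x.2 0), by
    have := continuous_kappa.comp (Continuous.prodMk_left (0 : I))
    exact continuous_fst.prodMk (this.comp continuous_snd)⟩

/-- The second half of a homotopy. -/
def secondHalf (F : C(X × I, Y)) : C(X × I, Y) :=
  F.comp ⟨fun x => (x.1, kappa 1 x.2), by
    have := continuous_kappa.comp (Continuous.prodMk_right (1 : I))
    exact continuous_fst.prodMk (this.comp continuous_snd)⟩

/-- The constant homotopy at the time zero of a homotopy. -/
def frozen (F : C(X × I, Y)) : C(X × I, Y) := F.comp ⟨fun x => (x.1, 0), by fun_prop⟩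

/-- The two-parameter family that compares a homotopy with its halves. -/
def halving (F : C(X × I, Y)) : C((X × I) × I, Y) :=
  F.comp ⟨fun x => (x.1.1, kappa x.1.2 x.2), by
    have : Continuous fun x : (X × I) × I => (x.1.2, x.2) := by fun_prop
    exact (continuous_fst.comp continuous_fst).prodMk (continuous_kappa.comp this)⟩

/-- A homotopy sweeps out the sum of what its two halves sweep out, up to degenerate chains and
boundaries. -/
theorem sweep_eq_halves (F : C(X × I, Y)) (y : Chain X) :
    sweep F y = sweep (firstHalf F) y - sweep (frozen F) y + sweep (secondHalf F) y +
      (bd Y (sweep₂ (halving F) y) - sweep₂ (halving F) (bd X y)) := by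
  have e1 : (halving F).comp (atTime (X × I) 1) = F :=
    ContinuousMap.ext fun x => congrArg F (Prod.ext rfl (Subtype.ext (by
      change (x.2 : ℝ) * (1 + (1 : ℝ)) / 2 = x.2
      ring)))
  have e2 : (halving F).comp (atTime (X × I) 0) = firstHalf F := rfl
  have e3 : (halving F).comp ((atTime X 1).prodMap (ContinuousMap.id I)) = secondHalf F := rfl
  have e4 : (halving F).comp ((atTime X 0).prodMap (ContinuousMap.id I)) = frozen F :=
    ContinuousMap.ext fun x => congrArg F (Prod.ext rfl (Subtype.ext (by
      change (0 : ℝ) * (1 + (x.2 : ℝ)) / 2 = 0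
      ring)))
  have h : bd Y (sweep₂ (halving F) y) = sweep F y - sweep (firstHalf F) y -
      (sweep (secondHalf F) y - sweep (frozen F) y - sweep₂ (halving F) (bd X y)) := by
    have h1 : push F (prism X y) = sweep F y := rfl
    have h2 : push (firstHalf F) (prism X y) = sweep (firstHalf F) y := rfl
    have h3 : sweep (halving F) (prism X (bd X y)) = sweep₂ (halving F) (bd X y) := rfl
    rw [sweep₂_apply, bd_sweep, e1, e2, bd_prism, map_sub, map_sub, sweep_push, sweep_push, e3, e4,
      h1, h2, h3]
  rw [h]
  abel

end Spaces

/-! ### The Mayer-Vietoris relation for a two-parameter family -/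

/-- Two chains are homologous. -/
abbrev Homologous {X : Type} [TopologicalSpace X] (a b : Chain X) : Prop :=
  HomologousIn (Set.univ : Set X) a b

section Spaces
variable {X Y : Type} [TopologicalSpace X] [TopologicalSpace Y]

theorem Homologous.pushIn {V : Set Y} {a b : Chain X} (h : Homologous a b) (f : C(X, Y))
    (hf : ∀ x, f x ∈ V) : HomologousIn V (push f a) (push f b) :=
  HomologousIn.push h f fun x _ => hf x

theorem Homologous.map {a b : Chain X} (h : Homologous a b) (f : C(X, Y)) :
    Homologous (push f a) (push f b) :=
  h.pushIn f fun _ => trivial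

/-- The midpoint of the unit interval. -/
def half : I := ⟨1 / 2, by norm_num, by norm_num⟩

/-- A two-parameter family restricted to one value of each of its parameters. -/
def slice (F : C((X × I) × I, Y)) (a b : I) : C(X, Y) :=
  F.comp ((atTime (X × I) b).comp (atTime X a))

theorem sweep_bd_prism_of_eq (F : C((X × I) × I, Y)) (h : ∀ x b, F ((x, 0), b) = F ((x, 1), b))
    (u : Chain X) (hu : bd X u = 0) : sweep F (bd _ (prism X u)) = 0 := by
  have e : F.comp ((atTime X 1).prodMap (ContinuousMap.id I)) =
      F.comp ((atTime X 0).prodMap (ContinuousMap.id I)) :=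
    ContinuousMap.ext fun x => (h x.1 x.2).symm
  rw [bd_prism, hu, map_zero, sub_zero, map_sub, sweep_push, sweep_push, e, sub_self]

theorem sweep₂_bd_prism_of_eq (F : C(((X × I) × I) × I, Y))
    (h : ∀ x b c, F (((x, 0), b), c) = F (((x, 1), b), c))
    (u : Chain X) (hu : bd X u = 0) : sweep₂ F (bd _ (prism X u)) = 0 := by
  have e : F.comp (((atTime X 1).prodMap (ContinuousMap.id I)).prodMap (ContinuousMap.id I)) =
      F.comp (((atTime X 0).prodMap (ContinuousMap.id I)).prodMap (ContinuousMap.id I)) :=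
    ContinuousMap.ext fun x => (h x.1.1 x.1.2 x.2).symm
  rw [bd_prism, hu, map_zero, sub_zero, map_sub, sweep₂_push, sweep₂_push, e, sub_self]

theorem kappa_zero_right_le (t : I) : kappa t 0 ≤ half := by
  change (t : ℝ) * (1 + 0) / 2 ≤ 1 / 2
  linarith [t.2.2]

theorem kappa_one_left_ge (t : I) : half ≤ kappa 1 t := by
  change (1 : ℝ) / 2 ≤ (1 : ℝ) * (1 + t) / 2
  linarith [t.2.1]

theorem kappa_zero_zero : kappa 0 0 = 0 := Subtype.ext (by change (0 : ℝ) * (1 + 0) / 2 = 0; ring)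

theorem kappa_one_zero : kappa 1 0 = half :=
  Subtype.ext (by change (1 : ℝ) * (1 + 0) / 2 = 1 / 2; ring)

theorem mvRel_halves (F : C(X × I, Y)) {U V : Set Y} (hU : ∀ x, ∀ t ≤ half, F (x, t) ∈ U)
    (hV : ∀ x, ∀ t, half ≤ t → F (x, t) ∈ V) {y : Chain X}
    (hy : sweep₂ (halving F) (bd X y) = 0) {w : Chain Y} (hw : w ∈ supp U) :
    MVRel U V (sweep F y - w) (bd Y (sweep (firstHalf F) y - sweep (frozen F) y - w)) := by
  have m1 : ∀ x, firstHalf F x ∈ U := fun x => hU x.1 (kappa x.2 0) (kappa_zero_right_le x.2)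
  have m2 : ∀ x, frozen F x ∈ U := fun x => hU x.1 0 bot_le
  have m3 : ∀ x, secondHalf F x ∈ V := fun x => hV x.1 (kappa 1 x.2) (kappa_one_left_ge x.2)
  have hUV : ∀ x, F x ∈ U ∪ V := fun x => (le_total x.2 half).imp (hU x.1 x.2) (hV x.1 x.2)
  have m4 : ∀ x, halving F x ∈ U ∪ V := fun x => hUV _
  refine ⟨_, sub_mem (sub_mem (sweep_mem_supp_of_forall m1 y) (sweep_mem_supp_of_forall m2 y)) hw,
    sweep (secondHalf F) y, sweep_mem_supp_of_forall m3 y,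
    ⟨sweep₂ (halving F) y, push_mem_supp_of_forall _ m4 _, ?_⟩, rfl⟩
  rw [sweep_eq_halves F, hy]
  abel

theorem bd_sweep_firstHalf_sub (F : C(X × I, Y)) {y : Chain X}
    (h : sweep (firstHalf F) (bd X y) = 0)
    (h' : sweep (frozen F) (bd X y) = 0) :
    bd Y (sweep (firstHalf F) y - sweep (frozen F) y) =
      push (F.comp (atTime X half)) y - push (F.comp (atTime X 0)) y := by
  have e1 : (firstHalf F).comp (atTime X 1) = F.comp (atTime X half) :=
    ContinuousMap.ext fun x => congrArg (fun t => F (x, t)) kappa_one_zero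
  have e0 : (firstHalf F).comp (atTime X 0) = F.comp (atTime X 0) :=
    ContinuousMap.ext fun x => congrArg (fun t => F (x, t)) kappa_zero_zero
  have e2 : (frozen F).comp (atTime X 1) = (frozen F).comp (atTime X 0) := rfl
  rw [map_sub, bd_sweep, bd_sweep, e1, e0, e2, h, h', sub_self, sub_zero, sub_zero, sub_zero]

/-- A family of closed squares is cut twice into halves: its total chain is taken by two connecting
homomorphisms to the difference of two slices. -/
theorem mvRel_sweep₂ (F : C((X × I) × I, Y)) (h0 : ∀ x b, F ((x, 0), b) = F ((x, 1), b))
    (h1 : ∀ x a, F ((x, a), 0) = F ((x, 0), 0)) {U V U' V' : Set Y}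
    (hU : ∀ x a, ∀ b ≤ half, F ((x, a), b) ∈ U) (hV : ∀ x a, ∀ b, half ≤ b → F ((x, a), b) ∈ V)
    (hU' : ∀ x, ∀ a ≤ half, F ((x, a), half) ∈ U')
    (hV' : ∀ x a, half ≤ a → F ((x, a), half) ∈ V')
    (hU0 : ∀ x, F ((x, 0), 0) ∈ U') {u : Chain X} (hu : bd X u = 0) :
    ∃ e, MVRel U V (sweep₂ F u) e ∧
      MVRel U' V' e (push (slice F half half) u - push (slice F 0 half) u) := by
  set G : C(X × I, Y) := F.comp (atTime (X × I) half) with hG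
  set G0 : C(X × I, Y) := F.comp (atTime (X × I) 0) with hG0
  have m6 : ∀ x, G0 x ∈ U' := fun x => by
    change F ((x.1, x.2), 0) ∈ U'
    rw [h1]
    exact hU0 _
  have e3 : G0.comp (atTime X 1) = G0.comp (atTime X 0) := ContinuousMap.ext fun x => h1 x 1
  refine ⟨sweep G u - sweep G0 u, ?_, ?_⟩
  · have := mvRel_halves F (fun x => hU x.1 x.2) (fun x => hV x.1 x.2) (y := prism X u)
      (sweep₂_bd_prism_of_eq _ (fun x b c => h0 _ _) u hu) (w := 0) (zero_mem _)
    rw [sub_zero, sub_zero, bd_sweep_firstHalf_sub F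
      (sweep_bd_prism_of_eq (firstHalf F) (fun x b => h0 x (kappa b 0)) u hu)
      (sweep_bd_prism_of_eq (frozen F) (fun x _ => h0 x 0) u hu)] at this
    exact this
  · have := mvRel_halves G hU' hV' (y := u) (by rw [hu, map_zero])
      (w := sweep G0 u) (sweep_mem_supp_of_forall m6 u)
    rw [map_sub, bd_sweep_firstHalf_sub G (by rw [hu, map_zero]) (by rw [hu, map_zero]), bd_sweep,
      e3, sub_self, hu, map_zero, sub_zero, sub_zero] at this
    exact this

end Spaces

/-! ### A covering of the product with the sphere -/

/-- Euclidean three-space. -/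
abbrev E3 : Type := EuclideanSpace ℝ (Fin 3)

/-- An open cone with apex removed that is star-shaped about the point `c` of the sphere. -/
structure IsStarCone (D : Set E3) (c : S2) : Prop where
  zero_notMem : (0 : E3) ∉ D
  smul_mem : ∀ x ∈ D, ∀ r : ℝ, 0 < r → r • x ∈ D
  segment_mem : ∀ x ∈ D, ∀ t : ℝ, 0 ≤ t → t ≤ 1 → (1 - t) • x + t • (c : E3) ∈ D

section Sphere
variable {A : Type} [TopologicalSpace A]

/-- The part of `A × S²` that lies over a cone. -/
def cyl (A : Type) (D : Set E3) : Set (A × S2) := {x | (x.2 : E3) ∈ D}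

/-- The section of `A × S² → A` at a point of the sphere. -/
def atPoint (A : Type) [TopologicalSpace A] (q : S2) : C(A, A × S2) :=
  ⟨fun a => (a, q), by fun_prop⟩

/-- The projection of `A × S²` to `A`. -/
def proj (A : Type) [TopologicalSpace A] : C(A × S2, A) := ⟨Prod.fst, continuous_fst⟩

/-- The projection to `A`, followed by the section at `q`. -/
def reset (A : Type) [TopologicalSpace A] (q : S2) : C(A × S2, A × S2) :=
  (atPoint A q).comp (proj A)

/-- The radial projection to the sphere; a junk value at the origin. -/
def normalize (x : E3) : S2 :=
  if h : x = 0 then basePt else ⟨‖x‖⁻¹ • x, by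
    rw [mem_sphere_zero_iff_norm, norm_smul, norm_inv, norm_norm,
      inv_mul_cancel₀ (norm_ne_zero_iff.2 h)]⟩

theorem normalize_coe {x : E3} (h : x ≠ 0) : (normalize x : E3) = ‖x‖⁻¹ • x := by
  rw [normalize, dif_neg h]

theorem norm_coe_S2 (s : S2) : ‖(s : E3)‖ = 1 := mem_sphere_zero_iff_norm.1 s.2

theorem coe_S2_ne_zero (s : S2) : (s : E3) ≠ 0 := fun h => by
  have := norm_coe_S2 s
  rw [h, norm_zero] at this
  exact zero_ne_one this

theorem normalize_S2 (s : S2) : normalize (s : E3) = s :=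
  Subtype.ext (by rw [normalize_coe (coe_S2_ne_zero s), norm_coe_S2, inv_one, one_smul])

theorem continuous_normalize {Z : Type} [TopologicalSpace Z] {f : Z → E3} (hf : Continuous f)
    (h0 : ∀ z, f z ≠ 0) : Continuous fun z => normalize (f z) := by
  refine continuous_induced_rng.2 ?_
  have : (Subtype.val ∘ fun z => normalize (f z)) = fun z => ‖f z‖⁻¹ • f z :=
    funext fun z => normalize_coe (h0 z)
  rw [this]
  exact (hf.norm.inv₀ fun z => norm_ne_zero_iff.2 (h0 z)).smul hf

theorem IsStarCone.normalize_mem {D : Set E3} {c : S2} (h : IsStarCone D c) {x : E3} (hx : x ∈ D) :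
    (normalize x : E3) ∈ D := by
  have h0 : x ≠ 0 := fun h' => h.zero_notMem (h' ▸ hx)
  rw [normalize_coe h0]
  exact h.smul_mem _ hx _ (inv_pos.2 (norm_pos_iff.2 h0))

theorem IsStarCone.homologousIn_reset_center {D : Set E3} {c : S2} (h : IsStarCone D c)
    {z : Chain (A × S2)} (hz : bd _ z = 0) (hzD : z ∈ supp (cyl A D)) :
    HomologousIn (cyl A D) z (push (reset A c) z) := by
  have hmem : ∀ x : cyl A D × I, (1 - (x.2 : ℝ)) • (x.1.1.2 : E3) + (x.2 : ℝ) • (c : E3) ∈ D :=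
    fun x => h.segment_mem _ x.1.2 _ x.2.2.1 x.2.2.2
  refine HomologousIn.of_homotopy_on (W := cyl A D)
    ⟨fun x => (x.1.1.1, normalize ((1 - (x.2 : ℝ)) • (x.1.1.2 : E3) + (x.2 : ℝ) • (c : E3))), ?_⟩
    (reset A c) (fun x => ?_) (fun x => ?_) (fun x => h.normalize_mem (hmem x)) hz hzD
  · refine Continuous.prodMk (by fun_prop) (continuous_normalize (by fun_prop) fun x h0 => ?_)
    exact h.zero_notMem (h0 ▸ hmem x)
  · refine Prod.ext rfl ?_
    change normalize ((1 - (0 : ℝ)) • (x.1.2 : E3) + (0 : ℝ) • (c : E3)) = x.1.2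
    rw [sub_zero, one_smul, zero_smul, add_zero, normalize_S2]
  · refine Prod.ext rfl ?_
    change normalize ((1 - (1 : ℝ)) • (x.1.2 : E3) + (1 : ℝ) • (c : E3)) = c
    rw [sub_self, one_smul, zero_smul, zero_add, normalize_S2]

theorem push_reset_mem {D : Set E3} {q : S2} (hq : (q : E3) ∈ D) (z : Chain (A × S2)) :
    push (reset A q) z ∈ supp (cyl A D) :=
  push_mem_supp_of_forall _ (fun _ => hq) _

theorem IsStarCone.homologousIn_reset {D : Set E3} {c : S2} (h : IsStarCone D c) {q : S2}
    (hq : (q : E3) ∈ D) {z : Chain (A × S2)} (hz : bd _ z = 0) (hzD : z ∈ supp (cyl A D)) :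
    HomologousIn (cyl A D) z (push (reset A q) z) := by
  refine (h.homologousIn_reset_center hz hzD).trans ?_
  have := h.homologousIn_reset_center (z := push (reset A q) z) (by rw [bd_push, hz, map_zero])
    (push_reset_mem hq z)
  rw [push_comp] at this
  exact this.symm

/-- The complement of a closed half-line on the axis with index `1`. -/
def offRay (ε : ℝ) : Set E3 := {x | ¬ (x 0 = 0 ∧ x 2 = 0 ∧ 0 ≤ ε * x 1)}

/-- The complement of a closed half-plane in the plane where the coordinate with index `2`
vanishes. -/
def offHalfPlane (ε : ℝ) : Set E3 := {x | ¬ (x 2 = 0 ∧ 0 ≤ ε * x 0)}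

/-- An open half-space, given by the sign of the coordinate with index `2`. -/
def halfSpace (ε : ℝ) : Set E3 := {x | 0 < ε * x 2}

/-- The unit vector of an axis. -/
def axisPt (i : Fin 3) : S2 := ⟨EuclideanSpace.single i 1, by simp⟩

theorem coe_neg_S2 (s : S2) (i : Fin 3) : ((-s : S2) : E3) i = -((s : E3) i) := rfl

theorem isStarCone_offRay (ε : ℝ) (c : S2) (h0 : (c : E3) 0 = 0) (h2 : (c : E3) 2 = 0)
    (h1 : ε * (c : E3) 1 = -1) : IsStarCone (offRay ε) c where
  zero_notMem h := h ⟨rfl, rfl, by simp⟩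
  smul_mem x hx r hr := fun h => hx ⟨by simpa [hr.ne'] using h.1, by simpa [hr.ne'] using h.2.1, by
    have := h.2.2
    simp only [PiLp.smul_apply, smul_eq_mul] at this
    rw [mul_left_comm] at this
    exact nonneg_of_mul_nonneg_right this hr⟩
  segment_mem x hx t ht0 ht1 := fun h => by
    simp only [PiLp.add_apply, PiLp.smul_apply, smul_eq_mul, h0, h2, mul_zero, add_zero,
      mul_eq_zero] at h
    obtain ⟨ha, hb, hc⟩ := h
    have hc' : 0 ≤ (1 - t) * (ε * x 1) - t := by linear_combination hc + t * h1
    rcases ht1.eq_or_lt with rfl | ht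
    · norm_num at hc'
    · have ht' : 0 < 1 - t := by linarith
      refine hx ⟨ha.resolve_left ht'.ne', hb.resolve_left ht'.ne', ?_⟩
      exact nonneg_of_mul_nonneg_right (by linarith) ht'

theorem isStarCone_offHalfPlane (ε : ℝ) (c : S2) (h2 : (c : E3) 2 = 0)
    (h1 : ε * (c : E3) 0 = -1) : IsStarCone (offHalfPlane ε) c where
  zero_notMem h := h ⟨rfl, by simp⟩
  smul_mem x hx r hr := fun h => hx ⟨by simpa [hr.ne'] using h.1, by
    have := h.2
    simp only [PiLp.smul_apply, smul_eq_mul] at this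
    rw [mul_left_comm] at this
    exact nonneg_of_mul_nonneg_right this hr⟩
  segment_mem x hx t ht0 ht1 := fun h => by
    simp only [PiLp.add_apply, PiLp.smul_apply, smul_eq_mul, h2, mul_zero, add_zero,
      mul_eq_zero] at h
    obtain ⟨hb, hc⟩ := h
    have hc' : 0 ≤ (1 - t) * (ε * x 0) - t := by linear_combination hc + t * h1
    rcases ht1.eq_or_lt with rfl | ht
    · norm_num at hc'
    · have ht' : 0 < 1 - t := by linarith
      refine hx ⟨hb.resolve_left ht'.ne', ?_⟩
      exact nonneg_of_mul_nonneg_right (by linarith) ht'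

theorem isStarCone_halfSpace (ε : ℝ) (c : S2) (h2 : ε * (c : E3) 2 = 1) :
    IsStarCone (halfSpace ε) c where
  zero_notMem h := by simp [halfSpace] at h
  smul_mem x hx r hr := by
    change 0 < ε * (r * x 2)
    rw [mul_left_comm]
    exact mul_pos hr hx
  segment_mem x hx t ht0 ht1 := by
    change 0 < ε * ((1 - t) * x 2 + t * (c : E3) 2)
    have : ε * ((1 - t) * x 2 + t * (c : E3) 2) = (1 - t) * (ε * x 2) + t := by
      linear_combination t * h2
    rw [this]
    rcases ht1.eq_or_lt with rfl | ht
    · norm_num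
    · have := mul_pos (by linarith : 0 < 1 - t) (show 0 < ε * x 2 from hx)
      linarith

theorem isOpen_cyl {D : Set E3} (hD : IsOpen D) : IsOpen (cyl A D) :=
  hD.preimage (continuous_subtype_val.comp continuous_snd)

theorem isOpen_offRay (ε : ℝ) : IsOpen (offRay ε) := by
  have h : ∀ i : Fin 3, Continuous fun x : E3 => x i := fun i => by fun_prop
  refine IsClosed.not ?_
  exact (isClosed_eq (h 0) continuous_const).inter ((isClosed_eq (h 2) continuous_const).inter
    (isClosed_le continuous_const (continuous_const.mul (h 1))))

theorem isOpen_offHalfPlane (ε : ℝ) : IsOpen (offHalfPlane ε) := by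
  have h : ∀ i : Fin 3, Continuous fun x : E3 => x i := fun i => by fun_prop
  refine IsClosed.not ?_
  exact (isClosed_eq (h 2) continuous_const).inter
    (isClosed_le continuous_const (continuous_const.mul (h 0)))

theorem isOpen_halfSpace (ε : ℝ) : IsOpen (halfSpace ε) := by
  have h : ∀ i : Fin 3, Continuous fun x : E3 => x i := fun i => by fun_prop
  exact isOpen_lt continuous_const (continuous_const.mul (h 2))

theorem S2_coord_ne (s : S2) : ¬ ((s : E3) 0 = 0 ∧ (s : E3) 1 = 0 ∧ (s : E3) 2 = 0) := by
  rintro ⟨h0, h1, h2⟩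
  refine coe_S2_ne_zero s ?_
  ext i
  fin_cases i <;> assumption

theorem cyl_offRay_union {A : Type} : cyl A (offRay 1) ∪ cyl A (offRay (-1)) = Set.univ := by
  refine Set.eq_univ_of_forall fun x => ?_
  by_contra h
  simp only [cyl, offRay, Set.mem_union, Set.mem_ofPred_eq, not_or, not_not] at h
  exact S2_coord_ne x.2 ⟨h.1.1, by linarith [h.1.2.2, h.2.2.2], h.1.2.1⟩

theorem cyl_offRay_inter {A : Type} : cyl A (offRay 1) ∩ cyl A (offRay (-1)) =
    cyl A (offHalfPlane 1) ∪ cyl A (offHalfPlane (-1)) := by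
  ext x
  simp only [cyl, offRay, offHalfPlane, Set.mem_union, Set.mem_inter_iff, Set.mem_ofPred_eq]
  constructor
  · intro h
    by_contra h'
    simp only [not_or, not_not] at h'
    have h0 : (x.2 : E3) 0 = 0 := by linarith [h'.1.2, h'.2.2]
    rcases le_total 0 ((x.2 : E3) 1) with h1 | h1
    · exact h.1 ⟨h0, h'.1.1, by linarith⟩
    · exact h.2 ⟨h0, h'.1.1, by linarith⟩
  · rintro (h | h)
    · exact ⟨fun h' => h ⟨h'.2.1, by rw [h'.1, mul_zero]⟩,
        fun h' => h ⟨h'.2.1, by rw [h'.1, mul_zero]⟩⟩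
    · exact ⟨fun h' => h ⟨h'.2.1, by rw [h'.1, mul_zero]⟩,
        fun h' => h ⟨h'.2.1, by rw [h'.1, mul_zero]⟩⟩

theorem cyl_offHalfPlane_inter {A : Type} : cyl A (offHalfPlane 1) ∩ cyl A (offHalfPlane (-1)) =
    cyl A (halfSpace 1) ∪ cyl A (halfSpace (-1)) := by
  ext x
  simp only [cyl, halfSpace, offHalfPlane, Set.mem_union, Set.mem_inter_iff, Set.mem_ofPred_eq]
  constructor
  · intro h
    by_contra h'
    simp only [not_or, not_lt] at h'
    have h2 : (x.2 : E3) 2 = 0 := by linarith [h'.1, h'.2]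
    rcases le_total 0 ((x.2 : E3) 0) with h1 | h1
    · exact h.1 ⟨h2, by linarith⟩
    · exact h.2 ⟨h2, by linarith⟩
  · rintro (h | h) <;> exact ⟨fun h' => by simp [h'.1] at h, fun h' => by simp [h'.1] at h⟩

theorem cyl_halfSpace_inter {A : Type} : cyl A (halfSpace 1) ∩ cyl A (halfSpace (-1)) = ∅ := by
  ext x
  simp only [cyl, halfSpace, Set.mem_inter_iff, Set.mem_ofPred_eq, Set.mem_empty_iff_false,
    iff_false]
  intro h
  linarith [h.1, h.2]

end Sphere

/-! ### The homology of the product with the sphere -/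

section Sphere
variable {A B : Type} [TopologicalSpace A] [TopologicalSpace B]

/-- The slant product with the fundamental class of the sphere, up to sign: `u` represents the
image of the class of `z` under two connecting homomorphisms, restricted to the component of the
base point in the double intersection, and projected to `A`. -/
def SphereRel (z : Chain (A × S2)) (u : Chain A) : Prop :=
  ∃ e₁ e₂ w₁ w₂, MVRel (cyl A (offRay 1)) (cyl A (offRay (-1))) z e₁ ∧
    MVRel (cyl A (offHalfPlane 1)) (cyl A (offHalfPlane (-1))) e₁ e₂ ∧
    w₁ ∈ supp (cyl A (halfSpace 1)) ∧ w₂ ∈ supp (cyl A (halfSpace (-1))) ∧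
    bd _ w₁ = 0 ∧
    HomologousIn (cyl A (halfSpace 1) ∪ cyl A (halfSpace (-1))) e₂ (w₁ + w₂) ∧
    Homologous (push (proj A) w₁) u

theorem SphereRel.add {z z' : Chain (A × S2)} {u u' : Chain A} (h : SphereRel z u)
    (h' : SphereRel z' u') : SphereRel (z + z') (u + u') := by
  obtain ⟨e₁, e₂, w₁, w₂, h1, h2, h3, h4, h5, h6, h7⟩ := h
  obtain ⟨e₁', e₂', w₁', w₂', h1', h2', h3', h4', h5', h6', h7'⟩ := h'
  refine ⟨_, _, _, _, h1.add h1', h2.add h2', add_mem h3 h3', add_mem h4 h4', ?_, ?_, ?_⟩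
  · rw [map_add, h5, h5', add_zero]
  · rw [add_add_add_comm]
    exact h6.add h6'
  · rw [map_add]
    exact h7.add h7'

theorem SphereRel.smul {z : Chain (A × S2)} {u : Chain A} (r : ℂ) (h : SphereRel z u) :
    SphereRel (r • z) (r • u) := by
  obtain ⟨e₁, e₂, w₁, w₂, h1, h2, h3, h4, h5, h6, h7⟩ := h
  refine ⟨_, _, _, _, h1.smul r, h2.smul r, Submodule.smul_mem _ r h3, Submodule.smul_mem _ r h4,
    ?_, ?_, ?_⟩
  · rw [map_smul, h5, smul_zero]
  · rw [← smul_add]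
    exact h6.smul r
  · rw [map_smul]
    exact h7.smul r

theorem SphereRel.sub {z z' : Chain (A × S2)} {u u' : Chain A} (h : SphereRel z u)
    (h' : SphereRel z' u') : SphereRel (z - z') (u - u') := by
  have := h.add (h'.smul (-1))
  rwa [neg_one_smul, neg_one_smul, ← sub_eq_add_neg, ← sub_eq_add_neg] at this

theorem SphereRel.congr {z : Chain (A × S2)} {u u' : Chain A} (h : SphereRel z u)
    (hu : Homologous u u') : SphereRel z u' := by
  obtain ⟨e₁, e₂, w₁, w₂, h1, h2, h3, h4, h5, h6, h7⟩ := h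
  exact ⟨e₁, e₂, w₁, w₂, h1, h2, h3, h4, h5, h6, h7.trans hu⟩

theorem basePt_two : (basePt : E3) 2 = 1 := rfl

theorem basePt_mem_offRay (ε : ℝ) : (basePt : E3) ∈ offRay ε := fun h => by
  have := h.2.1
  rw [basePt_two] at this
  exact one_ne_zero this

theorem basePt_mem_offHalfPlane (ε : ℝ) : (basePt : E3) ∈ offHalfPlane ε := fun h => by
  have := h.1
  rw [basePt_two] at this
  exact one_ne_zero this

theorem basePt_mem_halfSpace : (basePt : E3) ∈ halfSpace 1 := by
  change (0 : ℝ) < 1 * (basePt : E3) 2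
  rw [basePt_two]
  norm_num

theorem isStarCone_offRay_one : IsStarCone (offRay 1) (-axisPt 1) :=
  isStarCone_offRay _ _ (by simp [axisPt]) (by simp [axisPt]) (by simp [axisPt])

theorem isStarCone_offRay_neg : IsStarCone (offRay (-1)) (axisPt 1) :=
  isStarCone_offRay _ _ (by simp [axisPt]) (by simp [axisPt]) (by simp [axisPt])

theorem isStarCone_offHalfPlane_one : IsStarCone (offHalfPlane 1) (-axisPt 0) :=
  isStarCone_offHalfPlane _ _ (by simp [axisPt]) (by simp [axisPt])

theorem isStarCone_offHalfPlane_neg : IsStarCone (offHalfPlane (-1)) (axisPt 0) :=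
  isStarCone_offHalfPlane _ _ (by simp [axisPt]) (by simp [axisPt])

theorem isStarCone_halfSpace_one : IsStarCone (halfSpace 1) basePt :=
  isStarCone_halfSpace _ _ (by rw [basePt_two, mul_one])

theorem isStarCone_halfSpace_neg : IsStarCone (halfSpace (-1)) (-basePt) :=
  isStarCone_halfSpace _ _ (by rw [coe_neg_S2, basePt_two]; norm_num)

theorem neg_basePt_mem_halfSpace : ((-basePt : S2) : E3) ∈ halfSpace (-1) := by
  change (0 : ℝ) < -1 * ((-basePt : S2) : E3) 2
  rw [coe_neg_S2, basePt_two]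
  norm_num

/-- The slant product exists for every cycle: the Mayer-Vietoris relation is applied twice, and the
result is a cycle over two disjoint half-spaces. -/
theorem exists_sphereRel {z : Chain (A × S2)} (hz : bd _ z = 0) :
    ∃ u, bd A u = 0 ∧ SphereRel z u := by
  obtain ⟨e₁, h₁⟩ := exists_mvRel (isOpen_cyl (A := A) (isOpen_offRay 1))
    (isOpen_cyl (isOpen_offRay (-1))) hz (by rw [cyl_offRay_union]; exact mem_supp_univ z)
  have he₁ := h₁.mem_supp hz
  rw [cyl_offRay_inter] at he₁
  obtain ⟨e₂, h₂⟩ := exists_mvRel (isOpen_cyl (A := A) (isOpen_offHalfPlane 1))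
    (isOpen_cyl (isOpen_offHalfPlane (-1))) h₁.bd_eq_zero he₁
  have he₂ := h₂.mem_supp h₁.bd_eq_zero
  rw [cyl_offHalfPlane_inter] at he₂
  obtain ⟨e, w₁, hw₁, w₂, hw₂, hw, rfl⟩ := exists_mvRel (isOpen_cyl (A := A) (isOpen_halfSpace 1))
    (isOpen_cyl (isOpen_halfSpace (-1))) h₂.bd_eq_zero he₂
  have hb : bd _ w₁ = 0 := by
    have := MVRel.mem_supp ⟨w₁, hw₁, w₂, hw₂, hw, rfl⟩ h₂.bd_eq_zero
    rwa [cyl_halfSpace_inter, supp_empty, Submodule.mem_bot] at this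
  exact ⟨push (proj A) w₁, by rw [bd_push, hb, map_zero], e₁, e₂, w₁, w₂, h₁, h₂, hw₁, hw₂, hb, hw,
    .refl _ _⟩

theorem reset_eq (q : S2) (z : Chain (A × S2)) :
    push (reset A q) z = push (atPoint A q) (push (proj A) z) := (push_comp _ _ _).symm

theorem homologousIn_reset_zero {D : Set E3} {q : S2} (hq : (q : E3) ∈ D) {z : Chain (A × S2)}
    (h : Homologous (push (proj A) z) 0) : HomologousIn (cyl A D) (push (reset A q) z) 0 := by
  have := h.pushIn (atPoint A q) (V := cyl A D) (fun _ => hq)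
  rwa [map_zero, ← reset_eq] at this

theorem MVRel.homologous_zero_of_proj {D D' : Set E3} {c c' : S2} (hD : IsStarCone D c)
    (hD' : IsStarCone D' c') {q : S2} (hq : (q : E3) ∈ D) (hq' : (q : E3) ∈ D')
    {z e : Chain (A × S2)}
    (h : MVRel (cyl A D) (cyl A D') z e) (he : HomologousIn (cyl A D ∩ cyl A D') e 0)
    (hz : bd _ z = 0) (hpz : Homologous (push (proj A) z) 0) :
    HomologousIn (cyl A D ∪ cyl A D') z 0 :=
  h.homologous_zero_of_push he hz (reset A q) (fun _ hw hb => hD.homologousIn_reset hq hb hw)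
    (fun _ hw hb => hD'.homologousIn_reset hq' hb hw) (fun _ _ => .inl hq)
    ((homologousIn_reset_zero hq hpz).mono Set.subset_union_left)

/-- A cycle is determined up to homology by its two components. -/
theorem SphereRel.homologous_zero {z : Chain (A × S2)} {u : Chain A} (h : SphereRel z u)
    (hz : bd _ z = 0) (hu : Homologous u 0) (hpz : Homologous (push (proj A) z) 0) :
    Homologous z 0 := by
  obtain ⟨e₁, e₂, w₁, w₂, h1, h2, h3, h4, h5, h6, h7⟩ := h
  have k1 : HomologousIn (cyl A (halfSpace 1)) w₁ 0 :=
    (isStarCone_halfSpace_one.homologousIn_reset basePt_mem_halfSpace h5 h3).trans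
      (homologousIn_reset_zero basePt_mem_halfSpace (h7.trans hu))
  have hb2 : bd _ w₂ = 0 := by
    have := h6.bd_eq
    rwa [h2.bd_eq_zero, map_add, h5, zero_add, eq_comm] at this
  have hp2 : Homologous (push (proj A) w₂) 0 := by
    have a1 := (h6.mono (Set.subset_univ _)).push (proj A) (W := Set.univ) fun _ _ => trivial
    have a2 := (k1.mono (Set.subset_univ _)).push (proj A) (W := Set.univ) fun _ _ => trivial
    have a3 := (a1.symm.trans (h2.push_homologous (proj A))).sub a2
    rwa [map_zero, sub_zero, map_add, add_sub_cancel_left] at a3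
  have k2 : HomologousIn (cyl A (halfSpace (-1))) w₂ 0 :=
    (isStarCone_halfSpace_neg.homologousIn_reset neg_basePt_mem_halfSpace hb2 h4).trans
      (homologousIn_reset_zero neg_basePt_mem_halfSpace hp2)
  have k3 := h6.trans ((k1.mono Set.subset_union_left).add (k2.mono Set.subset_union_right))
  rw [add_zero, ← cyl_offHalfPlane_inter] at k3
  have k4 := h2.homologous_zero_of_proj isStarCone_offHalfPlane_one isStarCone_offHalfPlane_neg
    (basePt_mem_offHalfPlane 1) (basePt_mem_offHalfPlane (-1)) k3 h1.bd_eq_zero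
    (h1.push_homologous (proj A))
  rw [← cyl_offRay_inter] at k4
  have k5 := h1.homologous_zero_of_proj isStarCone_offRay_one isStarCone_offRay_neg
    (basePt_mem_offRay 1) (basePt_mem_offRay (-1)) k4 hz hpz
  rwa [cyl_offRay_union] at k5

theorem SphereRel.homologous {z z' : Chain (A × S2)} {u u' : Chain A} (h : SphereRel z u)
    (h' : SphereRel z' u') (hz : bd _ z = 0) (hz' : bd _ z' = 0) (hu : Homologous u u')
    (hp : Homologous (push (proj A) z) (push (proj A) z')) : Homologous z z' := by
  have := (h.sub h').homologous_zero (by rw [map_sub, hz, hz', sub_zero])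
    (by simpa using hu.sub (.refl _ u')) (by simpa using hp.sub (.refl _ (push (proj A) z')))
  simpa using this.add (.refl _ z')

/-- The slant product of a boundary is a boundary. -/
theorem SphereRel.homologous_zero_right {z : Chain (A × S2)} {u : Chain A} (h : SphereRel z u)
    (hz : bd _ z = 0) (hz0 : Homologous z 0) : Homologous u 0 := by
  obtain ⟨e₁, e₂, w₁, w₂, h1, h2, h3, h4, h5, h6, h7⟩ := h
  have k1 := h1.homologous_zero (isOpen_cyl (isOpen_offRay 1)) (isOpen_cyl (isOpen_offRay (-1))) hz
    (by rwa [cyl_offRay_union])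
  rw [cyl_offRay_inter] at k1
  have k2 := h2.homologous_zero (isOpen_cyl (isOpen_offHalfPlane 1))
    (isOpen_cyl (isOpen_offHalfPlane (-1))) h1.bd_eq_zero k1
  rw [cyl_offHalfPlane_inter] at k2
  have k3 := homologous_zero_of_disjoint (isOpen_cyl (isOpen_halfSpace 1))
    (isOpen_cyl (isOpen_halfSpace (-1))) cyl_halfSpace_inter h3 h4 h5 (h6.symm.trans k2)
  have k4 := k3.push (proj A) (W := Set.univ) fun _ _ => trivial
  rw [map_zero] at k4
  exact h7.symm.trans k4

theorem sphereRel_atPoint {u : Chain A} (hu : bd A u = 0) :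
    SphereRel (push (atPoint A basePt) u) 0 := by
  have hm : push (atPoint A basePt) u ∈ supp (cyl A (offRay 1)) :=
    push_mem_supp_of_forall _ (fun _ => basePt_mem_offRay 1) _
  refine ⟨0, 0, 0, 0, ⟨_, hm, 0, zero_mem _, .of_eq (add_zero _).symm, ?_⟩,
    ⟨0, zero_mem _, 0, zero_mem _, .of_eq (add_zero _).symm, (map_zero _).symm⟩, zero_mem _,
    zero_mem _, map_zero _, .of_eq (add_zero _).symm, .of_eq (map_zero _)⟩
  rw [bd_push, hu, map_zero]

/-! ### The two-cell and the covering of the sphere -/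

theorem twoCell_weight_nonneg (a b : I) :
    0 ≤ (1 - (2 * (a : ℝ) - 1) ^ 2) * (1 - (2 * (b : ℝ) - 1) ^ 2) :=
  mul_nonneg (by nlinarith [a.2.1, a.2.2]) (by nlinarith [b.2.1, b.2.2])

theorem twoCell_denom_nonneg (a b : I) :
    0 ≤ (2 * (a : ℝ) - 1) ^ 2 + (2 * (b : ℝ) - 1) ^ 2 +
      ((1 - (2 * (a : ℝ) - 1) ^ 2) * (1 - (2 * (b : ℝ) - 1) ^ 2)) ^ 2 := by positivity

theorem twoCell_zero_nonpos {a b : I} (h : a ≤ half) : (twoCell (a, b) : E3) 0 ≤ 0 := by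
  have h' : 2 * (a : ℝ) - 1 ≤ 0 := by
    have : (a : ℝ) ≤ 1 / 2 := h
    linarith
  refine div_nonpos_of_nonpos_of_nonneg ?_ (twoCell_denom_nonneg a b)
  exact mul_nonpos_of_nonneg_of_nonpos (mul_nonneg zero_le_two (twoCell_weight_nonneg a b)) h'

theorem twoCell_zero_nonneg {a b : I} (h : half ≤ a) : 0 ≤ (twoCell (a, b) : E3) 0 := by
  have h' : 0 ≤ 2 * (a : ℝ) - 1 := by
    have : (1 : ℝ) / 2 ≤ a := h
    linarith
  refine div_nonneg ?_ (twoCell_denom_nonneg a b)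
  exact mul_nonneg (mul_nonneg zero_le_two (twoCell_weight_nonneg a b)) h'

theorem twoCell_one_nonpos {a b : I} (h : b ≤ half) : (twoCell (a, b) : E3) 1 ≤ 0 := by
  have h' : 2 * (b : ℝ) - 1 ≤ 0 := by
    have : (b : ℝ) ≤ 1 / 2 := h
    linarith
  refine div_nonpos_of_nonpos_of_nonneg ?_ (twoCell_denom_nonneg a b)
  exact mul_nonpos_of_nonneg_of_nonpos (mul_nonneg zero_le_two (twoCell_weight_nonneg a b)) h'

theorem twoCell_one_nonneg {a b : I} (h : half ≤ b) : 0 ≤ (twoCell (a, b) : E3) 1 := by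
  have h' : 0 ≤ 2 * (b : ℝ) - 1 := by
    have : (1 : ℝ) / 2 ≤ b := h
    linarith
  refine div_nonneg ?_ (twoCell_denom_nonneg a b)
  exact mul_nonneg (mul_nonneg zero_le_two (twoCell_weight_nonneg a b)) h'

theorem twoCell_half_one (a : I) : (twoCell (a, half) : E3) 1 = 0 :=
  le_antisymm (twoCell_one_nonpos le_rfl) (twoCell_one_nonneg le_rfl)

theorem twoCell_half_half_two : (twoCell (half, half) : E3) 2 = -1 := by
  change ((2 * ((1 : ℝ) / 2) - 1) ^ 2 + (2 * ((1 : ℝ) / 2) - 1) ^ 2 -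
    ((1 - (2 * ((1 : ℝ) / 2) - 1) ^ 2) * (1 - (2 * ((1 : ℝ) / 2) - 1) ^ 2)) ^ 2) /
    ((2 * ((1 : ℝ) / 2) - 1) ^ 2 + (2 * ((1 : ℝ) / 2) - 1) ^ 2 +
    ((1 - (2 * ((1 : ℝ) / 2) - 1) ^ 2) * (1 - (2 * ((1 : ℝ) / 2) - 1) ^ 2)) ^ 2) = -1
  norm_num

theorem mem_offRay {s : S2} {ε : ℝ} (h : ε * (s : E3) 1 ≤ 0) (hε : ε ≠ 0) : (s : E3) ∈ offRay ε :=
  fun h' => S2_coord_ne s ⟨h'.1, (mul_eq_zero.1 (le_antisymm h h'.2.2)).resolve_left hε, h'.2.1⟩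

theorem mem_offHalfPlane {s : S2} {ε : ℝ} (h1 : (s : E3) 1 = 0) (h : ε * (s : E3) 0 ≤ 0)
    (hε : ε ≠ 0) : (s : E3) ∈ offHalfPlane ε :=
  fun h' => S2_coord_ne s ⟨(mul_eq_zero.1 (le_antisymm h h'.2)).resolve_left hε, h1, h'.1⟩

variable {X : Type} [TopologicalSpace X]

theorem homologous_slice_zero_half (f : C((X × I) × I, A)) {u : Chain X} (hu : bd X u = 0) :
    Homologous (push (slice f half half) u) (push (slice f 0 half) u) := by
  have hk : Continuous fun t : I => kappa t 0 :=
    continuous_kappa.comp (Continuous.prodMk_left (0 : I))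
  have := HomologousIn.of_homotopy (V := Set.univ)
    (f.comp ⟨fun x : X × I => ((x.1, kappa x.2 0), half), by fun_prop⟩) (fun _ => trivial) hu
  convert this using 2
  · congr 1
    exact ContinuousMap.ext fun x => congrArg (fun t => f ((x, t), half)) kappa_one_zero.symm
  · congr 1
    exact ContinuousMap.ext fun x => congrArg (fun t => f ((x, t), half)) kappa_zero_zero.symm

/-- The slant product of a family that runs through the two-cell. The connecting homomorphisms cut
the square `(a, b)` at `b = 1/2` and the remaining segment at `a = 1/2`; this leaves the slices at
`(0, 1/2)`, over the base point, and at `(1/2, 1/2)`, over the opposite point. -/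
theorem sphereRel_sweep₂_twoCell (f : C((X × I) × I, A))
    (hf : ∀ x a b, (a = 0 ∨ a = 1 ∨ b = 0 ∨ b = 1) → f ((x, a), b) = f ((x, 0), 0))
    {u : Chain X} (hu : bd X u = 0) :
    SphereRel (sweep₂ (f.prodMk (twoCell.comp ⟨fun x => (x.1.2, x.2), by fun_prop⟩)) u)
      (-push (slice f 0 0) u) := by
  set F : C((X × I) × I, A × S2) := f.prodMk (twoCell.comp ⟨fun x => (x.1.2, x.2), by fun_prop⟩)
  have hF : ∀ x a b, F ((x, a), b) = (f ((x, a), b), twoCell (a, b)) := fun _ _ _ => rfl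
  have hb : ∀ x a b, (a = 0 ∨ a = 1 ∨ b = 0 ∨ b = 1) → F ((x, a), b) = (f ((x, 0), 0), basePt) :=
    fun x a b h => by rw [hF, hf x a b h, twoCell_boundary a b h]
  obtain ⟨e, h1, h2⟩ := mvRel_sweep₂ F
    (fun x b => by rw [hb x 0 b (by simp), hb x 1 b (by simp)])
    (fun x a => by rw [hb x a 0 (by simp), hb x 0 0 (by simp)])
    (U := cyl A (offRay 1)) (V := cyl A (offRay (-1))) (U' := cyl A (offHalfPlane 1))
    (V' := cyl A (offHalfPlane (-1)))
    (fun x a b h => mem_offRay (by rw [hF, one_mul]; exact twoCell_one_nonpos h) one_ne_zero)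
    (fun x a b h => mem_offRay (by
      rw [hF, neg_one_mul, neg_nonpos]; exact twoCell_one_nonneg h) (by norm_num))
    (fun x a h => mem_offHalfPlane (twoCell_half_one a) (by
      rw [hF, one_mul]; exact twoCell_zero_nonpos h) one_ne_zero)
    (fun x a h => mem_offHalfPlane (twoCell_half_one a) (by
      rw [hF, neg_one_mul, neg_nonpos]; exact twoCell_zero_nonneg h) (by norm_num))
    (fun x => by rw [hb x 0 0 (by simp)]; exact basePt_mem_offHalfPlane 1) hu
  refine ⟨e, _, -push (slice F 0 half) u, push (slice F half half) u, h1, h2,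
    neg_mem (push_mem_supp_of_forall _ (fun x => ?_) _), push_mem_supp_of_forall _ (fun x => ?_) _,
    ?_, .of_eq (sub_eq_neg_add _ _), ?_⟩
  · change F ((x, 0), half) ∈ _
    rw [hb x 0 half (by simp)]
    exact basePt_mem_halfSpace
  · change (0 : ℝ) < -1 * (twoCell (half, half) : E3) 2
    rw [twoCell_half_half_two]
    norm_num
  · rw [map_neg, bd_push, hu, map_zero, neg_zero]
  · rw [map_neg, push_comp]
    refine .of_eq (congrArg (fun g => -push g u) (ContinuousMap.ext fun x => ?_))
    exact hf x 0 half (by simp)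

/-- The slant product of a family that runs through the image of the two-cell under the antipodal
map, which exchanges the two half-spaces and the two sets of each covering. -/
theorem sphereRel_sweep₂_neg_twoCell (f : C((X × I) × I, A))
    (hf : ∀ x a b, (a = 0 ∨ a = 1 ∨ b = 0 ∨ b = 1) → f ((x, a), b) = f ((x, 0), 0))
    {u : Chain X} (hu : bd X u = 0) :
    SphereRel (sweep₂ (f.prodMk (-twoCell.comp ⟨fun x => (x.1.2, x.2), by fun_prop⟩)) u)
      (push (slice f 0 0) u) := by
  set F : C((X × I) × I, A × S2) := f.prodMk (-twoCell.comp ⟨fun x => (x.1.2, x.2), by fun_prop⟩)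
  have hF : ∀ x a b, F ((x, a), b) = (f ((x, a), b), -twoCell (a, b)) := fun _ _ _ => rfl
  have hb : ∀ x a b, (a = 0 ∨ a = 1 ∨ b = 0 ∨ b = 1) → F ((x, a), b) = (f ((x, 0), 0), -basePt) :=
    fun x a b h => by rw [hF, hf x a b h, twoCell_boundary a b h]
  obtain ⟨e, h1, h2⟩ := mvRel_sweep₂ F
    (fun x b => by rw [hb x 0 b (by simp), hb x 1 b (by simp)])
    (fun x a => by rw [hb x a 0 (by simp), hb x 0 0 (by simp)])
    (U := cyl A (offRay (-1))) (V := cyl A (offRay 1)) (U' := cyl A (offHalfPlane (-1)))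
    (V' := cyl A (offHalfPlane 1))
    (fun x a b h => mem_offRay (by
      rw [hF, coe_neg_S2, neg_one_mul, neg_neg]; exact twoCell_one_nonpos h) (by norm_num))
    (fun x a b h => mem_offRay (by
      rw [hF, coe_neg_S2, one_mul, neg_nonpos]; exact twoCell_one_nonneg h) one_ne_zero)
    (fun x a h => mem_offHalfPlane (by rw [hF, coe_neg_S2, twoCell_half_one a, neg_zero]) (by
      rw [hF, coe_neg_S2, neg_one_mul, neg_neg]; exact twoCell_zero_nonpos h) (by norm_num))
    (fun x a h => mem_offHalfPlane (by rw [hF, coe_neg_S2, twoCell_half_one a, neg_zero]) (by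
      rw [hF, coe_neg_S2, one_mul, neg_nonpos]; exact twoCell_zero_nonneg h) one_ne_zero)
    (fun x => by
      rw [hb x 0 0 (by simp)]
      intro h
      have := h.1
      rw [coe_neg_S2, basePt_two] at this
      norm_num at this) hu
  have hz : bd _ (sweep₂ F u) = 0 := by
    rw [bd_sweep₂ F (fun x b => by rw [hb x 0 b (by simp), hb x 1 b (by simp)])
      (fun x a => by rw [hb x a 0 (by simp), hb x a 1 (by simp)]), hu, map_zero]
  have h1' := h1.swap hz
  -- the two exchanges of the sets of the covering cancel each other
  have h2' := (h2.swap h1.bd_eq_zero).smul (-1)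
  rw [neg_one_smul, neg_one_smul, neg_neg] at h2'
  refine ⟨-e, _, push (slice F half half) u, -push (slice F 0 half) u, h1', h2',
    push_mem_supp_of_forall _ (fun x => ?_) _, neg_mem (push_mem_supp_of_forall _ (fun x => ?_) _),
    ?_, .of_eq (sub_eq_add_neg _ _), ?_⟩
  · change (0 : ℝ) < 1 * ((-twoCell (half, half) : S2) : E3) 2
    rw [coe_neg_S2, twoCell_half_half_two]
    norm_num
  · change F ((x, 0), half) ∈ _
    rw [hb x 0 half (by simp)]
    exact neg_basePt_mem_halfSpace
  · rw [bd_push, hu, map_zero]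
  · rw [push_comp]
    refine (homologous_slice_zero_half f hu).trans
      (.of_eq (congrArg (fun g => push g u) (ContinuousMap.ext fun x => ?_)))
    exact hf x 0 half (by simp)

/-! ### The cross product with the fundamental class of the sphere -/

/-- The map `A × [0,1]² → A × S²` given by the characteristic map of the two-cell. -/
def cellFamily (A : Type) [TopologicalSpace A] : C((A × I) × I, A × S2) :=
  ContinuousMap.prodMk ⟨fun x => x.1.1, by fun_prop⟩
    (twoCell.comp ⟨fun x => (x.1.2, x.2), by fun_prop⟩)

/-- The cross product of a chain with the fundamental cycle of the sphere. -/
def cross (A : Type) [TopologicalSpace A] : Chain A →ₗ[ℂ] Chain (A × S2) := sweep₂ (cellFamily A)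

theorem bd_cross (u : Chain A) : bd _ (cross A u) = cross A (bd A u) :=
  bd_sweep₂ _ (fun x b => Prod.ext rfl ((twoCell_boundary 0 b (by simp)).trans
    (twoCell_boundary 1 b (by simp)).symm)) (fun x a => Prod.ext rfl
    ((twoCell_boundary a 0 (by simp)).trans (twoCell_boundary a 1 (by simp)).symm)) u

theorem cross_push (f : C(A, B)) (u : Chain A) :
    cross B (push f u) = push (f.prodMap (ContinuousMap.id S2)) (cross A u) := by
  rw [cross, sweep₂_push, cross, push_sweep₂]
  rfl

theorem proj_cross (u : Chain A) : push (proj A) (cross A u) = 0 := by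
  rw [cross, push_sweep₂]
  exact sweep₂_eq_zero_of_swap _ rfl u

theorem proj_atPoint (q : S2) (u : Chain A) : push (proj A) (push (atPoint A q) u) = u := by
  rw [push_comp]
  exact push_id u

theorem sphereRel_cross {u : Chain A} (hu : bd A u = 0) : SphereRel (cross A u) (-u) := by
  exact (sphereRel_sweep₂_twoCell (X := A) (A := A) ⟨fun x => x.1.1, by fun_prop⟩
    (fun _ _ _ _ => rfl) hu).congr (.of_eq (congrArg Neg.neg (push_id u)))

/-- Every cycle of `A × S²` is homologous to a sum of a cycle of `A` and a cross product. -/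
theorem exists_homologous_add_cross {z : Chain (A × S2)} (hz : bd _ z = 0) :
    ∃ u, bd A u = 0 ∧
      Homologous z (push (atPoint A basePt) (push (proj A) z) + cross A u) := by
  obtain ⟨v, hv, h⟩ := exists_sphereRel hz
  have hv' : bd A (-v) = 0 := by rw [map_neg, hv, neg_zero]
  have hp : bd A (push (proj A) z) = 0 := by rw [bd_push, hz, map_zero]
  refine ⟨-v, hv', h.homologous ((sphereRel_atPoint hp).add (sphereRel_cross hv')) hz ?_ ?_ ?_⟩
  · rw [map_add, bd_push, hp, bd_cross, hv', map_zero, map_zero, add_zero]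
  · exact .of_eq (by rw [zero_add, neg_neg])
  · exact .of_eq (by rw [map_add, proj_atPoint, proj_cross, add_zero])

/-- The two summands of a cycle of `A × S²` are unique up to homology. -/
theorem homologous_zero_of_add_cross {w u : Chain A} (hw : bd A w = 0) (hu : bd A u = 0)
    (h : Homologous (push (atPoint A basePt) w + cross A u) 0) :
    Homologous w 0 ∧ Homologous u 0 := by
  constructor
  · have := h.map (proj A)
    rwa [map_add, proj_atPoint, proj_cross, add_zero, map_zero] at this
  · have := ((sphereRel_atPoint hw).add (sphereRel_cross hu)).homologous_zero_right
      (by rw [map_add, bd_push, hw, bd_cross, hu, map_zero, map_zero, add_zero]) h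
    rw [zero_add] at this
    simpa using this.neg

theorem homologous_atPoint_neg {u : Chain A} (hu : bd A u = 0) :
    Homologous (push (atPoint A (-basePt)) u) (push (atPoint A basePt) u) := by
  have hm : ((-basePt : S2) : E3) ∈ offRay 1 := fun h => by
    have := h.2.1
    rw [coe_neg_S2, basePt_two] at this
    norm_num at this
  have := isStarCone_offRay_one.homologousIn_reset (basePt_mem_offRay 1)
    (z := push (atPoint A (-basePt)) u) (by rw [bd_push, hu, map_zero])
    (push_mem_supp_of_forall _ (fun _ => hm) _)
  rw [reset_eq, proj_atPoint] at this
  exact this.mono (Set.subset_univ _)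

/-- The antipodal map of the sphere. -/
def antipode : C(S2, S2) := ⟨fun s => -s, continuous_neg⟩

/-- The antipodal map of the sphere reverses the sign of the cross product. -/
theorem homologous_antipode_cross {u : Chain A} (hu : bd A u = 0) :
    Homologous (push ((ContinuousMap.id A).prodMap antipode) (cross A u)) (-cross A u) := by
  have h1 := sphereRel_sweep₂_neg_twoCell (X := A) (A := A) ⟨fun x => x.1.1, by fun_prop⟩
    (fun _ _ _ _ => rfl) hu
  have h2 := (sphereRel_cross hu).smul (-1)
  rw [neg_one_smul, neg_one_smul, neg_neg] at h2
  have e : push ((ContinuousMap.id A).prodMap antipode) (cross A u) =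
      sweep₂ (ContinuousMap.prodMk ⟨fun x => x.1.1, by fun_prop⟩
        (-twoCell.comp ⟨fun x => (x.1.2, x.2), by fun_prop⟩)) u := by
    rw [cross, push_sweep₂]
    rfl
  rw [← e] at h1
  refine h1.homologous h2 ?_ ?_ (.of_eq (push_id u)) ?_
  · rw [bd_push, bd_cross, hu, map_zero, map_zero]
  · rw [map_neg, bd_cross, hu, map_zero, neg_zero]
  · rw [map_neg, push_comp, proj_cross, neg_zero]
    exact .of_eq (proj_cross u)

/-- The map `(a, s) ↦ (a, -s, s)`. -/
def antidiag (A : Type) [TopologicalSpace A] : C(A × S2, (A × S2) × S2) :=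
  ⟨fun x => ((x.1, -x.2), x.2), by fun_prop⟩

/-- The class of the antidiagonal of `S² × S²`, multiplied with a cycle. -/
theorem homologous_antidiag_cross {u : Chain A} (hu : bd A u = 0) :
    Homologous (push (antidiag A) (cross A u))
      (-push (atPoint _ basePt) (cross A u) + cross _ (push (atPoint A basePt) u)) := by
  have hc : bd _ (cross A u) = 0 := by rw [bd_cross, hu, map_zero]
  have hj : bd _ (push (atPoint A basePt) u) = 0 := by rw [bd_push, hu, map_zero]
  have h1 := sphereRel_sweep₂_twoCell (X := A) (A := A × S2)
    ⟨fun x => (x.1.1, -twoCell (x.1.2, x.2)), by fun_prop⟩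
    (fun x a b h => Prod.ext rfl (congrArg Neg.neg ((twoCell_boundary a b h).trans
      (twoCell_boundary 0 0 (by simp)).symm))) hu
  have e : push (antidiag A) (cross A u) = sweep₂ (ContinuousMap.prodMk
      ⟨fun x => (x.1.1, -twoCell (x.1.2, x.2)), by fun_prop⟩
        (twoCell.comp ⟨fun x => (x.1.2, x.2), by fun_prop⟩)) u := by
    rw [cross, push_sweep₂]
    rfl
  rw [← e] at h1
  have h2 := (sphereRel_atPoint hc).smul (-1)
  rw [neg_one_smul, neg_one_smul, neg_zero] at h2
  have h3 := h2.add (sphereRel_cross hj)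
  refine h1.homologous h3 ?_ ?_ ?_ ?_
  · rw [bd_push, hc, map_zero]
  · rw [map_add, map_neg, bd_push, hc, bd_cross, hj, map_zero, map_zero, neg_zero, add_zero]
  · rw [zero_add]
    refine HomologousIn.neg (HomologousIn.trans (.of_eq ?_) (homologous_atPoint_neg hu))
    exact congrArg (fun g => push g u) (ContinuousMap.ext fun x => Prod.ext rfl
      (congrArg Neg.neg (twoCell_boundary 0 0 (by simp))))
  · rw [map_add, map_neg, proj_atPoint, proj_cross, add_zero, push_comp]
    exact homologous_antipode_cross hu

end Sphere

/-! ### The fundamental chain of the cube -/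

theorem prismList_ofFn {K : Type} {m : ℕ} (v : Fin (m + 1) → K) :
    prismList (List.ofFn v) = ∑ k : Fin (m + 1), (-1 : ℂ) ^ (k : ℕ) •
      Finsupp.single (List.ofFn fun j : Fin (m + 2) =>
        (v (k.predAbove j), if k.castSucc < j then (1 : I) else 0)) 1 := by
  induction m with
  | zero => simp [prismList]
  | succ m ih =>
    rw [List.ofFn_succ, prismList, ih, Fin.sum_univ_succ (n := m + 1), map_sum, sub_eq_add_neg,
      ← Finset.sum_neg_distrib]
    refine congrArg₂ (· + ·) ?_ (Finset.sum_congr rfl fun i _ => ?_)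
    · rw [Fin.val_zero, pow_zero, one_smul]
      congr 1
      rw [List.ofFn_succ, List.ofFn_succ]
      simp [-List.ofFn_succ, Function.comp_def]
      rw [List.ofFn_succ (f := fun i => (v i, (1 : I))), List.ofFn_succ]
      rfl
    · rw [map_smul, coneL_single, Fin.val_succ, pow_succ, mul_neg_one, neg_smul, List.ofFn_succ
        (f := fun j : Fin (m + 3) => (v (i.succ.predAbove j),
          if i.succ.castSucc < j then (1 : I) else 0))]
      simp [-List.ofFn_succ, Fin.succ_predAbove_succ]

/-- The vertices of the simplex of the cube that belongs to the inverse of a permutation. -/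
def cubeVert {m : ℕ} (ρ : Equiv.Perm (Fin m)) (j : Fin (m + 1)) (i : Fin m) : I :=
  if (ρ i).castSucc < j then 1 else 0

theorem comb_cubeVert {m : ℕ} (ρ : Equiv.Perm (Fin m)) : comb (cubeVert ρ) = cubeSimplex ρ⁻¹ := by
  refine ContinuousMap.ext fun t => funext fun i => Subtype.ext ?_
  change ∑ j, t j * ((cubeVert ρ j i : I) : ℝ) = ∑ j with (ρ i).castSucc < j, t j
  rw [Finset.sum_filter]
  refine Finset.sum_congr rfl fun j _ => ?_
  unfold cubeVert
  split_ifs <;> simp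

theorem cubeCh_eq_realize (m : ℕ) : cubeCh m = realize _ (∑ ρ : Equiv.Perm (Fin m),
    (Equiv.Perm.sign ρ : ℂ) • Finsupp.single (List.ofFn (cubeVert ρ)) 1) := by
  simp only [map_sum, map_smul, realize_single, realizeList_ofFn, comb_cubeVert]
  rw [cubeCh, ← Equiv.sum_comp (Equiv.inv _)]
  simp

/-- The homeomorphism that inserts a new first coordinate into a cube. -/
def consCube (m : ℕ) : C((Fin m → I) × I, Fin (m + 1) → I) :=
  ⟨fun x => Fin.cons x.2 x.1, by fun_prop⟩

theorem isAffine_consCube (m : ℕ) : IsAffine (consCube m) := by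
  refine fun n v => ContinuousMap.ext fun t => funext fun i => Subtype.ext ?_
  refine Fin.cases ?_ (fun i => ?_) i <;> rfl

/-- The permutation that inserts a new first letter with value `k`. -/
def insertPerm {m : ℕ} (k : Fin (m + 1)) (ρ : Equiv.Perm (Fin m)) : Equiv.Perm (Fin (m + 1)) :=
  k.cycleRange⁻¹ * Equiv.Perm.decomposeFin.symm (0, ρ)

theorem insertPerm_zero {m : ℕ} (k : Fin (m + 1)) (ρ : Equiv.Perm (Fin m)) :
    insertPerm k ρ 0 = k := by
  simp [insertPerm]

theorem insertPerm_succ {m : ℕ} (k : Fin (m + 1)) (ρ : Equiv.Perm (Fin m)) (i : Fin m) :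
    insertPerm k ρ i.succ = k.succAbove (ρ i) := by
  simp [insertPerm]

theorem sign_insertPerm {m : ℕ} (k : Fin (m + 1)) (ρ : Equiv.Perm (Fin m)) :
    Equiv.Perm.sign (insertPerm k ρ) = (-1) ^ (k : ℕ) * Equiv.Perm.sign ρ := by
  simp [insertPerm, Equiv.Perm.decomposeFin.symm_sign]

theorem insertPerm_bijective (m : ℕ) : Function.Bijective
    fun x : Equiv.Perm (Fin m) × Fin (m + 1) => insertPerm x.2 x.1 := by
  rw [Fintype.bijective_iff_injective_and_card]
  constructor
  · rintro ⟨ρ, k⟩ ⟨ρ', k'⟩ h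
    have h0 : k = k' := by
      have := congr($h 0)
      simpa only [insertPerm_zero] using this
    subst h0
    refine Prod.ext (Equiv.ext fun i => ?_) rfl
    have := congr($h i.succ)
    simp only [insertPerm_succ] at this
    exact Fin.succAbove_right_injective this
  · simp [Fintype.card_perm, Nat.factorial_succ, mul_comm]

theorem cubeVert_insertPerm {m : ℕ} (k : Fin (m + 1)) (ρ : Equiv.Perm (Fin m)) (j : Fin (m + 2)) :
    consCube m (cubeVert ρ (k.predAbove j), if k.castSucc < j then (1 : I) else 0) =
      cubeVert (insertPerm k ρ) j := by
  funext i
  refine Fin.cases ?_ (fun i => ?_) i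
  · simp [consCube, cubeVert, insertPerm_zero]
  · simp only [consCube, ContinuousMap.coe_mk, Fin.cons_succ, cubeVert, insertPerm_succ]
    generalize ρ i = r
    have : r.castSucc < k.predAbove j ↔ (k.succAbove r).castSucc < j := by
      have hk : (k.castSucc : ℕ) = k := rfl
      have hr : (r.castSucc : ℕ) = r := rfl
      have hr' : (r.succ : ℕ) = r + 1 := rfl
      rcases lt_or_ge k.castSucc j with h1 | h1
      · rw [Fin.predAbove_of_castSucc_lt _ _ h1]
        have hj : ((j.pred (Fin.ne_zero_of_lt h1) : Fin (m + 1)) : ℕ) = (j : ℕ) - 1 := rfl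
        rcases lt_or_ge r.castSucc k with h2 | h2
        · rw [Fin.succAbove_of_castSucc_lt _ _ h2, Fin.lt_def, Fin.lt_def, hj]
          simp only [Fin.val_castSucc]
          rw [Fin.lt_def] at h1 h2
          omega
        · rw [Fin.succAbove_of_le_castSucc _ _ h2, Fin.lt_def, Fin.lt_def, hj]
          simp only [Fin.val_castSucc, Fin.val_succ]
          rw [Fin.lt_def] at h1
          omega
      · rw [Fin.predAbove_of_le_castSucc _ _ h1]
        have hj : ((j.castPred (Fin.ne_last_of_lt (h1.trans_lt k.castSucc_lt_last)) :
          Fin (m + 1)) : ℕ) = j := rfl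
        rw [Fin.le_def] at h1
        rcases lt_or_ge r.castSucc k with h2 | h2
        · rw [Fin.succAbove_of_castSucc_lt _ _ h2, Fin.lt_def, Fin.lt_def, hj]
          rfl
        · rw [Fin.succAbove_of_le_castSucc _ _ h2, Fin.lt_def, Fin.lt_def, hj]
          simp only [Fin.val_castSucc, Fin.val_succ]
          rw [Fin.le_def] at h2
          omega
    simp only [this]

/-- The fundamental chain of a cube is the prism over the fundamental chain of its face. -/
theorem cubeCh_succ (m : ℕ) : cubeCh (m + 1) = push (consCube m) (prism _ (cubeCh m)) := by
  rw [cubeCh_eq_realize m, prism_realize, ← realize_mapL (isAffine_consCube m), cubeCh_eq_realize]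
  congr 1
  rw [← (insertPerm_bijective m).sum_comp, Fintype.sum_prod_type]
  simp only [map_sum, map_smul, prismL_single, prismList_ofFn, mapL_single, List.map_ofFn,
    Finset.smul_sum]
  refine Finset.sum_congr rfl fun ρ _ => Finset.sum_congr rfl fun k _ => ?_
  rw [smul_smul, sign_insertPerm]
  congr 1
  · push_cast
    rw [mul_comm]
  · congr 2
    funext j
    exact (cubeVert_insertPerm k ρ j).symm

/-- The homeomorphism that inserts two new first coordinates into a cube. -/
def consCube₂ (m : ℕ) : C(((Fin m → I) × I) × I, Fin (m + 2) → I) :=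
  ⟨fun x => Fin.cons x.1.2 (Fin.cons x.2 x.1.1), by fun_prop⟩

theorem cubeCh_add_two (m : ℕ) :
    cubeCh (m + 2) = -push (consCube₂ m) (prism _ (prism _ (cubeCh m))) := by
  rw [cubeCh_succ, cubeCh_succ, prism_push, push_comp, ← map_neg, ← push_swap_prism_prism,
    push_comp]
  rfl

/-! ### Operators on the total homology -/

section Operators
variable {X Y Z A B : Type} [TopologicalSpace X] [TopologicalSpace Y] [TopologicalSpace Z]
  [TopologicalSpace A] [TopologicalSpace B]

/-- The class of a cycle in the total homology. -/
def cls (z : Chain X) (hz : bd X z = 0) : HTot X := totClass X ⟨z, hz⟩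

theorem exists_cls (x : HTot X) : ∃ (z : Chain X) (hz : bd X z = 0), cls z hz = x :=
  let ⟨z, hz⟩ := totClass_surjective x
  ⟨z.1, z.2, hz⟩

theorem cls_eq_zero_iff {z : Chain X} (hz : bd X z = 0) : cls z hz = 0 ↔ Homologous z 0 := by
  refine (totClass_eq_zero_iff _).trans ⟨fun ⟨b, hb⟩ => ⟨b, mem_supp_univ b, ?_⟩, fun ⟨b, _, hb⟩ =>
    ⟨b, ?_⟩⟩
  · rw [sub_zero]
    exact hb.symm
  · rw [← hb, sub_zero]

theorem cls_congr {z z' : Chain X} (h : z = z') (hz : bd X z = 0) (hz' : bd X z' = 0) :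
    cls z hz = cls z' hz' := by
  subst h
  rfl

theorem cls_add {z z' : Chain X} (hz : bd X z = 0) (hz' : bd X z' = 0) :
    cls z hz + cls z' hz' = cls (z + z') (by rw [map_add, hz, hz', add_zero]) := by
  unfold cls
  rw [← LinearMap.map_add]
  exact congrArg _ (Subtype.ext rfl)

theorem cls_smul (r : ℂ) {z : Chain X} (hz : bd X z = 0) :
    r • cls z hz = cls (r • z) (by rw [map_smul, hz, smul_zero]) := by
  unfold cls
  rw [← LinearMap.map_smul]
  exact congrArg _ (Subtype.ext rfl)

theorem cls_neg {z : Chain X} (hz : bd X z = 0) :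
    -cls z hz = cls (-z) (by rw [map_neg, hz, neg_zero]) := by
  rw [← neg_one_smul ℂ, cls_smul]
  exact cls_congr (neg_one_smul ℂ z) _ _

theorem cls_eq_iff {z z' : Chain X} (hz : bd X z = 0) (hz' : bd X z' = 0) :
    cls z hz = cls z' hz' ↔ Homologous z z' := by
  rw [← sub_eq_zero, sub_eq_add_neg, cls_neg, cls_add, cls_eq_zero_iff, ← sub_eq_add_neg]
  constructor
  · intro h
    simpa using h.add (.refl _ z')
  · intro h
    simpa using h.sub (.refl _ z')

theorem HTotMap_cls (f : C(X, Y)) {z : Chain X} (hz : bd X z = 0) :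
    HTotMap f (cls z hz) = cls (push f z) (by rw [bd_push, hz, map_zero]) :=
  HTotMap_totClass f _

theorem HTotMap_comp (g : C(Y, Z)) (f : C(X, Y)) (x : HTot X) :
    HTotMap g (HTotMap f x) = HTotMap (g.comp f) x := by
  obtain ⟨z, hz, rfl⟩ := exists_cls x
  rw [HTotMap_cls, HTotMap_cls, HTotMap_cls]
  exact cls_congr (push_comp _ _ _) _ _

theorem HTotMap_id (x : HTot X) : HTotMap (ContinuousMap.id X) x = x := by
  obtain ⟨z, hz, rfl⟩ := exists_cls x
  rw [HTotMap_cls]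
  exact cls_congr (push_id z) _ _

theorem HTotMap_homotopy (F : C(X × I, Y)) (x : HTot X) :
    HTotMap (F.comp (atTime X 1)) x = HTotMap (F.comp (atTime X 0)) x := by
  obtain ⟨z, hz, rfl⟩ := exists_cls x
  rw [HTotMap_cls, HTotMap_cls, cls_eq_iff]
  exact HomologousIn.of_homotopy F (V := Set.univ) (fun _ => trivial) hz

/-- The map of cycles induced by a chain map. -/
def chainOpCyc (φ : Chain X →ₗ[ℂ] Chain Y) (hφ : ∀ c, bd Y (φ c) = φ (bd X c)) :
    Cyc X →ₗ[ℂ] Cyc Y :=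
  (φ ∘ₗ (Cyc X).subtype).codRestrict (Cyc Y) fun c => by
    rw [LinearMap.mem_ker]
    exact (hφ c.1).trans (by rw [c.2, map_zero])

variable (X) in
theorem exists_cycle_section : ∃ g : HTot X →ₗ[ℂ] Cyc X, totClass X ∘ₗ g = LinearMap.id :=
  (totClass X).exists_rightInverse_of_surjective (LinearMap.range_eq_top.2 totClass_surjective)

/-- The map of total homology induced by a chain map, by means of a linear choice of representing
cycles; the result does not depend on the choice, by `chainOp_cls`. -/
def chainOp (φ : Chain X →ₗ[ℂ] Chain Y) (hφ : ∀ c, bd Y (φ c) = φ (bd X c)) : HTot X →ₗ[ℂ] HTot Y :=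
  totClass Y ∘ₗ chainOpCyc φ hφ ∘ₗ (exists_cycle_section X).choose

theorem chainOp_cls (φ : Chain X →ₗ[ℂ] Chain Y) (hφ : ∀ c, bd Y (φ c) = φ (bd X c)) {z : Chain X}
    (hz : bd X z = 0) : chainOp φ hφ (cls z hz) = cls (φ z) (by rw [hφ, hz, map_zero]) := by
  obtain ⟨y, hy⟩ : ∃ y, y = (exists_cycle_section X).choose (cls z hz) := ⟨_, rfl⟩
  have h1 : cls y.1 y.2 = cls z hz := by
    subst hy
    exact congr($((exists_cycle_section X).choose_spec) (cls z hz))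
  have h2 : chainOp φ hφ (cls z hz) = cls (φ y.1) (by rw [hφ, y.2, map_zero]) := by
    unfold chainOp
    rw [LinearMap.comp_apply, LinearMap.comp_apply, ← hy]
    rfl
  rw [h2, cls_eq_iff]
  obtain ⟨b, -, hb⟩ := (cls_eq_iff _ _).1 h1
  exact ⟨φ b, mem_supp_univ _, by rw [← map_sub, hb, hφ]⟩

/-- The cross product with the fundamental class of the sphere. -/
def crossH (A : Type) [TopologicalSpace A] : HTot A →ₗ[ℂ] HTot (A × S2) :=
  chainOp (cross A) bd_cross

theorem crossH_cls {z : Chain A} (hz : bd A z = 0) :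
    crossH A (cls z hz) = cls (cross A z) (by rw [bd_cross, hz, map_zero]) :=
  chainOp_cls _ _ hz

theorem crossH_HTotMap (f : C(A, B)) (x : HTot A) :
    crossH B (HTotMap f x) = HTotMap (f.prodMap (ContinuousMap.id S2)) (crossH A x) := by
  obtain ⟨z, hz, rfl⟩ := exists_cls x
  rw [HTotMap_cls, crossH_cls, crossH_cls, HTotMap_cls]
  exact cls_congr (cross_push f z) _ _

theorem antipode_crossH (x : HTot A) :
    HTotMap ((ContinuousMap.id A).prodMap antipode) (crossH A x) = -crossH A x := by
  obtain ⟨z, hz, rfl⟩ := exists_cls x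
  rw [crossH_cls, HTotMap_cls, cls_neg, cls_eq_iff]
  exact homologous_antipode_cross hz

/-- The antidiagonal sphere, the image of `s ↦ (-s, s)`, is the sphere in the second factor minus
the sphere in the first factor, because the antipodal map has degree `-1`. -/
theorem antidiag_crossH (x : HTot A) : HTotMap (antidiag A) (crossH A x) =
    -HTotMap (atPoint _ basePt) (crossH A x) + crossH _ (HTotMap (atPoint A basePt) x) := by
  obtain ⟨z, hz, rfl⟩ := exists_cls x
  rw [crossH_cls, HTotMap_cls, HTotMap_cls, HTotMap_cls, crossH_cls]
  rw [cls_neg, cls_add, cls_eq_iff]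
  exact homologous_antidiag_cross hz

variable (A) in
/-- The homology of `A × S²` as the sum of two copies of the homology of `A`. -/
theorem productMap_bijective : Function.Bijective
    ((HTotMap (atPoint A basePt)).coprod (crossH A)) := by
  have key : ∀ (w u : Chain A) (hw : bd A w = 0) (hu : bd A u = 0),
      HTotMap (atPoint A basePt) (cls w hw) + crossH A (cls u hu) =
        cls (push (atPoint A basePt) w + cross A u)
          (by rw [map_add, bd_push, bd_cross, hw, hu, map_zero, map_zero, add_zero]) := by
    intro w u hw hu
    rw [HTotMap_cls, crossH_cls, cls_add]
  constructor
  · rw [injective_iff_map_eq_zero]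
    rintro ⟨x, y⟩ h
    obtain ⟨w, hw, rfl⟩ := exists_cls x
    obtain ⟨u, hu, rfl⟩ := exists_cls y
    rw [LinearMap.coprod_apply, key, cls_eq_zero_iff] at h
    obtain ⟨h1, h2⟩ := homologous_zero_of_add_cross hw hu h
    exact Prod.ext ((cls_eq_zero_iff hw).2 h1) ((cls_eq_zero_iff hu).2 h2)
  · intro x
    obtain ⟨z, hz, rfl⟩ := exists_cls x
    obtain ⟨u, hu, h⟩ := exists_homologous_add_cross hz
    refine ⟨(cls (push (proj A) z) (by rw [bd_push, hz, map_zero]), cls u hu), ?_⟩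
    rw [LinearMap.coprod_apply, key, cls_eq_iff]
    exact h.symm

/-! ### The commutation of cross products -/

/-- The exchange of the two spheres. -/
def swapSpheres (A : Type) [TopologicalSpace A] : C((A × S2) × S2, (A × S2) × S2) :=
  ⟨fun x => ((x.1.1, x.2), x.1.2), by fun_prop⟩

theorem swap_family (q : C(I × I, S2)) (G : C((((A × I) × I) × I) × I, (A × S2) × S2))
    (hG : ∀ x a b c d, G ((((x, a), b), c), d) = ((x, q (a, b)), q (c, d))) :
    (swapSpheres A).comp G = ((((G.comp ((swapTimes (A × I)).prodMap (.id I))).comp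
      ((((swapTimes A).prodMap (.id I)).prodMap (.id I)))).comp (swapTimes ((A × I) × I)))).comp
      ((swapTimes (A × I)).prodMap (.id I)) := by
  refine ContinuousMap.ext fun ⟨⟨⟨⟨x, a⟩, b⟩, c⟩, d⟩ => ?_
  have h1 : ((swapSpheres A).comp G) ((((x, a), b), c), d) = ((x, q (c, d)), q (a, b)) :=
    congrArg (swapSpheres A) (hG x a b c d)
  exact h1.trans (hG x c d a b).symm

/-- Cross products with two spheres commute, exactly on chains: the exchange of two pairs of time
coordinates is an even permutation. -/
theorem swapSpheres_cross (u : Chain A) :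
    push (swapSpheres A) (cross _ (cross A u)) = cross _ (cross A u) := by
  -- the four prisms over a chain, and the exchanges of neighbouring time coordinates
  set P := prism _ (prism _ (prism _ (prism A u))) with hP
  have s1 : push ((((swapTimes A).prodMap (.id I)).prodMap (.id I))) P = -P := by
    rw [hP, ← prism_push, ← prism_push, push_swap_prism_prism, map_neg, map_neg]
  have s2 : push ((swapTimes (A × I)).prodMap (.id I)) P = -P := by
    rw [hP, ← prism_push, push_swap_prism_prism, map_neg]
  have s3 : push (swapTimes ((A × I) × I)) P = -P := by
    rw [hP, push_swap_prism_prism]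
  set G : C((((A × I) × I) × I) × I, (A × S2) × S2) :=
    (cellFamily (A × S2)).comp (((cellFamily A).prodMap (.id I)).prodMap (.id I)) with hG
  have hc : cross _ (cross A u) = push G P := by
    rw [cross, cross, sweep₂_apply, sweep₂_apply, sweep, sweep, LinearMap.comp_apply,
      LinearMap.comp_apply, prism_push, prism_push, push_comp]
  have hs := swap_family twoCell G fun _ _ _ _ _ => rfl
  rw [hc, push_comp, hs]
  simp only [← push_comp, s1, s2, s3, map_neg, neg_neg]

theorem swapSpheres_crossH (x : HTot A) :
    HTotMap (swapSpheres A) (crossH _ (crossH A x)) = crossH _ (crossH A x) := by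
  obtain ⟨z, hz, rfl⟩ := exists_cls x
  rw [crossH_cls, crossH_cls, HTotMap_cls]
  exact cls_congr (swapSpheres_cross z) _ _

end Operators

/-! ### Product cells as iterated cross products -/

theorem bd_cubeCh_zero : bd _ (cubeCh 0) = 0 := by
  obtain ⟨h, -⟩ := totClass_cubeClass (ContinuousMap.id (Fin 0 → I)) fun _ i => i.elim0
  rwa [push_id] at h

/-- The class of a point. -/
def ptClass {X : Type} [TopologicalSpace X] (x : X) : HTot X :=
  cls (push (ContinuousMap.const _ x) (cubeCh 0)) (by rw [bd_push, bd_cubeCh_zero, map_zero])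

theorem HTotMap_ptClass {X Y : Type} [TopologicalSpace X] [TopologicalSpace Y] (f : C(X, Y))
    (x : X) : HTotMap f (ptClass x) = ptClass (f x) := by
  rw [ptClass, HTotMap_cls]
  exact cls_congr (push_comp _ _ _) _ _

/-- The class of a cube in the total homology, in terms of ungraded chains. -/
theorem lof_cubeClass {X : Type} [TopologicalSpace X] {m : ℕ} (f : C(Fin m → I, X))
    (hf : IsClosedCube f) : ∃ h : bd X (push f (cubeCh m)) = 0,
      DirectSum.lof ℂ ℕ (fun d => H X d) m (cubeClass f hf) = cls (push f (cubeCh m)) h :=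
  let ⟨h, e⟩ := totClass_cubeClass f hf
  ⟨h, e.symm⟩

section Slots
variable {n : ℕ}

/-- The map `(S²)^n × S² → (S²)^n` that replaces some coordinates by functions of the last
argument. -/
def slot (φ : Fin n → Option C(S2, S2)) : C((Fin n → S2) × S2, Fin n → S2) where
  toFun x v := (φ v).elim (x.1 v) fun g => g x.2
  continuous_toFun := by
    refine continuous_pi fun v => ?_
    cases φ v with
    | none => exact (continuous_apply v).comp continuous_fst
    | some g => exact g.continuous.comp continuous_snd

/-- The cross product with the fundamental class of the sphere, put into some slots; the sign makes
it agree with the orientation of cubes. -/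
def cellOp (φ : Fin n → Option C(S2, S2)) : HTot (Fin n → S2) →ₗ[ℂ] HTot (Fin n → S2) :=
  -(HTotMap (slot φ) ∘ₗ crossH _)

theorem cellOp_apply (φ : Fin n → Option C(S2, S2)) (x : HTot (Fin n → S2)) :
    cellOp φ x = -HTotMap (slot φ) (crossH _ x) := rfl

/-- The map from a cube to `(S²)^n` that fills the slots successively. -/
def cubeMap (x : Fin n → S2) (k : ℕ) (φ : Fin k → Fin n → Option C(S2, S2)) :
    C(Fin (2 * k) → I, Fin n → S2) :=
  match k, φ with
  | 0, _ => ContinuousMap.const _ x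
  | k + 1, φ => (slot (φ 0)).comp
      (((cubeMap x k fun j => φ j.succ).comp ⟨fun t i => t i.succ.succ, by fun_prop⟩).prodMk
        (twoCell.comp ⟨fun t => (t (0 : Fin (2 * k + 2)), t (1 : Fin (2 * k + 2))), by fun_prop⟩))

theorem exists_push_cubeMap (x : Fin n → S2) {k : ℕ} (φ : Fin k → Fin n → Option C(S2, S2)) :
    ∃ h : bd _ (push (cubeMap x k φ) (cubeCh (2 * k))) = 0,
      cls _ h = (List.ofFn φ).foldr (fun φ y => cellOp φ y) (ptClass x) := by
  induction k with
  | zero => 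
    have hb : bd _ (cubeCh (2 * 0)) = 0 := bd_cubeCh_zero
    exact ⟨by rw [bd_push, hb, map_zero], rfl⟩
  | succ k ih =>
    obtain ⟨h, e⟩ := ih fun j => φ j.succ
    have hc : bd _ (cross _ (push (cubeMap x k fun j => φ j.succ) (cubeCh (2 * k)))) = 0 := by
      rw [bd_cross, h, map_zero]
    have hG : (cubeMap x (k + 1) φ).comp (consCube₂ (2 * k)) =
        ((slot (φ 0)).comp (cellFamily _)).comp
        (((cubeMap x k fun j => φ j.succ).prodMap (.id I)).prodMap (.id I)) :=
      ContinuousMap.ext fun y => congrArg (slot (φ 0)) (Prod.ext rfl rfl)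
    have key : push (cubeMap x (k + 1) φ) (cubeCh (2 * (k + 1))) =
        -push (slot (φ 0)) (cross _ (push (cubeMap x k fun j => φ j.succ) (cubeCh (2 * k)))) := by
      obtain ⟨g, hg⟩ : ∃ g : C(Fin (2 * k + 2) → I, Fin n → S2), g = cubeMap x (k + 1) φ := ⟨_, rfl⟩
      rw [← hg] at hG
      change push (cubeMap x (k + 1) φ) (cubeCh (2 * k + 2)) = _
      rw [← hg, cubeCh_add_two, map_neg, push_comp, hG, cross, push_sweep₂, sweep₂_push]
      rfl
    refine ⟨by rw [key, map_neg, bd_push, hc, map_zero, neg_zero], ?_⟩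
    rw [List.ofFn_succ, List.foldr_cons, ← e, cellOp_apply, crossH_cls, HTotMap_cls, cls_neg]
    exact cls_congr key _ _

theorem cubeMap_apply_none (x : Fin n → S2) {k : ℕ} (φ : Fin k → Fin n → Option C(S2, S2))
    (t : Fin (2 * k) → I) (v : Fin n) (h : ∀ j, φ j v = none) : cubeMap x k φ t v = x v := by
  induction k with
  | zero => rfl
  | succ k ih =>
    change (φ 0 v).elim _ _ = _
    rw [h 0]
    exact ih _ _ fun j => h j.succ

theorem cubeMap_apply_some (x : Fin n → S2) {k : ℕ} (φ : Fin k → Fin n → Option C(S2, S2))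
    (t : Fin (2 * k) → I) (v : Fin n) (j : Fin k) (g : C(S2, S2)) (hj : φ j v = some g)
    (h : ∀ i, i ≠ j → φ i v = none) :
    cubeMap x k φ t v = g (twoCell (t ⟨2 * j, by omega⟩, t ⟨2 * j + 1, by omega⟩)) := by
  induction k with
  | zero => exact j.elim0
  | succ k ih =>
    change (φ 0 v).elim _ _ = _
    refine Fin.cases (fun hj h => ?_) (fun j hj h => ?_) j hj h
    · rw [hj]
      rfl
    · rw [h 0 (Fin.succ_ne_zero j).symm]
      exact ih _ _ j hj fun i hi => h i.succ fun h' => hi (Fin.succ_injective _ h')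

/-- The class of a map from a cube whose coordinates are given by slots. -/
theorem lof_cubeClass_eq_foldr (x : Fin n → S2) {k : ℕ} (φ : Fin k → Fin n → Option C(S2, S2))
    (f : C(Fin (2 * k) → I, Fin n → S2)) (hf : IsClosedCube f)
    (h : ∀ t v, f t v = cubeMap x k φ t v) :
    DirectSum.lof ℂ ℕ (fun d => H (Fin n → S2) d) (2 * k) (cubeClass f hf) =
      (List.ofFn φ).foldr (fun φ y => cellOp φ y) (ptClass x) := by
  obtain ⟨h1, e1⟩ := lof_cubeClass f hf
  obtain ⟨h2, e2⟩ := exists_push_cubeMap x φ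
  have : f = cubeMap x k φ := ContinuousMap.ext fun t => funext fun v => h t v
  rw [e1, ← e2]
  exact cls_congr (by rw [this]) _ _

/-- The slot that replaces one coordinate. -/
def single (v : Fin n) : Fin n → Option C(S2, S2) := fun w => if w = v then some (.id S2) else none

/-- The cross product with the fundamental class of the sphere in the coordinate `v`. -/
abbrev sphereOp (v : Fin n) : HTot (Fin n → S2) →ₗ[ℂ] HTot (Fin n → S2) := cellOp (single v)

theorem single_self (v : Fin n) : single v v = some (.id S2) := if_pos rfl

theorem single_of_ne {v w : Fin n} (h : w ≠ v) : single v w = none := if_neg h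

theorem slot_single (v : Fin n) (x : (Fin n → S2) × S2) :
    slot (single v) x = Function.update x.1 v x.2 := by
  funext w
  simp only [slot, single, ContinuousMap.coe_mk, Function.update_apply]
  split_ifs <;> rfl

theorem sphereOp_comm (v w : Fin n) (x : HTot (Fin n → S2)) :
    sphereOp v (sphereOp w x) = sphereOp w (sphereOp v x) := by
  rcases eq_or_ne v w with rfl | hvw
  · rfl
  have h : ∀ v w : Fin n, sphereOp v (sphereOp w x) =
      HTotMap ((slot (single v)).comp ((slot (single w)).prodMap (.id S2)))
        (crossH _ (crossH _ x)) := by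
    intro v w
    rw [cellOp_apply, cellOp_apply, map_neg, map_neg, neg_neg, crossH_HTotMap, HTotMap_comp]
  rw [h, h, ← swapSpheres_crossH x, HTotMap_comp, swapSpheres_crossH]
  congr 2
  refine ContinuousMap.ext fun y => ?_
  change slot (single v) (slot (single w) (y.1.1, y.2), y.1.2) =
    slot (single w) (slot (single v) (y.1.1, y.1.2), y.2)
  simp only [slot_single]
  exact Function.update_comm hvw.symm _ _ _

/-- The product class of the spheres in the coordinates in a list. -/
def listClass (l : List (Fin n)) : HTot (Fin n → S2) :=
  l.foldr (fun v x => sphereOp v x) (ptClass fun _ => basePt)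

theorem listClass_perm {l l' : List (Fin n)} (h : l.Perm l') : listClass l = listClass l' :=
  haveI : LeftCommutative fun (v : Fin n) (x : HTot (Fin n → S2)) => sphereOp v x :=
    ⟨fun v w x => sphereOp_comm v w x⟩
  h.foldr_eq _

/-- The product class of the spheres in the coordinates in a set. -/
def setClass (U : Finset (Fin n)) : HTot (Fin n → S2) := listClass U.toList

theorem setClass_insert {U : Finset (Fin n)} {v : Fin n} (h : v ∉ U) :
    setClass (insert v U) = sphereOp v (setClass U) :=
  listClass_perm (Finset.toList_insert h)

/-- A line diagram is an iterated cross product, applied to the class of a point. -/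
theorem lineDiagram_eq_setClass (U : Finset (Fin n)) : lineDiagram U = setClass U := by
  have hp : (List.ofFn (U.orderEmbOfFin rfl)).Perm U.toList := by
    refine (List.perm_ext_iff_of_nodup ?_ U.nodup_toList).2 fun v => ?_
    · rw [List.nodup_ofFn]
      exact (U.orderEmbOfFin rfl).injective
    · rw [List.mem_ofFn, Finset.mem_toList, ← Finset.mem_coe, ← Finset.range_orderEmbOfFin U rfl]
      exact Iff.rfl
  rw [setClass, ← listClass_perm hp]
  refine (lof_cubeClass_eq_foldr (fun _ => basePt) (fun j => single (U.orderEmbOfFin rfl j)) _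
    (prodCell_closed _) fun t v => ?_).trans ?_
  · simp only [prodCell, ContinuousMap.coe_mk]
    by_cases hv : v ∈ U
    · obtain ⟨j, rfl⟩ : ∃ j, U.orderEmbOfFin rfl j = v := by
        rw [← Set.mem_range, Finset.range_orderEmbOfFin]
        exact hv
      have hj : position U (U.orderEmbOfFin rfl j) = some j := by
        rw [position, dif_pos hv]
        congr 1
        rw [OrderIso.symm_apply_eq]
        rfl
      rw [hj, cubeMap_apply_some _ (fun j => single (U.orderEmbOfFin rfl j)) t _ j (.id S2)
        (single_self _) fun i hi => single_of_ne fun h =>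
        hi ((U.orderEmbOfFin rfl).injective h).symm]
      rfl
    · rw [position, dif_neg hv, cubeMap_apply_none _ (fun j => single (U.orderEmbOfFin rfl j)) t v
        fun j => single_of_ne fun h => hv (by
        rw [h]
        exact U.orderEmbOfFin_mem rfl j)]
      rfl
  · have : (List.ofFn fun j => single (U.orderEmbOfFin rfl j)) =
        (List.ofFn (U.orderEmbOfFin rfl)).map single := by
      rw [List.map_ofFn]
      rfl
    rw [listClass, this, List.foldr_map]

end Slots

/-! ### The homology of a point -/

section Point
variable {X : Type} [TopologicalSpace X]

/-- The augmentation, the sum of the coefficients of the simplices of dimension zero. -/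
def aug (X : Type) [TopologicalSpace X] : Chain X →ₗ[ℂ] ℂ :=
  Finsupp.linearCombination ℂ fun s => if s.1 = 0 then 1 else 0

theorem aug_bd (c : Chain X) : aug X (bd X c) = 0 := by
  have : aug X ∘ₗ bd X = 0 := by
    refine chain_hom_ext fun n τ => ?_
    rw [LinearMap.comp_apply, bd_single]
    match n with
    | 0 => simp [bdSimp]
    | 1 => simp [bdSimp, aug, Fin.sum_univ_two]
    | n + 2 => simp [bdSimp, aug]
  exact congr($this c)

theorem ptClass_ne_zero (x : X) : ptClass x ≠ 0 := by
  intro h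
  rw [ptClass, cls_eq_zero_iff] at h
  obtain ⟨b, -, hb⟩ := h
  have := aug_bd b
  rw [← hb, sub_zero] at this
  simp [cubeCh, push_single, aug] at this

variable [Unique X]

/-- The unique simplex of a point in each dimension. -/
def ptSimp (X : Type) [TopologicalSpace X] [Unique X] (n : ℕ) : Chain X :=
  Finsupp.single ⟨n, ContinuousMap.const _ default⟩ 1

theorem single_eq_ptSimp (n : ℕ) (τ : C(stdSimplex ℝ (Fin (n + 1)), X)) :
    Finsupp.single (⟨n, τ⟩ : Simp X) (1 : ℂ) = ptSimp X n := by
  rw [ptSimp, show τ = ContinuousMap.const _ default from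
    ContinuousMap.ext fun _ => Subsingleton.elim _ _]

theorem bd_ptSimp_succ (n : ℕ) :
    bd X (ptSimp X (n + 1)) = (∑ i : Fin (n + 2), (-1 : ℂ) ^ (i : ℕ)) • ptSimp X n := by
  rw [ptSimp, bd_single, bdSimp, Finset.sum_smul]
  refine Finset.sum_congr rfl fun i _ => ?_
  rw [single_eq_ptSimp]

theorem exists_eq_smul_ptClass (x : HTot X) : ∃ r : ℂ, x = r • ptClass default := by
  let h : Chain X →ₗ[ℂ] Chain X := Finsupp.linearCombination ℂ fun s => ptSimp X (s.1 + 1)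
  have hs : ∀ n, h (ptSimp X n) = ptSimp X (n + 1) := fun n => by simp [h, ptSimp]
  have key : bd X ∘ₗ h + h ∘ₗ bd X = LinearMap.id - (aug X).smulRight (ptSimp X 0) := by
    refine chain_hom_ext fun n τ => ?_
    rw [single_eq_ptSimp]
    simp only [LinearMap.add_apply, LinearMap.comp_apply, LinearMap.sub_apply, LinearMap.id_apply,
      LinearMap.smulRight_apply, hs]
    cases n with
    | zero =>
      rw [bd_ptSimp_succ]
      simp [Fin.sum_univ_two, aug, ptSimp, bd_single, bdSimp]
    | succ n =>
      have ha : aug X (ptSimp X (n + 1)) = 0 := by simp [aug, ptSimp]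
      rw [bd_ptSimp_succ, bd_ptSimp_succ, map_smul, hs, ← add_smul, ha, zero_smul, sub_zero,
        Fin.sum_univ_succ (n := n + 2)]
      simp [pow_succ]
  obtain ⟨z, hz, rfl⟩ := exists_cls x
  refine ⟨aug X z, ?_⟩
  rw [ptClass, cls_smul, cls_eq_iff]
  refine ⟨h z, mem_supp_univ _, ?_⟩
  have := congr($key z)
  simp only [LinearMap.add_apply, LinearMap.comp_apply, LinearMap.sub_apply, LinearMap.id_apply,
    LinearMap.smulRight_apply, hz, map_zero, add_zero] at this
  rw [this]
  congr 2
  simp [cubeCh, push_single, ptSimp]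

end Point

/-! ### The basis of line diagrams -/

section Basis
variable {n : ℕ}

/-- The homeomorphism `(S²)^n × S² → (S²)^(n+1)` that inserts a first coordinate. -/
def consMap (n : ℕ) : C((Fin n → S2) × S2, Fin (n + 1) → S2) :=
  ⟨fun x => Fin.cons x.2 x.1, by fun_prop⟩

/-- The inverse of `consMap`. -/
def unconsMap (n : ℕ) : C(Fin (n + 1) → S2, (Fin n → S2) × S2) := ⟨fun x => (Fin.tail x, x 0), by
  unfold Fin.tail
  fun_prop⟩

theorem HTotMap_bijective_of_inverse {X Y : Type} [TopologicalSpace X] [TopologicalSpace Y]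
    (f : C(X, Y)) (g : C(Y, X)) (h : f.comp g = .id Y) (h' : g.comp f = .id X) :
    Function.Bijective (HTotMap f) := by
  refine Function.bijective_iff_has_inverse.2 ⟨HTotMap g, fun x => ?_, fun y => ?_⟩
  · rw [HTotMap_comp, h', HTotMap_id]
  · rw [HTotMap_comp, h, HTotMap_id]

theorem consMap_bijective (n : ℕ) : Function.Bijective (HTotMap (consMap n)) :=
  HTotMap_bijective_of_inverse _ (unconsMap n)
    (ContinuousMap.ext fun x => Fin.cons_self_tail x) (ContinuousMap.ext fun _ => rfl)

/-- The insertion of the base point as a first coordinate. -/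
def consPt (n : ℕ) : C(Fin n → S2, Fin (n + 1) → S2) := (consMap n).comp (atPoint _ basePt)

theorem consPt_sphereOp (v : Fin n) (x : HTot (Fin n → S2)) :
    HTotMap (consPt n) (sphereOp v x) = sphereOp v.succ (HTotMap (consPt n) x) := by
  rw [cellOp_apply, cellOp_apply, map_neg, crossH_HTotMap, HTotMap_comp, HTotMap_comp]
  congr 3
  refine ContinuousMap.ext fun y => ?_
  change Fin.cons basePt (slot (single v) y) = slot (single v.succ) (Fin.cons basePt y.1, y.2)
  rw [slot_single, slot_single, Fin.cons_update]

theorem consPt_ptClass :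
    HTotMap (consPt n) (ptClass fun _ => basePt) = ptClass fun _ => basePt := by
  rw [HTotMap_ptClass]
  congr 1
  funext i
  exact Fin.cases rfl (fun _ => rfl) i

theorem consMap_crossH (x : HTot (Fin n → S2)) :
    -HTotMap (consMap n) (crossH _ x) = sphereOp 0 (HTotMap (consPt n) x) := by
  rw [cellOp_apply, crossH_HTotMap, HTotMap_comp]
  congr 3
  refine ContinuousMap.ext fun y => ?_
  change Fin.cons y.2 y.1 = slot (single 0) (Fin.cons basePt y.1, y.2)
  rw [slot_single, Fin.update_cons_zero]

theorem consPt_listClass (l : List (Fin n)) :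
    HTotMap (consPt n) (listClass l) = listClass (l.map Fin.succ) := by
  induction l with
  | nil => exact consPt_ptClass
  | cons v l ih =>
    change HTotMap (consPt n) (sphereOp v (listClass l)) =
      sphereOp v.succ (listClass (l.map Fin.succ))
    rw [consPt_sphereOp, ih]

theorem consPt_setClass (U : Finset (Fin n)) :
    HTotMap (consPt n) (setClass U) = setClass (U.map (Fin.succEmb n)) := by
  rw [setClass, consPt_listClass]
  refine listClass_perm ((List.perm_ext_iff_of_nodup ?_ (Finset.nodup_toList _)).2 fun v => ?_)
  · exact U.nodup_toList.map (Fin.succ_injective n)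
  · simp

theorem zero_notMem_map_succ (U : Finset (Fin n)) : (0 : Fin (n + 1)) ∉ U.map (Fin.succEmb n) := by
  simp

theorem consMap_crossH_setClass (U : Finset (Fin n)) :
    -HTotMap (consMap n) (crossH _ (setClass U)) = setClass (insert 0 (U.map (Fin.succEmb n))) := by
  rw [consMap_crossH, consPt_setClass, setClass_insert (zero_notMem_map_succ U)]

/-- The homology of `(S²)^(n+1)` as the sum of two copies of the homology of `(S²)^n`. -/
def consEquiv (n : ℕ) : (HTot (Fin n → S2) × HTot (Fin n → S2)) ≃ₗ[ℂ] HTot (Fin (n + 1) → S2) :=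
  ((LinearEquiv.refl ℂ _).prodCongr (LinearEquiv.neg ℂ)).trans
    ((LinearEquiv.ofBijective _ (productMap_bijective _)).trans
      (LinearEquiv.ofBijective _ (consMap_bijective n)))

theorem consEquiv_apply (x y : HTot (Fin n → S2)) : consEquiv n (x, y) =
    HTotMap (consPt n) x - HTotMap (consMap n) (crossH _ y) := by
  change HTotMap (consMap n) (HTotMap (atPoint _ basePt) x + crossH _ (-y)) = _
  rw [map_add, map_neg, map_neg, HTotMap_comp, sub_eq_add_neg]
  rfl

/-- Sets of vertices without or with the first vertex. -/
def finsetConsEquiv (n : ℕ) : Finset (Fin n) ⊕ Finset (Fin n) ≃ Finset (Fin (n + 1)) where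
  toFun s := s.elim (fun U => U.map (Fin.succEmb n)) (fun U => insert 0 (U.map (Fin.succEmb n)))
  invFun V := if 0 ∈ V then .inr (Finset.univ.filter fun v => v.succ ∈ V)
    else .inl (Finset.univ.filter fun v => v.succ ∈ V)
  left_inv s := by
    cases s with
    | inl U => simp
    | inr U =>
      simp [Fin.succ_ne_zero]
  right_inv V := by
    by_cases h : 0 ∈ V
    · simp only [h, if_true, Sum.elim_inr]
      ext v
      refine Fin.cases ?_ (fun v => ?_) v <;> simp [h, Fin.succ_ne_zero]
    · simp only [h, if_false, Sum.elim_inl]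
      ext v
      refine Fin.cases ?_ (fun v => ?_) v <;> simp [h]

/-- The iterated cross products form a basis: the homology of `(S²)^(n+1)` is the sum of two copies
of the homology of `(S²)^n`, one for the sets without and one for the sets with the first vertex. -/
theorem exists_basis_setClass (n : ℕ) :
    ∃ B : Module.Basis (Finset (Fin n)) ℂ (HTot (Fin n → S2)), ∀ U, B U = setClass U := by
  induction n with
  | zero =>
    have hU : ∀ U : Finset (Fin 0), setClass U = ptClass default := by
      intro U
      rw [Finset.eq_empty_of_isEmpty U, setClass, Finset.toList_empty]
      exact congrArg ptClass (Subsingleton.elim _ _)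
    refine ⟨Module.Basis.mk (v := fun U => setClass U) ?_ ?_, fun U => Module.Basis.mk_apply _ _ U⟩
    · rw [linearIndependent_unique_iff, hU]
      exact ptClass_ne_zero _
    · rintro x -
      obtain ⟨r, rfl⟩ := exists_eq_smul_ptClass x
      rw [← hU ∅]
      exact Submodule.smul_mem _ _ (Submodule.subset_span ⟨∅, rfl⟩)
  | succ n ih =>
    obtain ⟨B, hB⟩ := ih
    refine ⟨((B.prod B).map (consEquiv n)).reindex (finsetConsEquiv n), fun V => ?_⟩
    obtain ⟨s, rfl⟩ := (finsetConsEquiv n).surjective V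
    rw [Module.Basis.reindex_apply, Equiv.symm_apply_apply, Module.Basis.map_apply]
    cases s with
    | inl U =>
      rw [Module.Basis.prod_apply, Sum.elim_inl, Function.comp_apply, LinearMap.inl_apply,
        consEquiv_apply, hB, map_zero, map_zero, sub_zero, consPt_setClass]
      rfl
    | inr U =>
      rw [Module.Basis.prod_apply, Sum.elim_inr, Function.comp_apply, LinearMap.inr_apply,
        consEquiv_apply, hB, map_zero, zero_sub, consMap_crossH_setClass]
      rfl

end Basis

/-! ### The classes of the diagonal spheres of arcs -/

section Arcs
variable {n : ℕ}

/-- The slot of an arc: the antipodal map at the first end, the identity at the second. -/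
def arcSlot (e : Fin n × Fin n) : Fin n → Option C(S2, S2) := fun v =>
  if v = e.1 then some antipode else if v = e.2 then some (.id S2) else none

/-- The slot of an arc with the signs exchanged. -/
def revSlot (e : Fin n × Fin n) : Fin n → Option C(S2, S2) := fun v =>
  if v = e.1 then some (.id S2) else if v = e.2 then some antipode else none

/-- The map that replaces one coordinate by the base point. -/
def resetAt (v : Fin n) : C(Fin n → S2, Fin n → S2) :=
  ⟨fun x => Function.update x v basePt, by fun_prop⟩

theorem revSlot_cellOp (e : Fin n × Fin n) (x : HTot (Fin n → S2)) :
    cellOp (revSlot e) x = -cellOp (arcSlot e) x := by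
  have h : slot (revSlot e) = (slot (arcSlot e)).comp ((ContinuousMap.id _).prodMap antipode) := by
    refine ContinuousMap.ext fun y => funext fun v => ?_
    simp only [slot, revSlot, arcSlot, ContinuousMap.coe_mk, ContinuousMap.comp_apply]
    split_ifs
    · exact (neg_neg y.2).symm
    · rfl
    · rfl
  rw [cellOp_apply, cellOp_apply, h, ← HTotMap_comp, antipode_crossH, map_neg]

/-- The antidiagonal sphere of an arc is the difference of the spheres at its two ends, on classes
that live over the base point in the coordinates of both ends. -/
theorem arcSlot_cellOp {e : Fin n × Fin n} (he : e.1 ≠ e.2) {x : HTot (Fin n → S2)}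
    (h1 : HTotMap (resetAt e.1) x = x) (h2 : HTotMap (resetAt e.2) x = x) :
    cellOp (arcSlot e) x = sphereOp e.2 x - sphereOp e.1 x := by
  set D : C(((Fin n → S2) × S2) × S2, Fin n → S2) :=
    (slot (single e.2)).comp ((slot (single e.1)).prodMap (.id S2)) with hD
  have h : slot (arcSlot e) = D.comp (antidiag _) := by
    refine ContinuousMap.ext fun y => ?_
    change _ = slot (single e.2) (slot (single e.1) (y.1, -y.2), y.2)
    rw [slot_single, slot_single]
    funext v
    simp only [slot, arcSlot, ContinuousMap.coe_mk, Function.update_apply]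
    by_cases hv1 : v = e.1
    · have hv2 : v ≠ e.2 := fun h => he (hv1.symm.trans h)
      simp only [hv1, he, if_true, if_false]
      rfl
    · by_cases hv2 : v = e.2
      · simp only [hv2, he.symm, if_true, if_false]
        rfl
      · simp only [hv1, hv2, if_false]
        rfl
  have e1 : HTotMap D (HTotMap (atPoint _ basePt) (crossH _ x)) =
      HTotMap (slot (single e.1)) (crossH _ x) := by
    nth_rewrite 2 [← h2]
    rw [crossH_HTotMap, HTotMap_comp, HTotMap_comp]
    congr 2
    refine ContinuousMap.ext fun y => ?_
    change slot (single e.2) (slot (single e.1) y, basePt) =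
      slot (single e.1) (Function.update y.1 e.2 basePt, y.2)
    rw [slot_single, slot_single, slot_single]
    exact Function.update_comm he _ _ _
  have e2 : HTotMap D (crossH _ (HTotMap (atPoint _ basePt) x)) =
      HTotMap (slot (single e.2)) (crossH _ x) := by
    nth_rewrite 2 [← h1]
    rw [crossH_HTotMap, HTotMap_comp, crossH_HTotMap, HTotMap_comp]
    congr 2
    refine ContinuousMap.ext fun y => ?_
    change slot (single e.2) (slot (single e.1) (y.1, basePt), y.2) =
      slot (single e.2) (Function.update y.1 e.1 basePt, y.2)
    rw [slot_single (v := e.1)]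
  rw [cellOp_apply, cellOp_apply, cellOp_apply, h, ← HTotMap_comp, antidiag_crossH, map_add,
    map_neg,
    e1, e2]
  abel

theorem resetAt_sphereOp {v w : Fin n} (h : v ≠ w) {x : HTot (Fin n → S2)}
    (hx : HTotMap (resetAt v) x = x) : HTotMap (resetAt v) (sphereOp w x) = sphereOp w x := by
  rw [cellOp_apply, map_neg]
  nth_rewrite 2 [← hx]
  rw [crossH_HTotMap, HTotMap_comp, HTotMap_comp]
  congr 3
  refine ContinuousMap.ext fun y => ?_
  change Function.update (slot (single w) y) v basePt =
    slot (single w) (Function.update y.1 v basePt, y.2)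
  rw [slot_single, slot_single]
  exact Function.update_comm h.symm _ _ _

theorem resetAt_setClass (U : Finset (Fin n)) {v : Fin n} (h : v ∉ U) :
    HTotMap (resetAt v) (setClass U) = setClass U := by
  have : ∀ l : List (Fin n), v ∉ l → HTotMap (resetAt v) (listClass l) = listClass l := by
    intro l
    induction l with
    | nil =>
      intro _
      refine (HTotMap_ptClass _ _).trans (congrArg ptClass ?_)
      exact Function.update_eq_self v _
    | cons w l ih =>
      intro hv
      rw [List.mem_cons, not_or] at hv
      exact resetAt_sphereOp hv.1 (ih hv.2)
  exact this _ fun h' => h (Finset.mem_toList.1 h')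

/-- The sets that consist of exactly one endpoint of each arc in a set of arcs. -/
def transversals (es : Finset (Fin n × Fin n)) : Finset (Finset (Fin n)) :=
  {U | (∀ v ∈ U, ∃ e ∈ es, v = e.1 ∨ v = e.2) ∧ ∀ e ∈ es, (e.1 ∈ U ↔ e.2 ∉ U)}

theorem mem_transversals {es : Finset (Fin n × Fin n)} {U : Finset (Fin n)} :
    U ∈ transversals es ↔ (∀ v ∈ U, ∃ e ∈ es, v = e.1 ∨ v = e.2) ∧
      ∀ e ∈ es, (e.1 ∈ U ↔ e.2 ∉ U) := by
  simp [transversals]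

theorem undotSets_eq (M : DottedMatching n) : M.undotSets = transversals M.undotted := rfl

theorem transversals_empty : transversals (∅ : Finset (Fin n × Fin n)) = {∅} := by
  ext U
  simp [mem_transversals, Finset.eq_empty_iff_forall_notMem]

theorem transversals_insert {e : Fin n × Fin n} {es : Finset (Fin n × Fin n)} (he : e.1 ≠ e.2)
    (hd : ∀ e' ∈ es, e.1 ≠ e'.1 ∧ e.1 ≠ e'.2 ∧ e.2 ≠ e'.1 ∧ e.2 ≠ e'.2) :
    transversals (insert e es) =
      (transversals es).image (insert e.1) ∪ (transversals es).image (insert e.2) := by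
  have key : ∀ v w, (v = e.1 ∧ w = e.2 ∨ v = e.2 ∧ w = e.1) → ∀ V : Finset (Fin n),
      (V ∈ transversals (insert e es) ∧ v ∈ V) ↔ V ∈ (transversals es).image (insert v) := by
    intro v w hvw V
    have hvw' : v ≠ w := by
      rcases hvw with ⟨rfl, rfl⟩ | ⟨rfl, rfl⟩
      exacts [he, he.symm]
    have hv' : ∀ e' ∈ es, v ≠ e'.1 ∧ v ≠ e'.2 ∧ w ≠ e'.1 ∧ w ≠ e'.2 := by
      intro e' he'
      have := hd e' he'
      rcases hvw with ⟨rfl, rfl⟩ | ⟨rfl, rfl⟩ <;> tauto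
    have hee : ∀ u, (u = e.1 ∨ u = e.2) ↔ (u = v ∨ u = w) := by
      intro u
      rcases hvw with ⟨rfl, rfl⟩ | ⟨rfl, rfl⟩ <;> tauto
    have hes : ∀ V : Finset (Fin n), (e.1 ∈ V ↔ e.2 ∉ V) ↔ (v ∈ V ↔ w ∉ V) := by
      intro V
      rcases hvw with ⟨rfl, rfl⟩ | ⟨rfl, rfl⟩ <;> tauto
    simp only [mem_transversals, Finset.mem_image, Finset.forall_mem_insert,
      Finset.exists_mem_insert,
      hee, hes]
    constructor
    · rintro ⟨⟨h1, h2, h3⟩, hv⟩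
      have hw : w ∉ V := h2.1 hv
      refine ⟨V.erase v, ⟨fun u hu => ?_, fun e' he' => ?_⟩, Finset.insert_erase hv⟩
      · rw [Finset.mem_erase] at hu
        refine (h1 u hu.2).resolve_left ?_
        rintro (h | h)
        exacts [hu.1 h, hw (h ▸ hu.2)]
      · have h4 := hv' e' he'
        rw [Finset.mem_erase, Finset.mem_erase, h3 e' he']
        have := h4.1.symm
        have := h4.2.1.symm
        tauto
    · rintro ⟨U, ⟨h1, h2⟩, rfl⟩
      have hw : w ∉ U := fun h => by
        obtain ⟨e', he', h'⟩ := h1 w h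
        have := hv' e' he'
        tauto
      refine ⟨⟨fun u hu => ?_, ?_, fun e' he' => ?_⟩, Finset.mem_insert_self v U⟩
      · rcases Finset.mem_insert.1 hu with h | h
        exacts [.inl (.inl h), .inr (h1 u h)]
      · simp [hw, hvw'.symm]
      · have h4 := hv' e' he'
        have h5 := h4.1.symm
        have h6 := h4.2.1.symm
        simp only [Finset.mem_insert, h5, h6, false_or]
        exact h2 e' he'
  ext V
  rw [Finset.mem_union, ← key e.1 e.2 (.inl ⟨rfl, rfl⟩), ← key e.2 e.1 (.inr ⟨rfl, rfl⟩),
    ← and_or_left]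
  refine ⟨fun h => ⟨h, ?_⟩, fun h => h.1⟩
  have := (mem_transversals.1 h).2 e (Finset.mem_insert_self e es)
  tauto

theorem notMem_of_mem_transversals {es : Finset (Fin n × Fin n)} {U : Finset (Fin n)}
    (hU : U ∈ transversals es) {v : Fin n} (h : ∀ e ∈ es, v ≠ e.1 ∧ v ≠ e.2) : v ∉ U := fun hv => by
  obtain ⟨e, he, h'⟩ := (mem_transversals.1 hU).1 v hv
  have := h e he
  tauto

end Arcs

/-! ### Matchings -/

section Matchings
variable {n : ℕ}

theorem Matching.arc_mem (a : Matching n) (v : Fin n) : a.arc v ∈ a.arcs :=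
  (a.existsUnique_arc v).choose_spec.1.1

theorem Matching.eq_or_eq (a : Matching n) (v : Fin n) : v = (a.arc v).1 ∨ v = (a.arc v).2 :=
  (a.existsUnique_arc v).choose_spec.1.2

theorem Matching.arc_fst (a : Matching n) {e : Fin n × Fin n} (he : e ∈ a.arcs) : a.arc e.1 = e :=
  a.arc_eq he (.inl rfl)

theorem Matching.arc_snd (a : Matching n) {e : Fin n × Fin n} (he : e ∈ a.arcs) : a.arc e.2 = e :=
  a.arc_eq he (.inr rfl)

theorem Matching.ne_of_ne (a : Matching n) {e e' : Fin n × Fin n} (he : e ∈ a.arcs)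
    (he' : e' ∈ a.arcs) (h : e ≠ e') :
    e.1 ≠ e'.1 ∧ e.1 ≠ e'.2 ∧ e.2 ≠ e'.1 ∧ e.2 ≠ e'.2 := by
  refine ⟨fun h' => h ?_, fun h' => h ?_, fun h' => h ?_, fun h' => h ?_⟩
  · rw [← a.arc_fst he, h', a.arc_fst he']
  · rw [← a.arc_fst he, h', a.arc_snd he']
  · rw [← a.arc_snd he, h', a.arc_fst he']
  · rw [← a.arc_snd he, h', a.arc_snd he']

theorem Matching.not_exists_fst_eq_snd (a : Matching n) {e : Fin n × Fin n} (he : e ∈ a.arcs) :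
    ¬ ∃ e' ∈ a.arcs, e.2 = e'.1 := by
  rintro ⟨e', he', h⟩
  have : e = e' := by rw [← a.arc_snd he, h, a.arc_fst he']
  subst this
  exact (a.lt e he).ne' h

/-- The other endpoint of the arc through a vertex. -/
def Matching.partner (a : Matching n) (v : Fin n) : Fin n :=
  if v = (a.arc v).1 then (a.arc v).2 else (a.arc v).1

theorem Matching.partner_fst (a : Matching n) {e : Fin n × Fin n} (he : e ∈ a.arcs) :
    a.partner e.1 = e.2 := by
  rw [partner, a.arc_fst he, if_pos rfl]

theorem Matching.partner_snd (a : Matching n) {e : Fin n × Fin n} (he : e ∈ a.arcs) :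
    a.partner e.2 = e.1 := by
  rw [partner, a.arc_snd he, if_neg (a.lt e he).ne']

theorem Matching.exists_arc (a : Matching n) (v : Fin n) : ∃ e ∈ a.arcs, v = e.1 ∨ v = e.2 :=
  ⟨a.arc v, a.arc_mem v, a.eq_or_eq v⟩

theorem Matching.partner_partner (a : Matching n) (v : Fin n) : a.partner (a.partner v) = v := by
  obtain ⟨e, he, rfl | rfl⟩ := a.exists_arc v
  · rw [a.partner_fst he, a.partner_snd he]
  · rw [a.partner_snd he, a.partner_fst he]

theorem Matching.arc_partner (a : Matching n) (v : Fin n) : a.arc (a.partner v) = a.arc v := by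
  obtain ⟨e, he, rfl | rfl⟩ := a.exists_arc v
  · rw [a.partner_fst he, a.arc_fst he, a.arc_snd he]
  · rw [a.partner_snd he, a.arc_fst he, a.arc_snd he]

theorem Matching.partner_ne (a : Matching n) (v : Fin n) : a.partner v ≠ v := by
  obtain ⟨e, he, rfl | rfl⟩ := a.exists_arc v
  · rw [a.partner_fst he]
    exact (a.lt e he).ne'
  · rw [a.partner_snd he]
    exact (a.lt e he).ne

theorem Matching.arc_of_lt_partner (a : Matching n) {v : Fin n} (h : v < a.partner v) :
    a.arc v = (v, a.partner v) := by
  obtain ⟨e, he, rfl | rfl⟩ := a.exists_arc v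
  · rw [a.partner_fst he, a.arc_fst he]
  · rw [a.partner_snd he] at h
    exact (lt_asymm h (a.lt e he)).elim

/-- The arc through a vertex below an arc is nested below that arc. -/
theorem Matching.arc_nested (a : Matching n) {e : Fin n × Fin n} (he : e ∈ a.arcs) {v : Fin n}
    (h1 : e.1 < v) (h2 : v < e.2) : e.1 < (a.arc v).1 ∧ (a.arc v).2 < e.2 := by
  have hm := a.arc_mem v
  have hne : a.arc v ≠ e := by
    intro h
    rcases a.eq_or_eq v with h' | h' <;> rw [h] at h'
    exacts [h1.ne' h', h2.ne h']
  have hd := a.ne_of_ne hm he hne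
  have hl := a.lt _ hm
  have n1 := a.noncrossing _ hm e he
  have n2 := a.noncrossing e he _ hm
  rcases a.eq_or_eq v with h' | h'
  · rw [h'] at h1 h2
    rw [← h'] at h1 h2
    refine ⟨h' ▸ h1, lt_of_not_ge fun h => n2 ⟨h' ▸ h1, h' ▸ h2, lt_of_le_of_ne h hd.2.2.2.symm⟩⟩
  · refine ⟨lt_of_not_ge fun h => n1 ⟨lt_of_le_of_ne h hd.1, h' ▸ h1, h' ▸ h2⟩, h' ▸ h2⟩

theorem Matching.partner_nested (a : Matching n) {e : Fin n × Fin n} (he : e ∈ a.arcs) {v : Fin n}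
    (h1 : e.1 < v) (h2 : v < e.2) : e.1 < a.partner v ∧ a.partner v < e.2 := by
  have := a.arc_nested he h1 h2
  obtain ⟨e', he', rfl | rfl⟩ := a.exists_arc v
  · rw [a.arc_fst he'] at this
    rw [a.partner_fst he']
    exact ⟨h1.trans (a.lt e' he'), this.2⟩
  · rw [a.arc_snd he'] at this
    rw [a.partner_snd he']
    exact ⟨this.1, (a.lt e' he').trans h2⟩

/-- The vertices below an arc are matched among themselves, so that the endpoints of the arc have
different parity. -/
theorem Matching.even_iff (a : Matching n) {e : Fin n × Fin n} (he : e ∈ a.arcs) :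
    Even (e.1 : ℕ) ↔ ¬ Even (e.2 : ℕ) := by
  have hlt := a.lt e he
  have hcard : ((Finset.Ioo e.1 e.2).card : ZMod 2) = 0 := by
    rw [Finset.card_eq_sum_ones, Nat.cast_sum]
    refine Finset.sum_involution (fun v _ => a.partner v) (fun v _ => by decide)
      (fun v _ _ => a.partner_ne v) (fun v hv => ?_) (fun v _ => a.partner_partner v)
    rw [Finset.mem_Ioo] at hv ⊢
    exact a.partner_nested he hv.1 hv.2
  rw [ZMod.natCast_eq_zero_iff_even, Fin.card_Ioo] at hcard
  rw [Fin.lt_def] at hlt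
  obtain ⟨c, hc⟩ := hcard
  rw [Nat.even_iff, Nat.even_iff]
  omega

end Matchings

/-! ### The images of the homology generators -/

section Images
variable {n : ℕ}

theorem HTotMap_lof_cubeClass {X Y : Type} [TopologicalSpace X] [TopologicalSpace Y] {m : ℕ}
    (g : C(X, Y)) (f : C(Fin m → I, X)) (hf : IsClosedCube f) :
    HTotMap g (DirectSum.lof ℂ ℕ (fun d => H X d) m (cubeClass f hf)) =
      DirectSum.lof ℂ ℕ (fun d => H Y d) m
        (cubeClass (g.comp f) fun t i => congrArg g (hf t i)) := by
  obtain ⟨h1, e1⟩ := lof_cubeClass f hf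
  obtain ⟨h2, e2⟩ := lof_cubeClass (g.comp f) fun t i => congrArg g (hf t i)
  rw [e1, e2, HTotMap_cls]
  exact cls_congr (push_comp _ _ _) _ _

/-- All points of the product of spheres have the same class. -/
theorem ptClass_eq (x y : Fin n → S2) : ptClass x = ptClass y := by
  have : PathConnectedSpace S2 := isPathConnected_iff_pathConnectedSpace.1
    (isPathConnected_sphere (by
      rw [← Module.finrank_eq_rank, finrank_euclideanSpace_fin]
      norm_num) _ zero_le_one)
  obtain ⟨γ⟩ := PathConnectedSpace.joined y x
  have h := HTotMap_homotopy (X := Unit) (Y := Fin n → S2) ⟨fun t => γ t.2, by fun_prop⟩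
    (ptClass ())
  rw [HTotMap_ptClass, HTotMap_ptClass] at h
  have h1 : γ 1 = x := γ.target
  have h0 : γ 0 = y := γ.source
  exact (congrArg ptClass h1.symm).trans (h.trans (congrArg ptClass h0))

/-- The slots of an arc with prescribed signs at its endpoints. -/
def signSlot (s : Fin n → Prop) [DecidablePred s] (e : Fin n × Fin n) : Fin n → Option C(S2, S2) :=
  if s e.1 then arcSlot e else revSlot e

theorem signSlot_apply_fst (s : Fin n → Prop) [DecidablePred s] (e : Fin n × Fin n) :
    signSlot s e e.1 = some (if s e.1 then antipode else .id S2) := by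
  unfold signSlot
  split_ifs <;> simp [arcSlot, revSlot]

theorem signSlot_apply_snd (s : Fin n → Prop) [DecidablePred s] {e : Fin n × Fin n}
    (h : e.1 ≠ e.2) (hs : s e.1 ↔ ¬ s e.2) :
    signSlot s e e.2 = some (if s e.2 then antipode else .id S2) := by
  unfold signSlot
  by_cases h1 : s e.1
  · simp [h1, hs.1 h1, arcSlot, h.symm]
  · simp [h1, not_not.1 (mt hs.2 h1), revSlot, h.symm]

theorem signSlot_apply_of_ne (s : Fin n → Prop) [DecidablePred s] {e : Fin n × Fin n} {v : Fin n}
    (h1 : v ≠ e.1) (h2 : v ≠ e.2) : signSlot s e v = none := by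
  unfold signSlot
  split_ifs <;> simp [arcSlot, revSlot, h1, h2]

theorem signSlot_cellOp (s : Fin n → Prop) [DecidablePred s] (e : Fin n × Fin n)
    (x : HTot (Fin n → S2)) :
    cellOp (signSlot s e) x = (if s e.1 then (1 : ℂ) else -1) • cellOp (arcSlot e) x := by
  unfold signSlot
  split_ifs
  · rw [one_smul]
  · rw [revSlot_cellOp, neg_one_smul]

/-- The expansion of the product of the diagonal spheres of some arcs into line diagrams. -/
theorem foldr_signSlot (M : DottedMatching n) (s : Fin n → Prop) [DecidablePred s]
    (es : List (Fin n × Fin n)) (hn : es.Nodup) (hes : ∀ e ∈ es, e ∈ M.arcs) :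
    es.foldr (fun e x => cellOp (signSlot s e) x) (ptClass fun _ => basePt) =
      (es.map fun e => if s e.1 then (1 : ℂ) else -1).prod •
        ∑ U ∈ transversals es.toFinset, (-1 : ℂ) ^ M.leftCount U • setClass U := by
  induction es with
  | nil =>
    simp [transversals_empty, DottedMatching.leftCount, setClass, listClass]
  | cons e es ih =>
    rw [List.nodup_cons] at hn
    have he := hes e List.mem_cons_self
    have hlt := (M.lt e he).ne
    have hd : ∀ e' ∈ es.toFinset, e.1 ≠ e'.1 ∧ e.1 ≠ e'.2 ∧ e.2 ≠ e'.1 ∧ e.2 ≠ e'.2 := by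
      intro e' he'
      rw [List.mem_toFinset] at he'
      exact M.ne_of_ne he (hes e' (List.mem_cons_of_mem _ he')) fun h => hn.1 (h ▸ he')
    have hU1 : ∀ U ∈ transversals es.toFinset, e.1 ∉ U := fun U hU =>
      notMem_of_mem_transversals hU fun e' he' => ⟨(hd e' he').1, (hd e' he').2.1⟩
    have hU2 : ∀ U ∈ transversals es.toFinset, e.2 ∉ U := fun U hU =>
      notMem_of_mem_transversals hU fun e' he' => ⟨(hd e' he').2.2.1, (hd e' he').2.2.2⟩
    have hdisj : Disjoint ((transversals es.toFinset).image (insert e.1))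
        ((transversals es.toFinset).image (insert e.2)) := by
      rw [Finset.disjoint_left]
      intro V h1 h2
      obtain ⟨U1, hU1', rfl⟩ := Finset.mem_image.1 h1
      obtain ⟨U2, hU2', h⟩ := Finset.mem_image.1 h2
      have : e.1 ∈ insert e.2 U2 := h ▸ Finset.mem_insert_self _ _
      rcases Finset.mem_insert.1 this with h | h
      exacts [hlt h, hU1 _ hU2' h]
    have hinj : ∀ v, (∀ U ∈ transversals es.toFinset, v ∉ U) →
        Set.InjOn (insert v) (transversals es.toFinset : Set (Finset (Fin n))) := by
      intro v hv U hU U' hU' h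
      rw [← Finset.erase_insert (hv U hU), h, Finset.erase_insert (hv U' hU')]
    have hc1 : ∀ U ∈ transversals es.toFinset, M.leftCount (insert e.1 U) = M.leftCount U + 1 := by
      intro U hU
      rw [DottedMatching.leftCount, Finset.filter_insert, if_pos ⟨e, he, rfl⟩,
        Finset.card_insert_of_notMem fun h => hU1 U hU (Finset.mem_filter.1 h).1]
      rfl
    have hc2 : ∀ U, M.leftCount (insert e.2 U) = M.leftCount U := by
      intro U
      rw [DottedMatching.leftCount, Finset.filter_insert, if_neg (M.not_exists_fst_eq_snd he)]
      rfl
    rw [List.foldr_cons, ih hn.2 fun e' he' => hes e' (List.mem_cons_of_mem _ he'), map_smul,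
      signSlot_cellOp, List.map_cons, List.prod_cons, List.toFinset_cons,
      transversals_insert hlt hd, Finset.sum_union hdisj, Finset.sum_image (hinj _ hU1),
      Finset.sum_image (hinj _ hU2), smul_smul, mul_comm, ← Finset.sum_add_distrib, map_sum]
    congr 1
    refine Finset.sum_congr rfl fun U hU => ?_
    rw [map_smul, arcSlot_cellOp hlt (resetAt_setClass U (hU1 U hU))
      (resetAt_setClass U (hU2 U hU)),
      hc1 U hU, hc2, setClass_insert (hU1 U hU), setClass_insert (hU2 U hU), pow_succ, mul_neg_one,
      neg_smul, smul_sub]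
    abel

/-- The image of the class of a dotted matching under a map that applies the antipodal map in one
coordinate of each arc. -/
theorem HTotMap_homologyClass (M : DottedMatching n) (s : Fin n → Prop) [DecidablePred s]
    (hs : ∀ e ∈ M.arcs, (s e.1 ↔ ¬ s e.2)) (g : C(M.component, Fin n → S2))
    (hg : ∀ x v, g x v = if s v then -x.1 v else x.1 v) :
    HTotMap g M.homologyClass =
      (∏ e ∈ M.undotted, if s e.1 then (1 : ℂ) else -1) • M.lineDiagramSum := by
  have hund : ∀ e ∈ M.undotted, e ∈ M.arcs := fun e he => (Finset.mem_sdiff.1 he).1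
  set r := M.rightUndot.orderEmbOfFin rfl with hr
  set φ : Fin M.rightUndot.card → Fin n × Fin n := fun j => M.arc (r j) with hφ
  have hφ2 : ∀ j, φ j ∈ M.undotted ∧ (φ j).2 = r j := by
    intro j
    obtain ⟨e, he, h⟩ := Finset.mem_image.1 (M.rightUndot.orderEmbOfFin_mem rfl j)
    have : φ j = e := by
      rw [hφ, hr]
      change M.arc _ = e
      rw [← h, M.arc_snd (hund e he)]
    rw [this]
    exact ⟨he, h⟩
  have hφinj : Function.Injective φ := fun i j h => r.injective (by
    rw [← (hφ2 i).2, h, (hφ2 j).2])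
  have hφset : (List.ofFn φ).toFinset = M.undotted := by
    ext e
    rw [List.mem_toFinset, List.mem_ofFn]
    constructor
    · rintro ⟨j, rfl⟩
      exact (hφ2 j).1
    · intro he
      have : e.2 ∈ M.rightUndot := Finset.mem_image_of_mem _ he
      rw [← Finset.mem_coe, ← Finset.range_orderEmbOfFin M.rightUndot rfl] at this
      obtain ⟨j, hj⟩ := this
      refine ⟨j, ?_⟩
      rw [hφ, hr]
      change M.arc _ = e
      rw [hj, M.arc_snd (hund e he)]
  have hnodup : (List.ofFn φ).Nodup := List.nodup_ofFn.2 hφinj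
  refine (HTotMap_lof_cubeClass g M.cell fun t i => Subtype.ext (prodCell_closed _ t i)).trans ?_
  refine (lof_cubeClass_eq_foldr (fun v => if s v then -basePt else basePt)
    (fun j => signSlot s (φ j)) _ _ fun t v => ?_).trans ?_
  · have hcell : (M.cell t).1 v = ((position M.rightUndot (M.arc v).2).elim basePt fun j =>
        twoCell (t ⟨2 * j, by omega⟩, t ⟨2 * j + 1, by omega⟩)) := rfl
    rw [ContinuousMap.comp_apply, hg, hcell]
    have hm := M.arc_mem v
    by_cases hv : (M.arc v).2 ∈ M.rightUndot
    · obtain ⟨j, hj⟩ : ∃ j, r j = (M.arc v).2 := by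
        rw [← Set.mem_range, hr, Finset.range_orderEmbOfFin]
        exact hv
      have hpos : position M.rightUndot (M.arc v).2 = some j := by
        rw [position, dif_pos hv]
        congr 1
        rw [OrderIso.symm_apply_eq]
        exact Subtype.ext hj.symm
      have hφj : φ j = M.arc v := by
        rw [hφ]
        change M.arc (r j) = _
        rw [hj, M.arc_snd hm]
      have hsl : signSlot s (φ j) v = some (if s v then antipode else .id S2) := by
        rw [hφj]
        obtain ⟨w, hw⟩ : ∃ w, w = v := ⟨v, rfl⟩
        rcases M.eq_or_eq v with h | h
        · nth_rewrite 2 [h]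
          rw [signSlot_apply_fst, ← h]
        · nth_rewrite 2 [h]
          rw [signSlot_apply_snd s (M.lt _ hm).ne (hs _ hm), ← h]
      rw [hpos, cubeMap_apply_some _ (fun j => signSlot s (φ j)) t v j _ hsl fun i hi => ?_]
      · rw [Option.elim_some]
        split_ifs <;> rfl
      · have hne := M.ne_of_ne hm (hund _ (hφ2 i).1) fun h => hi (hφinj (h.symm.trans hφj.symm))
        rcases M.eq_or_eq v with h | h <;> rw [h]
        exacts [signSlot_apply_of_ne s hne.1 hne.2.1, signSlot_apply_of_ne s hne.2.2.1 hne.2.2.2]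
    · rw [position, dif_neg hv, Option.elim_none,
        cubeMap_apply_none _ (fun j => signSlot s (φ j)) t v fun j => ?_]
      have hne := M.ne_of_ne hm (hund _ (hφ2 j).1) fun h => hv (by
        rw [h]
        exact Finset.mem_image_of_mem _ (hφ2 j).1)
      rcases M.eq_or_eq v with h | h <;> rw [h]
      exacts [signSlot_apply_of_ne s hne.1 hne.2.1, signSlot_apply_of_ne s hne.2.2.1 hne.2.2.2]
  · have h1 : (List.ofFn fun j => signSlot s (φ j)) = (List.ofFn φ).map (signSlot s) := by
      rw [List.map_ofFn]
      rfl
    have h2 : ∀ e ∈ List.ofFn φ, e ∈ M.arcs := by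
      intro e he
      rw [← List.mem_toFinset, hφset] at he
      exact hund e he
    rw [ptClass_eq _ fun _ => basePt, h1, List.foldr_map, foldr_signSlot M s _ hnodup h2,
      ← List.prod_toFinset _ hnodup, hφset, DottedMatching.lineDiagramSum, undotSets_eq]
    simp only [lineDiagram_eq_setClass]

/-- The class of a dotted matching is mapped to its line diagram sum. -/
theorem gammaMap_homologyClass (M : DottedMatching n) :
    HTotMap M.gammaMap M.homologyClass = M.lineDiagramSum := by
  classical
  rw [HTotMap_homologyClass M (fun v => ∃ e ∈ M.arcs, v = e.1)
    (fun e he => iff_of_true ⟨e, he, rfl⟩ (M.not_exists_fst_eq_snd he)) _ fun x v => ?_,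
    Finset.prod_eq_one fun e he => if_pos ⟨e, (Finset.mem_sdiff.1 he).1, rfl⟩, one_smul]
  simp only [Matching.gammaMap, ContinuousMap.coe_mk]

/-- Under the alternating antipodal map each undotted arc contributes a sign, depending on which of
its endpoints, which have different parity, carries the antipodal map. -/
theorem gammaMap_incl_homologyClass (M : DottedMatching n) :
    HTotMap (gammaMap n) (HTotMap M.incl M.homologyClass) = M.lineDiagramSum ∨
      HTotMap (gammaMap n) (HTotMap M.incl M.homologyClass) = -M.lineDiagramSum := by
  rw [HTotMap_comp, HTotMap_homologyClass M (fun v => Even (v : ℕ)) (fun e he => M.even_iff he) _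
    fun x v => ?_]
  · have : (∏ e ∈ M.undotted, if Even (e.1 : ℕ) then (1 : ℂ) else -1) = 1 ∨
        (∏ e ∈ M.undotted, if Even (e.1 : ℕ) then (1 : ℂ) else -1) = -1 := by
      refine Finset.prod_induction _ (fun c : ℂ => c = 1 ∨ c = -1) ?_ (.inl rfl) fun e _ => ?_
      · rintro _ _ (rfl | rfl) (rfl | rfl) <;> simp
      · split_ifs <;> simp
    rcases this with h | h <;> rw [h] <;> simp
  · change (if Even ((v : ℕ) + 1) then x.1 v else -x.1 v) = _
    by_cases h : Even (v : ℕ) <;> simp [h, Nat.even_add_one]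

end Images

/-! ### Unitriangularity -/

section Triangular
variable {n : ℕ}

theorem DottedMatching.undotted_subset (M : DottedMatching n) {e : Fin n × Fin n}
    (he : e ∈ M.undotted) : e ∈ M.arcs := (Finset.mem_sdiff.1 he).1

theorem DottedMatching.rightUndot_mem_undotSets (M : DottedMatching n) :
    M.rightUndot ∈ M.undotSets := by
  rw [undotSets_eq, mem_transversals]
  refine ⟨fun v hv => ?_, fun e he => ?_⟩
  · obtain ⟨e, he, rfl⟩ := Finset.mem_image.1 hv
    exact ⟨e, he, .inr rfl⟩
  · refine iff_of_false (fun h => ?_) (not_not.2 (Finset.mem_image_of_mem _ he))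
    obtain ⟨e', he', h⟩ := Finset.mem_image.1 h
    exact M.not_exists_fst_eq_snd (M.undotted_subset he') ⟨e, M.undotted_subset he, h⟩

theorem DottedMatching.leftCount_rightUndot (M : DottedMatching n) :
    M.leftCount M.rightUndot = 0 := by
  rw [leftCount, Finset.card_eq_zero, Finset.filter_eq_empty_iff]
  intro v hv
  obtain ⟨e, he, rfl⟩ := Finset.mem_image.1 hv
  exact M.not_exists_fst_eq_snd (M.undotted_subset he)

theorem DottedMatching.card_of_mem_undotSets (M : DottedMatching n) {U : Finset (Fin n)}
    (hU : U ∈ M.undotSets) : U.card = M.undotted.card := by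
  rw [undotSets_eq, mem_transversals] at hU
  refine Finset.card_bij (fun v _ => M.arc v) (fun v hv => ?_) (fun v hv w hw h => ?_)
    fun e he => ?_
  · obtain ⟨e, he, h⟩ := hU.1 v hv
    rwa [M.arc_eq (M.undotted_subset he) h]
  · obtain ⟨e, he, hve⟩ := hU.1 v hv
    obtain ⟨e', he', hwe⟩ := hU.1 w hw
    obtain rfl : e = e' := by
      rw [← M.arc_eq (M.undotted_subset he) hve, h, M.arc_eq (M.undotted_subset he') hwe]
    have := hU.2 e he
    rcases hve with rfl | rfl <;> rcases hwe with rfl | rfl <;> tauto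
  · by_cases h : e.1 ∈ U
    · exact ⟨e.1, h, M.arc_fst (M.undotted_subset he)⟩
    · exact ⟨e.2, not_not.1 fun h' => h ((hU.2 e he).2 h'), M.arc_snd (M.undotted_subset he)⟩

/-- Moving an element of a transversal from the right end to the left end of its arc lowers the set
in the colexicographic order. -/
theorem DottedMatching.toColex_le (M : DottedMatching n) {U : Finset (Fin n)}
    (hU : U ∈ M.undotSets) : toColex U ≤ toColex M.rightUndot := by
  rw [undotSets_eq, mem_transversals] at hU
  rw [Finset.Colex.toColex_le_toColex]
  intro v hv hv'
  obtain ⟨e, he, h⟩ := hU.1 v hv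
  have hr : e.2 ∈ M.rightUndot := Finset.mem_image_of_mem _ he
  rcases h with rfl | rfl
  · exact ⟨e.2, hr, (hU.2 e he).1 hv, (M.lt e (M.undotted_subset he)).le⟩
  · exact (hv' hr).elim

theorem repr_lineDiagramSum (B : Module.Basis (Finset (Fin n)) ℂ (HTot (Fin n → S2)))
    (hB : ∀ U, B U = lineDiagram U) (M : DottedMatching n) (U : Finset (Fin n)) :
    B.repr M.lineDiagramSum U = if U ∈ M.undotSets then (-1 : ℂ) ^ M.leftCount U else 0 := by
  rw [DottedMatching.lineDiagramSum, map_sum, Finsupp.finsetSum_apply]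
  simp only [← hB, map_smul, Module.Basis.repr_self, Finsupp.smul_apply, Finsupp.single_apply,
    smul_eq_mul, mul_ite, mul_one, mul_zero, Finset.sum_ite_eq']

theorem repr_lineDiagramSum_rightUndot (B : Module.Basis (Finset (Fin n)) ℂ (HTot (Fin n → S2)))
    (hB : ∀ U, B U = lineDiagram U) (M : DottedMatching n) :
    B.repr M.lineDiagramSum M.rightUndot = 1 := by
  rw [repr_lineDiagramSum B hB, if_pos M.rightUndot_mem_undotSets, M.leftCount_rightUndot, pow_zero]

theorem mem_undotSets_of_repr_ne_zero
    (B : Module.Basis (Finset (Fin n)) ℂ (HTot (Fin n → S2))) (hB : ∀ U, B U = lineDiagram U)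
    (M : DottedMatching n) {U : Finset (Fin n)} (h : B.repr M.lineDiagramSum U ≠ 0) :
    U ∈ M.undotSets := by
  rw [repr_lineDiagramSum B hB] at h
  by_contra hU
  exact h (if_neg hU)

/-! ### Standard dotted matchings and their right endpoints -/

theorem DottedMatching.IsStandard.arc_undotted {M : DottedMatching n} (hM : M.IsStandard)
    {e : Fin n × Fin n} (he : e ∈ M.arcs) {v : Fin n} (h1 : e.1 < v) (h2 : v < e.2) :
    M.arc v ∈ M.undotted :=
  Finset.mem_sdiff.2 ⟨M.arc_mem v, fun h => hM _ h e he (M.arc_nested he h1 h2)⟩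

theorem DottedMatching.mem_undotted_of_mem_rightUndot (M : DottedMatching n) {r : Fin n}
    (hr : r ∈ M.rightUndot) : (M.partner r, r) ∈ M.undotted := by
  obtain ⟨e, he, rfl⟩ := Finset.mem_image.1 hr
  rwa [M.partner_snd (M.undotted_subset he)]

/-- If the arcs of `M` and `M'` at smaller right endpoints agree, then the arc of `M` that ends at
`r` cannot begin to the left of that of `M'`. Otherwise the left endpoint `l` of the latter lies
below the former, hence on an undotted arc of `M`. If `l` is the left end of this arc, then this is
also an arc of `M'`; if it is the right end, then `l` is also a right endpoint of `M'`. -/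
theorem DottedMatching.IsStandard.not_partner_lt {M M' : DottedMatching n} (hM : M.IsStandard)
    (hR : M.rightUndot = M'.rightUndot) {r : Fin n} (hr : r ∈ M.rightUndot)
    (ih : ∀ r' < r, r' ∈ M.rightUndot → M.partner r' = M'.partner r') :
    ¬ M.partner r < M'.partner r := by
  intro hlt
  have h1 := M.mem_undotted_of_mem_rightUndot hr
  have h1' := M'.mem_undotted_of_mem_rightUndot (hR ▸ hr)
  have hm' := M'.undotted_subset h1'
  set l := M'.partner r with hl
  have hlr : l < r := M'.lt _ hm'
  have hu := hM.arc_undotted (M.undotted_subset h1) hlt hlr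
  have hnest := M.arc_nested (M.undotted_subset h1) hlt hlr
  rcases M.eq_or_eq l with h | h
  · have hr1 : (M.arc l).2 ∈ M.rightUndot := Finset.mem_image_of_mem _ hu
    have h2 := ih _ hnest.2 hr1
    rw [M.partner_snd (M.arc_mem l), ← h] at h2
    have h3 := M'.undotted_subset (M'.mem_undotted_of_mem_rightUndot (hR ▸ hr1))
    rw [← h2] at h3
    have h4 := congrArg Prod.snd ((M'.arc_fst (e := (l, (M.arc l).2)) h3).symm.trans
      (M'.arc_fst (e := (l, r)) hm'))
    exact hnest.2.ne h4
  · have hlR : l ∈ M'.rightUndot := by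
      rw [← hR, h]
      exact Finset.mem_image_of_mem _ hu
    obtain ⟨e, he, hel⟩ := Finset.mem_image.1 hlR
    exact M'.not_exists_fst_eq_snd (M'.undotted_subset he) ⟨_, hm', hel⟩

/-- The undotted arcs of a standard dotted matching are determined by their right endpoints, one
after the other from the left. -/
theorem DottedMatching.IsStandard.undotted_subset_of_rightUndot_eq {M M' : DottedMatching n}
    (hM : M.IsStandard) (hM' : M'.IsStandard) (hR : M.rightUndot = M'.rightUndot) :
    M.undotted ⊆ M'.undotted := by
  have key : ∀ r : Fin n, r ∈ M.rightUndot → M.partner r = M'.partner r := by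
    intro r
    induction r using WellFoundedLT.induction with
    | ind r ih =>
      intro hr
      refine le_antisymm (not_lt.1 ?_) (not_lt.1 ?_)
      · exact hM'.not_partner_lt hR.symm (hR ▸ hr) fun r' hr' h => (ih r' hr' (hR ▸ h)).symm
      · exact hM.not_partner_lt hR hr ih
  intro e he
  have hr : e.2 ∈ M.rightUndot := Finset.mem_image_of_mem _ he
  have := M'.mem_undotted_of_mem_rightUndot (hR ▸ hr)
  rwa [← key _ hr, M.partner_snd (M.undotted_subset he)] at this

theorem DottedMatching.arc_mem_dotted_iff (M : DottedMatching n) (v : Fin n) :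
    M.arc v ∈ M.dotted ↔ ∀ e ∈ M.undotted, v ≠ e.1 ∧ v ≠ e.2 := by
  constructor
  · intro h e he
    rw [← not_or]
    intro h'
    rw [M.arc_eq (M.undotted_subset he) h'] at h
    exact (Finset.mem_sdiff.1 he).2 h
  · intro h
    by_contra h'
    have := h _ (Finset.mem_sdiff.2 ⟨M.arc_mem v, h'⟩)
    have := M.eq_or_eq v
    tauto

/-- If the undotted arcs agree, a dotted arc of `M` cannot end strictly below the arc of `M'` with
the same left endpoint: its right endpoint would lie on a dotted arc of `M'` nested below that
arc. -/
theorem DottedMatching.IsStandard.not_dotted_partner_lt {M M' : DottedMatching n}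
    (hM' : M'.IsStandard) (hU : M.undotted = M'.undotted) {v : Fin n} (hv : M.arc v ∈ M.dotted)
    (h : v < M.partner v) : ¬ M.partner v < M'.partner v := by
  intro hlt
  have ha := M.arc_of_lt_partner h
  have ha' := M'.arc_of_lt_partner (h.trans hlt)
  have hw : M.arc (M.partner v) = M.arc v :=
    M.arc_eq (M.arc_mem v) (.inr (by rw [ha]))
  rw [← hw, M.arc_mem_dotted_iff, hU, ← M'.arc_mem_dotted_iff] at hv
  have hm : (v, M'.partner v) ∈ M'.arcs := ha' ▸ M'.arc_mem v
  exact hM' _ hv _ hm (M'.arc_nested hm h hlt)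

/-- A standard dotted matching is determined by the right endpoints of its undotted arcs. -/
theorem rightUndot_injOn :
    Set.InjOn (fun M : DottedMatching n => M.rightUndot) {M | M.IsStandard} := by
  intro M hM M' hM' hR
  have hU : M.undotted = M'.undotted := Finset.Subset.antisymm
    (hM.undotted_subset_of_rightUndot_eq hM' hR) (hM'.undotted_subset_of_rightUndot_eq hM hR.symm)
  have hD : ∀ v, M.arc v ∈ M.dotted ↔ M'.arc v ∈ M'.dotted := fun v => by
    rw [M.arc_mem_dotted_iff, hU, M'.arc_mem_dotted_iff]
  -- the dotted arcs agree, by induction on one of their endpoints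
  have key : ∀ v : Fin n, M.arc v ∈ M.dotted → M.partner v = M'.partner v := by
    intro v
    induction v using WellFoundedLT.induction with
    | ind v ih =>
      intro hv
      rcases lt_or_gt_of_ne (M.partner_ne v) with h | h
      · have := ih _ h (by rwa [M.arc_partner])
        rw [M.partner_partner] at this
        nth_rewrite 2 [this]
        rw [M'.partner_partner]
      rcases lt_or_gt_of_ne (M'.partner_ne v) with h' | h'
      · have := ih _ h' (by rw [hD, M'.arc_partner, ← hD]; exact hv)
        rw [M'.partner_partner] at this
        nth_rewrite 1 [← this]
        rw [M.partner_partner]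
      · exact le_antisymm (not_lt.1 (hM.not_dotted_partner_lt hU.symm ((hD v).1 hv) h'))
          (not_lt.1 (hM'.not_dotted_partner_lt hU hv h))
  have hdot : M.dotted = M'.dotted := by
    ext e
    constructor
    · intro he
      have hm := M.dotted_subset he
      have hv : M.arc e.1 ∈ M.dotted := by rwa [M.arc_fst hm]
      have hp := (key _ hv).symm.trans (M.partner_fst hm)
      have := (hD _).1 hv
      rwa [M'.arc_of_lt_partner (hp ▸ M.lt e hm), hp] at this
    · intro he
      have hm := M'.dotted_subset he
      have hv : M'.arc e.1 ∈ M'.dotted := by rwa [M'.arc_fst hm]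
      have hp := (key _ ((hD _).2 hv)).trans (M'.partner_fst hm)
      have := (hD _).2 hv
      rwa [M.arc_of_lt_partner (hp ▸ M'.lt e hm), hp] at this
  have harcs : M.arcs = M'.arcs := by
    rw [← Finset.sdiff_union_of_subset M.dotted_subset,
      ← Finset.sdiff_union_of_subset M'.dotted_subset]
    exact congrArg₂ _ hU hdot
  exact DottedMatching.ext harcs hdot

/-- The line diagram sums of standard dotted matchings are linearly independent. -/
theorem linearIndependent_lineDiagramSum
    (B : Module.Basis (Finset (Fin n)) ℂ (HTot (Fin n → S2))) (hB : ∀ U, B U = lineDiagram U) :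
    LinearIndependent ℂ
      (fun M : {M : DottedMatching n // M.IsStandard} => M.1.lineDiagramSum) := by
  rw [linearIndependent_iff']
  intro s g hs
  by_contra! hg
  obtain ⟨M₀, hM₀, hg₀⟩ := hg
  -- a matching with nonzero coefficient whose set of right endpoints is largest
  obtain ⟨M, hM, hmax⟩ := Finset.exists_max_image (s.filter fun M => g M ≠ 0)
    (fun M => toColex M.1.rightUndot) ⟨M₀, Finset.mem_filter.2 ⟨hM₀, hg₀⟩⟩
  rw [Finset.mem_filter] at hM
  have h := congrArg (fun x => B.repr x M.1.rightUndot) hs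
  simp only [map_sum, map_smul, map_zero, Finsupp.finsetSum_apply, Finsupp.smul_apply,
    Finsupp.zero_apply, smul_eq_mul] at h
  rw [Finset.sum_eq_single M, repr_lineDiagramSum_rightUndot B hB, mul_one] at h
  · exact hM.2 h
  · intro N hN hne
    by_contra hN0
    have h1 := left_ne_zero_of_mul hN0
    have h2 := N.1.toColex_le (mem_undotSets_of_repr_ne_zero B hB N.1 (right_ne_zero_of_mul hN0))
    have h3 := le_antisymm (hmax N (Finset.mem_filter.2 ⟨hN, h1⟩)) h2
    exact hne (Subtype.ext (rightUndot_injOn N.2 M.2 (toColex_inj.1 h3)))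
  · exact fun h => (h hM.1).elim

end Triangular

/-! ### Reduced words in a free product of groups of order two -/

section Words
variable {α β : Type}

open Classical in
/-- Multiplication of a reduced word with a letter from the left; each letter is its own inverse. -/
def pushLetter (a : α) (s : List α) : List α :=
  match s with
  | [] => [a]
  | b :: t => if b = a then t else a :: b :: t

theorem pushLetter_cons_self (a : α) (t : List α) : pushLetter a (a :: t) = t := if_pos rfl

theorem pushLetter_cons_of_ne {a b : α} (h : b ≠ a) (t : List α) :
    pushLetter a (b :: t) = a :: b :: t := if_neg h

/-- The reduced form of a word. -/
def reduceWord (l : List α) : List α := l.foldr pushLetter []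

theorem reduceWord_cons (a : α) (l : List α) : reduceWord (a :: l) = pushLetter a (reduceWord l) :=
  rfl

theorem pushLetter_cases (a : α) (s : List α) :
    pushLetter a s = a :: s ∨ s = a :: pushLetter a s := by
  cases s with
  | nil => exact .inl rfl
  | cons b t =>
    by_cases h : b = a
    · subst h
      exact .inr (by rw [pushLetter_cons_self])
    · exact .inl (pushLetter_cons_of_ne h t)

/-- A word is reduced if equal letters are never adjacent. -/
abbrev IsReduced (l : List α) : Prop := l.IsChain (· ≠ ·)

theorem IsReduced.pushLetter {s : List α} (hs : IsReduced s) (a : α) :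
    IsReduced (pushLetter a s) := by
  cases s with
  | nil => exact List.isChain_singleton a
  | cons b t =>
    by_cases h : b = a
    · subst h
      rw [pushLetter_cons_self]
      exact hs.tail
    · rw [pushLetter_cons_of_ne h]
      exact List.isChain_cons_cons.2 ⟨Ne.symm h, hs⟩

theorem isReduced_reduceWord (l : List α) : IsReduced (reduceWord l) := by
  induction l with
  | nil => exact List.isChain_nil
  | cons a l ih => exact ih.pushLetter a

theorem pushLetter_pushLetter {s : List α} (hs : IsReduced s) (a : α) :
    pushLetter a (pushLetter a s) = s := by
  rcases pushLetter_cases a s with h | h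
  · rw [h, pushLetter_cons_self]
  · generalize pushLetter a s = t at h
    subst h
    cases t with
    | nil => rfl
    | cons b t => exact pushLetter_cons_of_ne (List.isChain_cons_cons.1 hs).1.symm t

theorem length_reduceWord_le (l : List α) : (reduceWord l).length ≤ l.length := by
  induction l with
  | nil => exact le_rfl
  | cons a l ih =>
    rw [reduceWord_cons, List.length_cons]
    rcases pushLetter_cases a (reduceWord l) with h | h
    · rw [h, List.length_cons]
      omega
    · have := congrArg List.length h
      rw [List.length_cons] at this
      omega

theorem reduceWord_map_pushLetter (f : α → β) (a : α) (s : List α) :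
    reduceWord ((pushLetter a s).map f) = pushLetter (f a) (reduceWord (s.map f)) := by
  rcases pushLetter_cases a s with h | h
  · rw [h]
    rfl
  · nth_rewrite 2 [h]
    rw [List.map_cons, reduceWord_cons, pushLetter_pushLetter (isReduced_reduceWord _)]

/-- A map of the letters induces a homomorphism. -/
theorem reduceWord_map (f : α → β) (l : List α) :
    reduceWord (l.map f) = reduceWord ((reduceWord l).map f) := by
  induction l with
  | nil => rfl
  | cons a l ih =>
    rw [List.map_cons, reduceWord_cons, ih, reduceWord_cons, reduceWord_map_pushLetter]

theorem length_reduceWord_map_le (f : α → β) (l : List α) :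
    (reduceWord (l.map f)).length ≤ (reduceWord l).length := by
  rw [reduceWord_map]
  exact (length_reduceWord_le _).trans (by rw [List.length_map])

end Words

/-! ### Words and noncrossing matchings -/

section Matchings
variable {n : ℕ} (x : Fin n → S2)

/-- The reduced form of the word of the coordinates from the position `i` on. -/
def suffixWord (i : ℕ) : List S2 := reduceWord ((List.ofFn x).drop i)

theorem suffixWord_self : suffixWord x n = [] := by
  rw [suffixWord, List.drop_of_length_le (by simp)]
  rfl

theorem suffixWord_zero : suffixWord x 0 = reduceWord (List.ofFn x) := rfl

theorem suffixWord_eq (i : Fin n) : suffixWord x i = pushLetter (x i) (suffixWord x (i + 1)) := by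
  rw [suffixWord, List.drop_eq_getElem_cons (by simp), reduceWord_cons, List.getElem_ofFn]
  rfl

theorem suffixWord_cases (i : Fin n) : suffixWord x i = x i :: suffixWord x (i + 1) ∨
    suffixWord x (i + 1) = x i :: suffixWord x i := by
  rw [suffixWord_eq]
  exact pushLetter_cases _ _

/-- An interval `[i, j)` that is a union of arcs of a matching contributes nothing to the reduced
word. -/
theorem suffixWord_eq_of_closed {a : Matching n} (hx : x ∈ a.component) (m : ℕ) :
    ∀ i j : ℕ, j = i + m → j ≤ n →
      (∀ v : Fin n, i ≤ v → v < j → i ≤ a.partner v ∧ (a.partner v : ℕ) < j) →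
      suffixWord x i = suffixWord x j := by
  induction m using Nat.strong_induction_on with
  | _ m ih =>
    intro i j hij hj hcl
    rcases Nat.eq_zero_or_pos m with rfl | hm
    · rw [hij, add_zero]
    set v : Fin n := ⟨i, by omega⟩ with hv
    have hv1 := hcl v le_rfl (by change i < j; omega)
    have hvp : v < a.partner v := lt_of_le_of_ne hv1.1 (a.partner_ne v).symm
    have harc := a.arc_of_lt_partner hvp
    have hmem : (v, a.partner v) ∈ a.arcs := harc ▸ a.arc_mem v
    set r := a.partner v with hr
    have hvr : i < (r : ℕ) := hvp
    have hxr : x v = x r := hx _ hmem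
    have hin : ∀ w : Fin n, v < w → w < r → v < a.partner w ∧ a.partner w < r :=
      fun w h1 h2 => a.partner_nested hmem h1 h2
    have e1 : suffixWord x (i + 1) = suffixWord x r := by
      refine ih (r - (i + 1)) (by omega) _ _ (by omega) r.2.le fun w h1 h2 => ?_
      exact hin w (Fin.lt_def.2 h1) (Fin.lt_def.2 h2)
    have e2 : suffixWord x (r + 1) = suffixWord x j := by
      refine ih (j - (r + 1)) (by omega) _ _ (by omega) hj fun w h1 h2 => ?_
      have h3 := hcl w (by omega) h2
      refine ⟨?_, h3.2⟩
      by_contra h4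
      have h5 : a.partner w ≤ r := Fin.le_def.2 (by omega)
      have hwr : w ≠ r := fun h => by rw [h] at h1; omega
      rcases h5.lt_or_eq with h5 | h5
      · have h6 : v ≤ a.partner w := h3.1
        rcases h6.lt_or_eq with h6 | h6
        · have := (hin _ h6 h5).2
          rw [a.partner_partner] at this
          exact absurd (Fin.lt_def.1 this) (by omega)
        · have := a.partner_partner w
          rw [← h6] at this
          exact hwr this.symm
      · have h7 := a.partner_partner w
        rw [h5, hr, a.partner_partner] at h7
        rw [← h7] at h1
        change (r : ℕ) + 1 ≤ i at h1
        omega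
    have e3 := suffixWord_eq x v
    have e4 := suffixWord_eq x r
    rw [← e2]
    change suffixWord x i = pushLetter (x v) (suffixWord x (i + 1)) at e3
    rw [e3, e1, e4, hxr]
    exact pushLetter_pushLetter (isReduced_reduceWord _) _

/-- The length of the reduced word from a position on. -/
def height (i : ℕ) : ℕ := (suffixWord x i).length

theorem height_cases (i : Fin n) : height x i = height x (i + 1) + 1 ∨
    height x (i + 1) = height x i + 1 := by
  rcases suffixWord_cases x i with h | h
  · exact .inl (congrArg List.length h)
  · exact .inr (congrArg List.length h)

/-- A pair of positions is matched if the heights strictly between its ends exceed those at its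
ends. -/
def IsHeightArc (e : Fin n × Fin n) : Prop :=
  e.1 < e.2 ∧ height x e.1 = height x (e.2 + 1) ∧
    ∀ j : ℕ, (e.1 : ℕ) < j → j ≤ e.2 → height x e.1 < height x j

/-- Reading the word from right to left, a letter is put in front at the right end of a height arc,
and the letters put in front of it afterwards are all removed before the left end, where therefore
the same letter is removed again. -/
theorem IsHeightArc.eq {e : Fin n × Fin n} (h : IsHeightArc x e) : x e.1 = x e.2 := by
  obtain ⟨hlt, heq, hbet⟩ := h
  have hlt' : (e.1 : ℕ) < e.2 := hlt
  have h1 : height x e.2 = height x (e.2 + 1) + 1 := by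
    have := hbet e.2 hlt' le_rfl
    rcases height_cases x e.2 with h | h <;> omega
  have h2 : height x (e.1 + 1) = height x e.1 + 1 := by
    have := hbet (e.1 + 1) (by omega) hlt'
    rcases height_cases x e.1 with h | h <;> omega
  -- between the two ends, nothing below the letter put in front at the right end is touched
  have key : ∀ m j : ℕ, j + m = e.2 → (e.1 : ℕ) < j → suffixWord x e.2 <:+ suffixWord x j := by
    intro m
    induction m with
    | zero =>
      intro j hj _
      rw [add_zero] at hj
      rw [hj]
    | succ m ih =>
      intro j hj hj1
      have h3 := ih (j + 1) (by omega) (by omega)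
      have hjn : j < n := by have := e.2.2; omega
      rcases suffixWord_cases x ⟨j, hjn⟩ with h | h
      · change suffixWord x j = _ at h
        rw [h]
        exact h3.trans (List.suffix_cons _ _)
      · change suffixWord x (j + 1) = x ⟨j, hjn⟩ :: suffixWord x j at h
        refine List.suffix_of_suffix_length_le h3 (h ▸ List.suffix_cons _ _) ?_
        have := hbet j hj1 (by omega)
        change height x e.2 ≤ height x j
        omega
  have h3 := (key (e.2 - (e.1 + 1)) (e.1 + 1) (by omega) (by omega)).eq_of_length (by
    change height x e.2 = height x (e.1 + 1)
    omega)
  rcases suffixWord_cases x e.1 with h | h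
  · have := congrArg List.length h
    change height x e.1 = height x (e.1 + 1) + 1 at this
    omega
  rcases suffixWord_cases x e.2 with h' | h'
  · rw [h, h'] at h3
    exact (List.cons.inj h3).1.symm
  · have := congrArg List.length h'
    change height x (e.2 + 1) = height x e.2 + 1 at this
    omega

/-- Every position lies on a height arc: it is the right end of one if its letter is put in front of
the reduced word, and the left end of one if its letter cancels. -/
theorem exists_heightArc (h0 : height x 0 = 0) (v : Fin n) :
    ∃ e, IsHeightArc x e ∧ (v = e.1 ∨ v = e.2) := by
  classical
  have hn : height x n = 0 := by rw [height, suffixWord_self]; rfl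
  have hv := v.2
  rcases height_cases x v with h | h
  · -- the last position to the left where the height is small enough
    have hex : ∃ m : ℕ, m < (v : ℕ) ∧ height x (v - 1 - m) ≤ height x (v + 1) := by
      have hv0 : (v : ℕ) ≠ 0 := fun h' => by rw [h'] at h; omega
      exact ⟨v - 1, by omega, by rw [Nat.sub_self, h0]; omega⟩
    set m := Nat.find hex
    obtain ⟨hm1, hm2⟩ : m < (v : ℕ) ∧ height x (v - 1 - m) ≤ height x (v + 1) := Nat.find_spec hex
    have hmin : ∀ m' < m, height x (v + 1) < height x (v - 1 - m') := fun m' hm' =>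
      not_le.1 fun h' => Nat.find_min hex hm' ⟨by omega, h'⟩
    have hbet : ∀ j : ℕ, v - 1 - m < j → j ≤ v → height x (v + 1) < height x j := by
      intro j h1 h2
      rcases h2.eq_or_lt with rfl | h2
      · omega
      · have := hmin (v - 1 - j) (by omega)
        rwa [show (v : ℕ) - 1 - (v - 1 - j) = j by omega] at this
    have heq : height x (v - 1 - m) = height x (v + 1) := by
      have h1 := hbet (v - 1 - m + 1) (by omega) (by omega)
      have h2 := height_cases x ⟨v - 1 - m, by omega⟩
      change height x (v - 1 - m) = height x (v - 1 - m + 1) + 1 ∨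
        height x (v - 1 - m + 1) = height x (v - 1 - m) + 1 at h2
      omega
    refine ⟨(⟨v - 1 - m, by omega⟩, v), ⟨Fin.lt_def.2 (by change (v : ℕ) - 1 - m < v; omega), heq,
      fun j h1 h2 => ?_⟩, .inr rfl⟩
    change height x (v - 1 - m) < _
    rw [heq]
    exact hbet j h1 h2
  · -- the first position to the right where the height is small enough
    have hex : ∃ r, (v : ℕ) < r ∧ r < n ∧ height x (r + 1) ≤ height x v := by
      have : (v : ℕ) + 1 ≠ n := fun h' => by rw [h', hn] at h; omega
      exact ⟨n - 1, by omega, by omega, by rw [Nat.sub_add_cancel (by omega), hn]; omega⟩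
    set r := Nat.find hex
    obtain ⟨hr1, hr2, hr3⟩ : (v : ℕ) < r ∧ r < n ∧ height x (r + 1) ≤ height x v :=
      Nat.find_spec hex
    have hmin : ∀ r' < r, (v : ℕ) < r' → height x v < height x (r' + 1) := fun r' hr' h1 =>
      not_le.1 fun h' => Nat.find_min hex hr' ⟨h1, by omega, h'⟩
    have hbet : ∀ j : ℕ, (v : ℕ) < j → j ≤ r → height x v < height x j := by
      intro j h1 h2
      rcases Nat.eq_or_lt_of_le h1 with h1 | h1
      · rw [← h1]
        change height x v < height x (v + 1)
        omega
      · have := hmin (j - 1) (by omega) (by omega)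
        rwa [Nat.sub_add_cancel (by omega)] at this
    have heq : height x v = height x (r + 1) := by
      have h1 := hbet r hr1 le_rfl
      have h2 := height_cases x ⟨r, hr2⟩
      change height x r = height x (r + 1) + 1 ∨ height x (r + 1) = height x r + 1 at h2
      omega
    exact ⟨(v, ⟨r, hr2⟩), ⟨Fin.lt_def.2 hr1, heq, hbet⟩, .inl rfl⟩

theorem IsHeightArc.unique {e e' : Fin n × Fin n} (h : IsHeightArc x e) (h' : IsHeightArc x e')
    {v : Fin n} (hv : v = e.1 ∨ v = e.2) (hv' : v = e'.1 ∨ v = e'.2) : e = e' := by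
  obtain ⟨hlt, heq, hbet⟩ := h
  obtain ⟨hlt', heq', hbet'⟩ := h'
  rw [Fin.lt_def] at hlt hlt'
  obtain ⟨i, r⟩ := e
  obtain ⟨i', r'⟩ := e'
  simp only at *
  rcases hv with rfl | rfl <;> rcases hv' with rfl | rfl
  · rcases lt_trichotomy (r : ℕ) r' with h | h | h
    · have := hbet' (r + 1) (by omega) h
      omega
    · rw [Fin.ext h]
    · have := hbet (r' + 1) (by omega) h
      omega
  · have h1 := hbet (v + 1) (by omega) hlt
    have h2 := hbet' v hlt' le_rfl
    omega
  · have h1 := hbet v hlt le_rfl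
    have h2 := hbet' (v + 1) (by omega) hlt'
    omega
  · rcases lt_trichotomy (i : ℕ) i' with h | h | h
    · have := hbet i' h hlt'.le
      omega
    · rw [Fin.ext h]
    · have := hbet' i h hlt.le
      omega

open Classical in
/-- The matching of a word that reduces to the empty word. -/
def heightMatching (h0 : height x 0 = 0) : Matching n where
  arcs := {e | IsHeightArc x e}
  lt e he := (Finset.mem_filter.1 he).2.1
  existsUnique_arc v := by
    obtain ⟨e, he, hv⟩ := exists_heightArc x h0 v
    refine ⟨e, ⟨by simpa using he, hv⟩, fun e' he' => ?_⟩
    have h1 : IsHeightArc x e' := by simpa using he'.1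
    exact h1.unique x he he'.2 hv
  noncrossing e he e' he' := by
    rintro ⟨h1, h2, h3⟩
    have ha : IsHeightArc x e := by simpa using he
    have ha' : IsHeightArc x e' := by simpa using he'
    rw [Fin.lt_def] at h1 h2 h3
    have h4 := ha.2.2 e'.1 h1 h2.le
    have h5 := ha'.2.2 (e.2 + 1) (by omega) h3
    have := ha.2.1
    omega

/-- A matching cancels the letters of a word in pairs, and the heights provide a noncrossing
matching if all letters cancel. -/
theorem mem_springer_iff : x ∈ springer n ↔ reduceWord (List.ofFn x) = [] := by
  rw [springer, Set.mem_iUnion]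
  constructor
  · rintro ⟨a, ha⟩
    have := suffixWord_eq_of_closed x ha n 0 n (by omega) le_rfl fun v _ _ =>
      ⟨Nat.zero_le _, (a.partner v).2⟩
    rwa [suffixWord_self] at this
  · intro h
    have h0 : height x 0 = 0 := by
      rw [height, suffixWord_zero, h]
      rfl
    refine ⟨heightMatching x h0, fun e he => ?_⟩
    have : IsHeightArc x e := by simpa [heightMatching] using he
    exact this.eq x

end Matchings

/-! ### The filtration of the product of spheres by the length of the reduced word -/

section Levels
variable {n k : ℕ}

/-- The points of `(S²)^n` for which at least `2k` letters cancel in the word of the coordinates. -/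
def level (n k : ℕ) : Set (Fin n → S2) := {x | (reduceWord (List.ofFn x)).length + 2 * k ≤ n}

theorem mem_level {x : Fin n → S2} :
    x ∈ level n k ↔ (reduceWord (List.ofFn x)).length + 2 * k ≤ n := Iff.rfl

theorem level_zero (n : ℕ) : level n 0 = Set.univ :=
  Set.eq_univ_of_forall fun x => by
    have := length_reduceWord_le (List.ofFn x)
    rw [List.length_ofFn] at this
    exact mem_level.2 (by omega)

theorem isEmpty_level (h : n < 2 * k) : IsEmpty (level n k) :=
  ⟨fun x => by have := mem_level.1 x.2; omega⟩

theorem springer_eq_level (k : ℕ) : springer (k + k) = level (k + k) k := by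
  ext x
  rw [mem_springer_iff, mem_level, ← List.length_eq_zero_iff]
  omega

/-- Identifying further coordinates does not lower the level. -/
theorem mem_level_of_eq_imp_eq {x y : Fin n → S2} (h : ∀ i j, x i = x j → y i = y j)
    (hx : x ∈ level n k) : y ∈ level n k := by
  obtain ⟨f, hf⟩ : ∃ f : S2 → S2, y = f ∘ x :=
    ⟨Function.extend x y id,
      (Function.FactorsThrough.extend_comp (g := y) id fun i j => h i j).symm⟩
  rw [mem_level, hf, ← List.map_ofFn]
  exact (Nat.add_le_add_right (length_reduceWord_map_le f _) _).trans hx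

/-- Whether a point belongs to a level depends only on which of its coordinates agree, and the level
is the union of finitely many sets given by equations between coordinates. -/
theorem isClosed_level (n k : ℕ) : IsClosed (level n k) := by
  let R : Set (Fin n → Fin n → Prop) :=
    {r | ∀ x : Fin n → S2, (∀ i j, r i j → x i = x j) → x ∈ level n k}
  have e : level n k = ⋃ r ∈ R, {x | ∀ i j, r i j → x i = x j} := by
    ext x
    rw [Set.mem_iUnion₂]
    exact ⟨fun hx => ⟨fun i j => x i = x j, fun y hy => mem_level_of_eq_imp_eq hy hx,
      fun _ _ h => h⟩, fun ⟨_, hr, h⟩ => hr x h⟩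
  rw [e]
  refine (Set.toFinite R).isClosed_biUnion fun r _ => ?_
  simp only [Set.ofPred_forall]
  exact isClosed_iInter fun i => isClosed_iInter fun j => isClosed_iInter fun _ =>
    isClosed_eq (continuous_apply i) (continuous_apply j)

instance (n k : ℕ) : CompactSpace (level n k) :=
  isCompact_iff_compactSpace.1 (isClosed_level n k).isCompact

theorem reduceWord_ofFn_cons (y : S2) (x : Fin n → S2) :
    reduceWord (List.ofFn (Fin.cons y x : Fin (n + 1) → S2)) =
      pushLetter y (reduceWord (List.ofFn x)) := by
  rw [List.ofFn_succ, reduceWord_cons]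
  rfl

theorem reduceWord_ofFn_succ (x : Fin (n + 1) → S2) :
    reduceWord (List.ofFn x) = pushLetter (x 0) (reduceWord (List.ofFn (Fin.tail x))) := by
  rw [← reduceWord_ofFn_cons, Fin.cons_self_tail]

theorem cons_mem_level {x : Fin n → S2} (hx : x ∈ level n k) (y : S2) :
    (Fin.cons y x : Fin (n + 1) → S2) ∈ level (n + 1) k := by
  rw [mem_level] at hx ⊢
  rw [reduceWord_ofFn_cons]
  rcases pushLetter_cases y (reduceWord (List.ofFn x)) with h | h <;>
    have := congrArg List.length h <;> rw [List.length_cons] at this <;> omega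

theorem tail_mem_level {x : Fin (n + 1) → S2} (hx : x ∈ level (n + 1) (k + 1)) :
    Fin.tail x ∈ level n k := by
  rw [mem_level, reduceWord_ofFn_succ] at hx
  rw [mem_level]
  rcases pushLetter_cases (x 0) (reduceWord (List.ofFn (Fin.tail x))) with h | h <;>
    have := congrArg List.length h <;> rw [List.length_cons] at this <;> omega

/-- Where the tail is not itself of the higher level, the first coordinate cancels. -/
theorem reduceWord_tail {x : Fin (n + 1) → S2} (hx : x ∈ level (n + 1) (k + 1))
    (h : Fin.tail x ∉ level n (k + 1)) : ∃ t, reduceWord (List.ofFn (Fin.tail x)) = x 0 :: t := by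
  rw [mem_level, reduceWord_ofFn_succ] at hx
  rw [mem_level] at h
  rcases pushLetter_cases (x 0) (reduceWord (List.ofFn (Fin.tail x))) with h' | h'
  · have := congrArg List.length h'
    rw [List.length_cons] at this
    omega
  · exact ⟨_, h'⟩

theorem length_reduceWord_mod_two {α : Type} (l : List α) :
    (reduceWord l).length % 2 = l.length % 2 := by
  induction l with
  | nil => rfl
  | cons a l ih =>
    rw [reduceWord_cons]
    rcases pushLetter_cases a (reduceWord l) with h | h <;>
      have := congrArg List.length h <;> rw [List.length_cons] at this ⊢ <;> omega

/-- Over a point that is not of the higher level lies a point of the level `k + 1`: its first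
coordinate is the first letter of the reduced word, which is not empty for reasons of parity. -/
theorem exists_cons_mem_level (hk : 2 * (k + 1) ≤ n + 1) {x : Fin n → S2} (hx : x ∈ level n k)
    (h : x ∉ level n (k + 1)) : ∃ y, (Fin.cons y x : Fin (n + 1) → S2) ∈ level (n + 1) (k + 1) := by
  rw [mem_level] at hx h
  have hp := length_reduceWord_mod_two (List.ofFn x)
  rw [List.length_ofFn] at hp
  match hw : reduceWord (List.ofFn x) with
  | [] =>
    rw [hw, List.length_nil] at hp h
    omega
  | y :: t =>
    refine ⟨y, ?_⟩
    rw [mem_level, reduceWord_ofFn_cons, hw, pushLetter_cons_self]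
    rw [hw, List.length_cons] at hx
    omega

/-- Forgetting the first coordinate. Over the next level this is the projection of a product with
`S²`, and over the complement of the next level it is injective. -/
def tailMap (n k : ℕ) : C(level (n + 1) (k + 1), level n k) where
  toFun x := ⟨Fin.tail x.1, tail_mem_level x.2⟩
  continuous_toFun := by
    refine Continuous.subtype_mk (continuous_pi fun i => ?_) _
    exact (continuous_apply i.succ).comp continuous_subtype_val

/-- The points of a level that are of the next higher level. -/
def nextLevel (n k : ℕ) : Set (level n k) := {x | x.1 ∈ level n (k + 1)}

theorem isClosed_nextLevel (n k : ℕ) : IsClosed (nextLevel n k) :=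
  (isClosed_level n (k + 1)).preimage continuous_subtype_val

theorem tailMap_injOn (x x' : level (n + 1) (k + 1)) (hx : tailMap n k x ∉ nextLevel n k)
    (h : tailMap n k x = tailMap n k x') : x = x' := by
  obtain ⟨t, ht⟩ := reduceWord_tail x.2 hx
  obtain ⟨t', ht'⟩ := reduceWord_tail x'.2 (show tailMap n k x' ∉ nextLevel n k from h ▸ hx)
  have e : Fin.tail x.1 = Fin.tail x'.1 := congrArg Subtype.val h
  have e0 : x.1 0 = x'.1 0 := by
    rw [e, ht'] at ht
    exact (List.cons.inj ht).1.symm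
  exact Subtype.ext (by rw [← Fin.cons_self_tail x.1, ← Fin.cons_self_tail x'.1, e, e0])

theorem tailMap_surjOn (hk : 2 * (k + 1) ≤ n + 1) (y : level n k) (hy : y ∉ nextLevel n k) :
    ∃ x, tailMap n k x = y := by
  obtain ⟨a, ha⟩ := exists_cons_mem_level hk y.2 hy
  exact ⟨⟨_, ha⟩, Subtype.ext (Fin.tail_cons (α := fun _ => S2) a y.1)⟩

end Levels

/-- A map of a compact space to a Hausdorff space is a homeomorphism over every set over which it is
bijective, and therefore maps to that set lift. -/
theorem exists_lift_of_bijective_over {X Y Z : Type} [TopologicalSpace X] [TopologicalSpace Y]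
    [TopologicalSpace Z] [CompactSpace X] [T2Space Y] (f : C(X, Y)) {B : Set Y}
    (hinj : ∀ x x', f x ∈ B → f x = f x' → x = x') (hsurj : ∀ y ∈ B, ∃ x, f x = y)
    (τ : C(Z, Y)) (hτ : ∀ t, τ t ∈ B) : ∃ τ' : C(Z, X), f.comp τ' = τ := by
  have hf : IsHomeomorph (B.restrictPreimage f) :=
    isHomeomorph_iff_continuous_isClosedMap_bijective.2
      ⟨f.continuous.restrictPreimage, f.continuous.isClosedMap.restrictPreimage B,
        fun x x' h => Subtype.ext (hinj _ _ x.2 (congrArg Subtype.val h)), fun y => by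
          obtain ⟨x, hx⟩ := hsurj y y.2
          exact ⟨⟨x, by rw [Set.mem_preimage, hx]; exact y.2⟩, Subtype.ext hx⟩⟩
  let e := hf.homeomorph
  refine ⟨⟨fun t => (e.symm ⟨τ t, hτ t⟩).1, continuous_subtype_val.comp
    (e.symm.continuous.comp (τ.continuous.subtype_mk hτ))⟩, ContinuousMap.ext fun t => ?_⟩
  exact congrArg Subtype.val (e.apply_symm_apply ⟨τ t, hτ t⟩)

/-! ### A deformation that merges nearby coordinates -/

/-- The weight of the attraction of `s` by `q`: it vanishes if the angle between `s` and `q` is not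
acute, and it is one if the distance of `s` and `q` is at most one. -/
def attraction (q s : S2) : ℝ := max 0 (min 1 (2 * inner ℝ (s : E3) (q : E3)))

/-- The point `s`, moved towards `q` for the time `t`. -/
def attractRaw (q : S2) (t : I) (s : S2) : E3 :=
  (1 - t * attraction q s) • (s : E3) + (t * attraction q s : ℝ) • (q : E3)

/-- A point and its antipode do not attract each other, so that the segment avoids the origin. -/
theorem attractRaw_ne_zero (q : S2) (t : I) (s : S2) : attractRaw q t s ≠ 0 := by
  intro h
  have h1 : inner ℝ (s : E3) (attractRaw q t s) = 0 := by rw [h, inner_zero_right]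
  rw [attractRaw, inner_add_right, real_inner_smul_right, real_inner_smul_right,
    real_inner_self_eq_norm_sq, norm_coe_S2] at h1
  have h0 : 0 ≤ attraction q s := le_max_left _ _
  have h2 : attraction q s ≤ 1 := max_le zero_le_one (min_le_left _ _)
  rcases le_or_gt (inner ℝ (s : E3) (q : E3)) 0 with hs | hs
  · have : attraction q s = 0 := max_eq_left ((min_le_right _ _).trans (by linarith))
    rw [this] at h1
    norm_num at h1
  · have ht1 : t * attraction q s ≤ 1 := mul_le_one₀ t.2.2 h0 h2
    have ht0 : 0 ≤ t * attraction q s := mul_nonneg t.2.1 h0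
    rcases ht1.lt_or_eq with h3 | h3
    · nlinarith [mul_nonneg ht0 hs.le]
    · rw [h3] at h1
      linarith

/-- The attraction of `s` by `q` on the sphere. -/
def attract (q : S2) (t : I) (s : S2) : S2 := normalize (attractRaw q t s)

theorem continuous_attract {Z : Type} [TopologicalSpace Z] {q s : Z → S2} {t : Z → I}
    (hq : Continuous q) (ht : Continuous t) (hs : Continuous s) :
    Continuous fun z => attract (q z) (t z) (s z) := by
  refine continuous_normalize ?_ fun z => attractRaw_ne_zero _ _ _
  have hq' : Continuous fun z => (q z : E3) := continuous_subtype_val.comp hq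
  have hs' : Continuous fun z => (s z : E3) := continuous_subtype_val.comp hs
  have ht' : Continuous fun z => (t z : ℝ) := continuous_subtype_val.comp ht
  have ha : Continuous fun z => attraction (q z) (s z) :=
    continuous_const.max (continuous_const.min (continuous_const.mul (hs'.inner hq')))
  exact ((continuous_const.sub (ht'.mul ha)).smul hs').add ((ht'.mul ha).smul hq')

theorem attract_zero (q s : S2) : attract q 0 s = s := by
  rw [attract, attractRaw]
  simp [normalize_S2]

/-- Points at distance at most one form an angle of at most 60 degrees. -/
theorem attract_one {q s : S2} (h : dist s q ≤ 1) : attract q 1 s = q := by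
  have h1 : 1 / 2 ≤ inner ℝ (s : E3) (q : E3) := by
    have e := norm_sub_sq_real (s : E3) (q : E3)
    rw [Subtype.dist_eq, dist_eq_norm] at h
    rw [norm_coe_S2, norm_coe_S2] at e
    nlinarith [norm_nonneg ((s : E3) - q)]
  have h2 : attraction q s = 1 := by
    rw [attraction, min_eq_left (by linarith), max_eq_right zero_le_one]
  rw [attract, attractRaw, h2]
  simp [normalize_S2]

section Collapse
variable {n : ℕ}

/-- The deformation of the sphere, at the time `t`, in which the first `m` coordinates of `x` have
one after the other attracted the points near them. -/
def gather (x : Fin n → S2) (t : I) (m : ℕ) (s : S2) : S2 :=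
  match m with
  | 0 => s
  | m + 1 => if h : m < n then attract (gather x t m (x ⟨m, h⟩)) t (gather x t m s)
      else gather x t m s

theorem gather_succ (x : Fin n → S2) (t : I) (j : Fin n) (s : S2) :
    gather x t (j + 1) s = attract (gather x t j (x j)) t (gather x t j s) := by
  rw [gather, dif_pos j.2]

theorem continuous_gather (n m : ℕ) {Z : Type} [TopologicalSpace Z] :
    ∀ {x : Z → Fin n → S2} {t : Z → I} {s : Z → S2}, Continuous x → Continuous t → Continuous s →
      Continuous fun z => gather (x z) (t z) m (s z) := by
  induction m with
  | zero => exact fun _ _ hs => hs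
  | succ m ih =>
    intro x t s hx ht hs
    by_cases h : m < n
    · simp only [gather, dif_pos h]
      exact continuous_attract (ih hx ht ((continuous_apply _).comp hx)) ht (ih hx ht hs)
    · simp only [gather, dif_neg h]
      exact ih hx ht hs

theorem gather_zero_time (x : Fin n → S2) (m : ℕ) (s : S2) : gather x 0 m s = s := by
  induction m generalizing s with
  | zero => rfl
  | succ m ih =>
    rw [gather]
    split_ifs with h
    · rw [attract_zero, ih]
    · exact ih s

/-- Points that are gathered at one stage stay together. -/
theorem gather_eq_of_le (x : Fin n → S2) (t : I) {m m' : ℕ} (hm : m ≤ m') {s s' : S2}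
    (h : gather x t m s = gather x t m s') : gather x t m' s = gather x t m' s' := by
  induction m', hm using Nat.le_induction with
  | base => exact h
  | succ m' _ ih => rw [gather, gather, ih]

/-- Coordinates that are close enough to each other are merged at the time one. -/
theorem exists_gather_eq (n : ℕ) : ∃ δ > 0, ∀ (x : Fin n → S2) (i j : Fin n),
    dist (x i) (x j) < δ → gather x 1 n (x i) = gather x 1 n (x j) := by
  -- uniform continuity keeps nearby points within the range of full attraction at every stage
  have hu : ∀ j : Fin n, ∃ δ > 0, ∀ (x : Fin n → S2) (s s' : S2), dist s s' < δ →
      dist (gather x 1 j s) (gather x 1 j s') < 1 := fun j => by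
    have hc : Continuous fun z : (Fin n → S2) × S2 => gather z.1 1 j z.2 :=
      continuous_gather n j continuous_fst continuous_const continuous_snd
    obtain ⟨δ, hδ, h⟩ := Metric.uniformContinuous_iff.1
      (CompactSpace.uniformContinuous_of_continuous hc) 1 one_pos
    refine ⟨δ, hδ, fun x s s' hs => @h (x, s) (x, s') ?_⟩
    rw [Prod.dist_eq, dist_self]
    exact max_lt hδ hs
  choose δ hδ h using hu
  obtain ⟨ε, hε, hle⟩ : ∃ ε > 0, ∀ j, ε ≤ δ j := by
    rcases isEmpty_or_nonempty (Fin n) with hn | hn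
    · exact ⟨1, one_pos, fun j => hn.elim j⟩
    · obtain ⟨j, hj⟩ := Finite.exists_min δ
      exact ⟨δ j, hδ j, hj⟩
  refine ⟨ε, hε, fun x i j hij => gather_eq_of_le x 1 (m := j + 1) j.2 ?_⟩
  rw [gather_succ, gather_succ, attract_one (h j x _ _ (hij.trans_le (hle j))).le,
    attract_one (by rw [dist_self]; exact zero_le_one)]

end Collapse

/-! ### Injectivity in homology of the inclusions of the levels -/

section Injectivity
variable {n k : ℕ}

/-- The deformation, applied to the coordinates of a point. -/
def collapse (m : ℕ) (x : Fin n → S2) (t : I) (y : Fin m → S2) : Fin m → S2 :=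
  fun i => gather x t n (y i)

theorem continuous_collapse {m : ℕ} {Z : Type} [TopologicalSpace Z] {x : Z → Fin n → S2}
    {t : Z → I} {y : Z → Fin m → S2} (hx : Continuous x) (ht : Continuous t) (hy : Continuous y) :
    Continuous fun z => collapse m (x z) (t z) (y z) :=
  continuous_pi fun i => continuous_gather n n hx ht ((continuous_apply i).comp hy)

theorem collapse_mem_level {m k : ℕ} (x : Fin n → S2) (t : I) {y : Fin m → S2}
    (hy : y ∈ level m k) : collapse m x t y ∈ level m k :=
  mem_level_of_eq_imp_eq (fun _ _ h => congrArg (gather x t n) h) hy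

/-- The points near a level are moved into the level. -/
theorem exists_collapse_mem_level (n k : ℕ) : ∃ ε > 0, ∀ x ∈ Metric.thickening ε (level n k),
    collapse n x 1 x ∈ level n k := by
  obtain ⟨δ, hδ, h⟩ := exists_gather_eq n
  refine ⟨δ / 2, half_pos hδ, fun x hx => ?_⟩
  obtain ⟨y, hy, hxy⟩ := Metric.mem_thickening_iff.1 hx
  refine mem_level_of_eq_imp_eq (fun i j hij => h x i j ?_) hy
  have hi := (dist_le_pi_dist x y i).trans_lt hxy
  have hj := (dist_le_pi_dist x y j).trans_lt hxy
  have := dist_triangle_right (x i) (x j) (y i)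
  rw [hij] at this hi
  linarith

/-- Every cycle of the level `k` that bounds in `(S²)^n` bounds in the level. -/
def LevelInjective (n k : ℕ) : Prop :=
  ∀ z : Chain (level n k), bd _ z = 0 → Homologous (push (valMap (level n k)) z) 0 → Homologous z 0

theorem levelInjective_of_isEmpty (h : IsEmpty (level n k)) : LevelInjective n k := fun z _ _ => by
  have : IsEmpty (Simp (level n k)) := ⟨fun s => h.elim (s.2 (stdVert s.1 0))⟩
  exact .of_eq (Subsingleton.elim z 0)

theorem levelInjective_zero (n : ℕ) : LevelInjective n 0 := fun z _ h => by
  have hu : ∀ x, x ∈ level n 0 := fun x => level_zero n ▸ Set.mem_univ x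
  have := h.map (⟨fun x => ⟨x, hu x⟩, by fun_prop⟩ : C(Fin n → S2, level n 0))
  rw [push_comp, map_zero] at this
  exact (HomologousIn.of_eq (push_id z).symm).trans this

/-- The induction step. A cycle of the level that bounds in `(S²)^(n+1)` is moved by excision over a
neighbourhood of the next level, by the deformation to a product with `S²`, and then compared with
a cross product, to which the second hypothesis applies. -/
theorem levelInjective_succ (h0 : LevelInjective n k) (h1 : LevelInjective n (k + 1)) :
    LevelInjective (n + 1) (k + 1) := by
  rcases lt_or_ge (n + 1) (2 * (k + 1)) with hk | hk
  · exact levelInjective_of_isEmpty (isEmpty_level hk)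
  intro z hz hz0
  obtain ⟨ε, hε, hcol⟩ := exists_collapse_mem_level n (k + 1)
  set N : Set (level n k) := {x | x.1 ∈ Metric.thickening ε (level n (k + 1))} with hN
  have hNo : IsOpen N := Metric.isOpen_thickening.preimage continuous_subtype_val
  -- the projection of the cycle to the first `n` coordinates bounds by the first hypothesis
  obtain ⟨b, -, hb⟩ : Homologous (push (tailMap n k) z) 0 := by
    refine h0 _ (by rw [bd_push, hz, map_zero]) ?_
    have := hz0.map (⟨Fin.tail, by unfold Fin.tail; fun_prop⟩ : C(Fin (n + 1) → S2, Fin n → S2))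
    rw [push_comp, map_zero] at this
    rw [push_comp]
    exact this
  rw [sub_zero] at hb
  obtain ⟨w, hwN, hw, hzw, hw0⟩ := excision (tailMap n k) (isClosed_nextLevel n k) hNo
    (fun x hx => Metric.self_subset_thickening hε _ hx) tailMap_injOn
    (fun m τ hτ => exists_lift_of_bijective_over (tailMap n k) (B := (nextLevel n k)ᶜ)
      tailMap_injOn (tailMap_surjOn hk) τ hτ) hz hb
  obtain ⟨w, rfl⟩ := exists_restrict hwN
  have hw' : bd _ w = 0 := push_valMap_injective _ (by rw [← bd_push, hw, map_zero])
  -- the part over the neighbourhood is deformed to a product with the sphere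
  let ν : C(N, level n (k + 1)) := ⟨fun x => ⟨collapse n x.1.1 1 x.1.1, hcol _ x.2⟩,
    (continuous_collapse (by fun_prop) continuous_const (by fun_prop)).subtype_mk _⟩
  let T : C(tailMap n k ⁻¹' N, N) := ⟨fun x => ⟨tailMap n k x.1, x.2⟩, by fun_prop⟩
  let ρ : C(tailMap n k ⁻¹' N, level n (k + 1) × S2) :=
    ⟨fun x => (ν (T x), collapse (n + 1) (T x).1.1 1 x.1.1 0),
      ((map_continuous ν).comp (map_continuous T)).prodMk ((continuous_apply 0).comp
        (continuous_collapse (by fun_prop) continuous_const (by fun_prop)))⟩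
  let j : C(level n (k + 1) × S2, level (n + 1) (k + 1)) :=
    ⟨fun x => ⟨Fin.cons x.2 x.1.1, cons_mem_level x.1.2 x.2⟩,
      ((map_continuous (consMap n)).comp
        ((continuous_subtype_val.comp continuous_fst).prodMk continuous_snd)).subtype_mk _⟩
  let F : C((tailMap n k ⁻¹' N) × I, level (n + 1) (k + 1)) :=
    ⟨fun x => ⟨collapse (n + 1) (T x.1).1.1 x.2 x.1.1.1, collapse_mem_level _ _ x.1.1.2⟩,
      (continuous_collapse (by fun_prop) (by fun_prop) (by fun_prop)).subtype_mk _⟩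
  have hF0 : F.comp (atTime _ 0) = valMap (tailMap n k ⁻¹' N) :=
    ContinuousMap.ext fun x => Subtype.ext (funext fun i => gather_zero_time _ _ _)
  have hF1 : F.comp (atTime _ 1) = j.comp ρ :=
    ContinuousMap.ext fun x => Subtype.ext (Fin.cons_self_tail (α := fun _ => S2)
      (collapse (n + 1) (T x).1.1 1 x.1.1)).symm
  have hj : Homologous (push j (push ρ w)) z := by
    have := HomologousIn.of_homotopy F (V := Set.univ) (fun _ => trivial) hw'
    rw [hF0, hF1] at this
    rw [push_comp]
    exact this.trans hzw.symm
  have hρ : bd _ (push ρ w) = 0 := by rw [bd_push, hw', map_zero]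
  -- the projection of the deformed cycle bounds, hence it is a cross product
  have hp : Homologous (push (proj _) (push ρ w)) 0 := by
    obtain ⟨c, hc, hwc⟩ := hw0
    obtain ⟨c, rfl⟩ := exists_restrict hc
    have e : push T w = bd _ c := push_valMap_injective _ (by
      rw [← bd_push, ← hwc, sub_zero, push_comp, push_comp]
      rfl)
    refine ⟨push ν c, mem_supp_univ _, ?_⟩
    rw [bd_push, ← e, sub_zero, push_comp, push_comp]
    rfl
  obtain ⟨u, hu, hwu⟩ := exists_homologous_add_cross hρ
  have hwu : Homologous (push ρ w) (cross _ u) := by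
    refine hwu.trans ?_
    have := (hp.map (atPoint _ basePt)).add (.refl _ (cross _ u))
    rwa [map_zero, zero_add] at this
  -- this cross product bounds in the product of all spheres
  have hcr : Homologous (cross _ (push (valMap (level n (k + 1))) u)) 0 := by
    rw [cross_push]
    refine (Homologous.map hwu.symm _).trans ?_
    have := Homologous.map ((hj.map (valMap _)).trans hz0) (unconsMap n)
    rw [push_comp, push_comp, map_zero] at this
    exact this
  have hu' : bd _ (push (valMap (level n (k + 1))) u) = 0 := by rw [bd_push, hu, map_zero]
  obtain ⟨c, -, hc⟩ := h1 u hu (homologous_zero_of_add_cross (map_zero _) hu'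
    (by rwa [map_zero, zero_add])).2
  rw [sub_zero] at hc
  have hcu : Homologous (cross _ u) 0 :=
    ⟨cross _ c, mem_supp_univ _, by rw [bd_cross, ← hc, sub_zero]⟩
  have := Homologous.map (hwu.trans hcu) j
  rw [map_zero] at this
  exact hj.symm.trans this

theorem levelInjective (n k : ℕ) : LevelInjective n k := by
  induction n generalizing k with
  | zero =>
    cases k with
    | zero => exact levelInjective_zero 0
    | succ k => exact levelInjective_of_isEmpty (isEmpty_level (by omega))
  | succ n ih =>
    cases k with
    | zero => exact levelInjective_zero _
    | succ k => exact levelInjective_succ (ih k) (ih (k + 1))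

theorem HTotMap_valMap_springer_injective (hn : Even n) :
    Function.Injective (HTotMap (valMap (springer n))) := by
  obtain ⟨k, rfl⟩ := hn
  rw [springer_eq_level]
  refine (injective_iff_map_eq_zero _).2 fun x hx => ?_
  obtain ⟨z, hz, rfl⟩ := exists_cls x
  rw [HTotMap_cls, cls_eq_zero_iff] at hx
  rw [cls_eq_zero_iff]
  exact levelInjective _ _ z hz hx

/-- The antipodal map in the coordinates at odd-numbered vertices, counted from `1`. -/
def alternate (n : ℕ) : C(Fin n → S2, Fin n → S2) where
  toFun x i := if Even ((i : ℕ) + 1) then x i else -x i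
  continuous_toFun := by
    refine continuous_pi fun i => ?_
    split_ifs
    exacts [continuous_apply i, (continuous_apply i).neg]

theorem alternate_comp_alternate (n : ℕ) : (alternate n).comp (alternate n) = .id _ :=
  ContinuousMap.ext fun x => funext fun i => by
    change (if _ then (if _ then _ else _) else -(if _ then _ else _)) = x i
    split_ifs
    exacts [rfl, neg_neg _]

theorem gammaMap_injective (n : ℕ) (hn : Even n) : Function.Injective (HTotMap (gammaMap n)) := by
  have e : gammaMap n = (alternate n).comp (valMap (springer n)) := rfl
  intro x y h
  rw [e, ← HTotMap_comp, ← HTotMap_comp] at h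
  exact HTotMap_valMap_springer_injective hn ((HTotMap_bijective_of_inverse _ _
    (alternate_comp_alternate n) (alternate_comp_alternate n)).1 h)

end Injectivity

end SpringerTwoRow
end

open SpringerTwoRow
theorem mainTheorem6 (n : ℕ) (hn : Even n) :
    (∃ B : Module.Basis (Finset (Fin n)) ℂ (HTot (Fin n → S2)),
      (∀ U, B U = lineDiagram U) ∧
      ∀ M : DottedMatching n, M.IsStandard →
        B.repr M.lineDiagramSum M.rightUndot = 1 ∧
        ∀ U, B.repr M.lineDiagramSum U ≠ 0 →
          U.card = M.rightUndot.card ∧ toColex U ≤ toColex M.rightUndot) ∧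
    Set.InjOn (fun M : DottedMatching n => M.rightUndot) {M | M.IsStandard} ∧
    (∀ M : DottedMatching n, M.IsStandard →
      HTotMap M.gammaMap M.homologyClass = M.lineDiagramSum ∧
      (HTotMap (gammaMap n) (HTotMap M.incl M.homologyClass) = M.lineDiagramSum ∨
        HTotMap (gammaMap n) (HTotMap M.incl M.homologyClass) = -M.lineDiagramSum)) ∧
    LinearIndependent ℂ
      (fun M : {M : DottedMatching n // M.IsStandard} => M.1.lineDiagramSum) ∧
    Function.Injective (HTotMap (gammaMap n)) := by
  obtain ⟨B, hB⟩ := exists_basis_setClass n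
  have hB' : ∀ U, B U = lineDiagram U := fun U => (hB U).trans (lineDiagram_eq_setClass U).symm
  refine ⟨⟨B, hB', fun M _ => ⟨repr_lineDiagramSum_rightUndot B hB' M, fun U hU => ?_⟩⟩,
    rightUndot_injOn,
    fun M _ => ⟨gammaMap_homologyClass M, gammaMap_incl_homologyClass M⟩,
    linearIndependent_lineDiagramSum B hB', gammaMap_injective n hn⟩
  have h := mem_undotSets_of_repr_ne_zero B hB' M hU
  exact ⟨(M.card_of_mem_undotSets h).trans
    (M.card_of_mem_undotSets M.rightUndot_mem_undotSets).symm, M.toColex_le h⟩
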